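/- Let $k_2>k_1>0$ and $k_{3,1},k_{3,2}>0$ with $k_{3,1}\neq 2k_2\neq k_{3,2}$. For $n\ge 1$ let $\mathcal L$ be the $2n\times 2n$ matrix of the diatomic chain $$(\mathcal L q)_p=\kappa_{p-1}(q_{p-1}-q_p)+\kappa_p(q_{p+1}-q_p),\quad 1\le p\le 2n,\qquad q_0=q_{2n+1}=0,$$ with $\kappa_0=k_{3,1}$, $\kappa_{2n}=k_{3,2}$, and, for $1\le p\le 2n-1$, $\kappa_p=k_1$ if $p$ is odd and $\kappa_p=k_2$ if $p$ is even. Let $-(\omega^{(j)})^2$ with $\omega^{(j)}>0$ $(1\le j\le 2n)$ be its distinct eigenvalues, with eigenvectors $u^{(j)}$. Assume that exactly two frequencies are isolated and that they lie in the band gap: with $n_1+n_2+2=2n$, the frequencies are numbered so that $2k_2<(\omega^{(1)})^2<\dots<(\omega^{(n_1)})^2<2k_1+2k_2$ (optical band), $(\omega^{(n_1+1)})^2,(\omega^{(n_1+2)})^2\in(2k_1,2k_2)$, and $2k_1>(\omega^{(2n-n_2+1)})^2>\dots>(\omega^{(2n)})^2>0$ (acoustic band). Let $$\mathbb D_1=\{2,\dots,n_1\},\quad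 \mathbb D_2=\{2n-n_2+1,\dots,2n\},\quad \mathbb D_3=\{n_1+1,\,2n-n_2\}.$$ Consider formal expansions $$\omega=\sum_{m\ge 0}\epsilon^m\omega^{<m>},\qquad Q(\tau)=\sum_{m\ge0}\epsilon^{m+1}Q^{<m>}(\tau)$$ which satisfy $\omega^2 Q''=\mathcal L Q+Q^{3}$ (componentwise cube) at every order in $\epsilon$, where each $Q^{<m>}$ is $C^2$, $$Q^{<m>}(\tau)=\sum_{j=1}^{2n}\sum_{k\ge1}c_{m,k,j}\frac{u^{(j)}}{|u^{(j)}|}\left(e^{ik\tau}+e^{-ik\tau}\right),$$ $\omega^{<0>}=\omega^{(1)}$, $Q^{<0>}(\tau)=\frac{u^{(1)}}{|u^{(1)}|}(e^{i\tau}+e^{-i\tau})$, $c_{0,1,1}=1$, and $c_{m,1,1}=0$ for $m\ge1$. For $C_1>0$ put $$\mathcal R_m=\frac{C_1f^mn^m}{m^2+2},\qquad f=\frac{40(k_2-k_1)}{k_1k_2}.$$ Then there is $N$, depending only on $k_1,k_2,k_{3,1},k_{3,2}$, such that for every $C_1>0$ there are $C_2,C_3,C_4,\delta>0$, independent of $n$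 and $m$, with $$C_1C_3=\tfrac1{16},\qquad \frac{27k_1k_2}{320\sqrt{2k_2}(k_2-k_1)}+\delta<C_1C_2=\frac{7k_1k_2}{80\sqrt{2k_2}(k_2-k_1)}<\frac{\pi^2k_1k_2}{64\sqrt{2k_2}(k_2-k_1)}-\delta,$$ such that for every $n\ge N$ for which the spectrum is as assumed, such an expansion exists, and every such expansion satisfies, for all $m\ge1$ and all $l\ge1$, \begin{align*} &(i)\ |\omega^{<2m>}|<\frac{C_2\mathcal R_m}{n^2};\qquad (ii)\ \sum_{j\in\mathbb D_1}|c_{2m,1,j}|<C_3\mathcal R_m;\\ &(iii)\ \sum_{j\in\mathbb D_2}|c_{2m,1,j}|<\frac{C_4\mathcal R_m}{n};\qquad (iv)\ \sum_{j\in\mathbb D_3}|c_{2m,1,j}|<\frac{C_4\mathcal R_m}{n^{5/2}};\\ &(v)\ \sum_{j=1}^{n_1}|c_{2m,2l+1,j}|<\frac{C_4\mathcal R_m}{n(2l+1)^2};\qquad (vi)\ \sum_{j\in\mathbb D_2}|c_{2m,2l+1,j}|<\frac{C_4\mathcal R_m}{n(2l+1)^2};\\ &(vii)\ \sum_{j\in\mathbb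 D_3}|c_{2m,2l+1,j}|<\frac{C_4\mathcal R_m}{n^{5/2}(2l+1)^2}. \end{align*} -/

import Mathlib

noncomputable section

namespace DiatomicChain

/-- Stiffness of the spring between masses `p` and `p + 1` (masses are numbered `1, …, 2n`, and
`0`, `2n + 1` are the fixed walls): `k31` and `k32` at the two ends, and `k1`, `k2` alternating
inside. -/
def spring (n : ℕ) (k1 k2 k31 k32 : ℝ) (p : ℕ) : ℝ :=
  if p = 0 then k31 else if p = 2 * n then k32 else if p % 2 = 1 then k1 else k2

/-- The matrix `L` of the linear chain `q'' = L q`. The index `i : Fin (2 * n)` stands for the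
mass number `i + 1`, whose left and right springs are `spring i` and `spring (i + 1)`. -/
def chainMatrix (n : ℕ) (k1 k2 k31 k32 : ℝ) : Matrix (Fin (2 * n)) (Fin (2 * n)) ℝ :=
  fun i p =>
    if p = i then
      -(spring n k1 k2 k31 k32 (i : ℕ) + spring n k1 k2 k31 k32 ((i : ℕ) + 1))
    else if (p : ℕ) = (i : ℕ) + 1 then spring n k1 k2 k31 k32 ((i : ℕ) + 1)
    else if (i : ℕ) = (p : ℕ) + 1 then spring n k1 k2 k31 k32 (i : ℕ)
    else 0

/-- `Ω j`, `u j` (`1 ≤ j ≤ 2n`) are all the eigenfrequencies and eigenvectors of the linear chain,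
numbered so that `1, …, n1` is the optical band in increasing order, the two numbers
`n1 + 1` and `2n - n2 = n1 + 2` are the isolated frequencies in the band gap, and
`2n - n2 + 1, …, 2n` is the acoustic band in decreasing order. -/
structure IsSpectrum (n : ℕ) (k1 k2 k31 k32 : ℝ) (n1 n2 : ℕ)
    (Ω : ℕ → ℝ) (u : ℕ → Fin (2 * n) → ℝ) : Prop where
  count : n1 + n2 + 2 = 2 * n
  pos : ∀ j ∈ Finset.Icc 1 (2 * n), 0 < Ω j
  ne_zero : ∀ j ∈ Finset.Icc 1 (2 * n), u j ≠ 0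
  eigen : ∀ j ∈ Finset.Icc 1 (2 * n),
    (chainMatrix n k1 k2 k31 k32).mulVec (u j) = (-(Ω j) ^ 2) • u j
  injOn : Set.InjOn Ω (Set.Icc 1 (2 * n))
  optical : ∀ j ∈ Finset.Icc 1 n1, 2 * k2 < (Ω j) ^ 2 ∧ (Ω j) ^ 2 < 2 * k1 + 2 * k2
  optical_mono : StrictMonoOn Ω (Set.Icc 1 n1)
  gap : ∀ j ∈ Finset.Icc (n1 + 1) (n1 + 2), 2 * k1 < (Ω j) ^ 2 ∧ (Ω j) ^ 2 < 2 * k2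
  acoustic : ∀ j ∈ Finset.Icc (2 * n - n2 + 1) (2 * n), (Ω j) ^ 2 < 2 * k1
  acoustic_anti : StrictAntiOn Ω (Set.Icc (2 * n - n2 + 1) (2 * n))

/-- The normalized vector `v / |v|` (Euclidean norm). -/
def unitState {N : ℕ} (v : Fin N → ℝ) (i : Fin N) : ℝ :=
  v i / Real.sqrt (∑ p, (v p) ^ 2)

/-- `ω = ∑ ε ^ m ω^{<m>}` and `Q(τ) = ∑ ε ^ (m + 1) Q^{<m>}(τ)` (with `ω^{<m>} = w m` and
`Q^{<m>} = Q m`) form the formal expansion, around the linear state number `1`, of a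
`2π`-periodic even solution of `ω² Q'' = L Q + Q³` (Hadamard cube), and
`Q^{<m>}(τ) = ∑_{j = 1}^{2n} ∑_{k ≥ 1} c_{m,k,j} (u^{(j)} / |u^{(j)}|) (e^{ikτ} + e^{-ikτ})`. -/
structure IsExpansion (n : ℕ) (k1 k2 k31 k32 : ℝ) (Ω : ℕ → ℝ) (u : ℕ → Fin (2 * n) → ℝ)
    (w : ℕ → ℝ) (Q : ℕ → ℝ → Fin (2 * n) → ℝ) (c : ℕ → ℕ → ℕ → ℝ) : Prop where
  smooth : ∀ m i, ContDiff ℝ 2 (fun τ => Q m τ i)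
  form : ∀ m τ i, HasSum
    (fun k : ℕ => ∑ j ∈ Finset.Icc 1 (2 * n),
      c m (k + 1) j * unitState (u j) i * (2 * Real.cos (((k : ℝ) + 1) * τ)))
    (Q m τ i)
  w_zero : w 0 = Ω 1
  Q_zero : ∀ τ i, Q 0 τ i = unitState (u 1) i * (2 * Real.cos τ)
  c_zero : c 0 1 1 = 1
  normalized : ∀ m, 1 ≤ m → c m 1 1 = 0
  /-- The equation, as an identity of formal power series in `ε`, at every time and mass. -/
  equation : ∀ τ i,
    (PowerSeries.mk w) ^ 2 *
        (PowerSeries.X * PowerSeries.mk (fun m => iteratedDeriv 2 (fun s => Q m s i) τ)) =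
      ∑ p, PowerSeries.C (chainMatrix n k1 k2 k31 k32 i p) *
          (PowerSeries.X * PowerSeries.mk (fun m => Q m τ p)) +
        (PowerSeries.X * PowerSeries.mk (fun m => Q m τ i)) ^ 3

/-- `f = 40 (k2 - k1) / (k1 k2)`. -/
def growth (k1 k2 : ℝ) : ℝ := 40 * (k2 - k1) / (k1 * k2)

/-- `R_m = C1 f ^ m n ^ m / (m² + 2)`. -/
def majorant (k1 k2 C1 : ℝ) (n m : ℕ) : ℝ :=
  C1 * growth k1 k2 ^ m * (n : ℝ) ^ m / ((m : ℝ) ^ 2 + 2)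

/-- Indices of the optical band other than the first one. -/
def D1 (n1 : ℕ) : Finset ℕ := Finset.Icc 2 n1

/-- Indices of the acoustic band. -/
def D2 (n n2 : ℕ) : Finset ℕ := Finset.Icc (2 * n - n2 + 1) (2 * n)

/-- Indices of the two isolated frequencies. -/
def D3 (n n1 n2 : ℕ) : Finset ℕ := {n1 + 1, 2 * n - n2}

end DiatomicChain

end

/-! ### The chain matrix, its three-term recurrence and its orthonormal eigenbasis. -/

noncomputable section
namespace DiatomicChain
open Finset

/-! The proof combines quantitative information on the linear spectrum near the lower edge of the
optical band with a majorant induction on the order of the expansion.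

Linear part. With `ν = ω² - (k1 + k2)`, an eigenvector restricted to either sublattice solves a
second-order recurrence with constant coefficients. In the two bands the characteristic roots lie on
the unit circle, so a normalized mode is spread out and has sup norm `O(n^(-1/2))`
(`abs_le_of_band`). In the gap the recurrence is hyperbolic, and the isolated modes have bounded
`ℓ¹` norm (`sum_abs_le_of_gap`), because for large `n` their frequencies keep a fixed distance from
the gap edges (`exists_gap_bound`); this uses that neither end spring equals `2 k2`. For an optical
mode, let `α` be the distance of its wave number from the band edge. As long as `α` is small, the
characteristic equation says that `n α - g(α)` is a multiple of `π`, where `g` is Lipschitz near `0`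
and `g(0) = 0`. Hence `α_1` is close to `π / n` and the small `α_j` are at least about `j π / n`
(`exists_optical_phases`). The dispersion relation is quadratic at the edge, with curvature `20 /
f`, so near the edge `Ω_j² - Ω_1²` is at least `180 (j² - 1) / (f n²)` (`exists_optical_spacing`).
The first mode is nearly a half sine wave on each sublattice, which gives sharp values for its sup
norm and fourth moment (`exists_first_mode_bounds`).

Nonlinear part. Odd orders vanish (`IsExpansion.odd_eq_zero`). Projection on the mode `j` and the
harmonic `k` gives scalar equations with divisors `k² Ω_1² - Ω_j²`; the resonant one, `j = k = 1`,
determines the frequency correction. The divisors are bounded away from zero, uniformly in `n`,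
except for `k = 1` and optical `j`, where they may be as small as `n^(-2)`. The cubic term is
estimated against a test vector that is bounded in `ℓ²`, in sup norm, or in `ℓ¹` (the three
`HarmSeq.abs_cubicCoef_le_*`). By duality the first estimate bounds the `ℓ²` norm of all modal
coefficients at once, and Cauchy-Schwarz against the square-summable inverse divisors gives (ii) in
`IsReduced.sum_first_lt`. A factor `1 / n` from the cubic term and `f n²` from the divisors explain
the growth `(f n)^m`. The sup estimate gives (i), the `ℓ¹` estimate gives (iv) and (vii), and the
remaining bounds follow from `ℓ²` and the nonresonant divisors. The induction closes since `F^m /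
(m² + 2)` reproduces itself under convolution up to a factor `4` (`sum_weight_mul_weight_le`); see
`orderBounds`.

Existence. Cosine polynomials with odd frequencies are stable under triple products and second
derivatives. On them each order is solved mode by mode, the frequency correction removing the only
resonance (`IsSpectrum.exists_isExpansion`). -/

/-- The eigenvalue equation `L q = -ω² q` of the chain with `ν = ω² - (k1 + k2)`, written as a
three-term recurrence for a sequence extended by the two virtual masses `0` and `2n + 1`. -/
structure IsChainSeq (n : ℕ) (k1 k2 k31 k32 ν : ℝ) (q : ℕ → ℝ) : Prop where
  left : k2 * q 0 = (k2 - k31) * q 1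
  right : k2 * q (2 * n + 1) = (k2 - k32) * q (2 * n)
  odd : ∀ p < n, -ν * q (2 * p + 1) = k2 * q (2 * p) + k1 * q (2 * p + 2)
  even : ∀ p < n, -ν * q (2 * p + 2) = k1 * q (2 * p + 1) + k2 * q (2 * p + 3)

theorem sum_fin_ite_val_eq (N m : ℕ) (x : ℝ) :
    ∑ p : Fin N, (if (p : ℕ) = m then x else 0) = if m < N then x else 0 := by
  split_ifs with h
  · rw [Finset.sum_eq_single (⟨m, h⟩ : Fin N)]
    · simp
    · intro b _ hb
      rw [if_neg]
      intro hbm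
      exact hb (Fin.ext hbm)
    · simp
  · apply Finset.sum_eq_zero
    intro p _
    rw [if_neg]
    have := p.2
    omega

/-- The wall conditions replace each end spring by a spring `k2` attached to a virtual mass, so that
the end rows take the same two-periodic form as the interior ones. -/
theorem chainMatrix_mulVec {n : ℕ} {k1 k2 k31 k32 : ℝ} {q : ℕ → ℝ}
    (h0 : k2 * q 0 = (k2 - k31) * q 1) (hN : k2 * q (2 * n + 1) = (k2 - k32) * q (2 * n))
    (i : Fin (2 * n)) :
    (chainMatrix n k1 k2 k31 k32).mulVec (fun p => q (p + 1)) i =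
      -(k1 + k2) * q (i + 1) +
        (if (i : ℕ) % 2 = 0 then k2 * q i + k1 * q (i + 2) else k1 * q i + k2 * q (i + 2)) := by
  have hi := i.2
  -- A row has at most three nonzero entries. Subtraction truncates at `i = 0`, where `i - 1` would
  -- repeat the diagonal; the inner test cancels that contribution.
  have key : ∀ p : Fin (2 * n), chainMatrix n k1 k2 k31 k32 i p * q (p + 1) =
      (if (p : ℕ) = (i : ℕ) then
        -(spring n k1 k2 k31 k32 i + spring n k1 k2 k31 k32 (i + 1)) * q (i + 1) else 0) +
      (if (p : ℕ) = (i : ℕ) + 1 then spring n k1 k2 k31 k32 (i + 1) * q (i + 2) else 0) +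
      (if (p : ℕ) = (i : ℕ) - 1 then (if (i : ℕ) = 0 then 0 else
        spring n k1 k2 k31 k32 i * q i) else 0) := by
    intro p
    unfold chainMatrix
    by_cases h1 : p = i
    · subst h1
      rcases Nat.eq_zero_or_pos (p : ℕ) with h | h
      · simp [h]
      · rw [if_pos rfl, if_pos rfl, if_neg (by omega), if_neg (by omega)]; ring
    · have h1' : (p : ℕ) ≠ i := fun h => h1 (Fin.ext h)
      rw [if_neg h1, if_neg h1']
      by_cases h2 : (p : ℕ) = i + 1
      · rw [if_pos h2, if_pos h2, if_neg (by omega), h2]; ring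
      · rw [if_neg h2, if_neg h2]
        by_cases h3 : (i : ℕ) = p + 1
        · rw [if_pos h3, if_pos (by omega), if_neg (by omega), h3]; ring
        · rw [if_neg h3]
          by_cases h4 : (p : ℕ) = i - 1
          · rw [if_pos h4, if_pos (by omega)]; ring
          · rw [if_neg h4]; ring
  simp only [Matrix.mulVec, dotProduct]
  rw [Finset.sum_congr rfl fun p _ => key p, Finset.sum_add_distrib, Finset.sum_add_distrib,
    sum_fin_ite_val_eq, sum_fin_ite_val_eq, sum_fin_ite_val_eq, if_pos hi]
  rw [if_pos (by omega : (i : ℕ) - 1 < 2 * n)]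
  generalize (i : ℕ) = a at *
  have s0 : a = 0 → spring n k1 k2 k31 k32 a = k31 := fun h => by simp [spring, h]
  have s1 : a ≠ 0 → a % 2 = 0 → spring n k1 k2 k31 k32 a = k2 := fun h h' => by
    unfold spring
    rw [if_neg h, if_neg (by omega), if_neg (by omega)]
  have s2 : a % 2 = 1 → spring n k1 k2 k31 k32 a = k1 := fun h => by
    unfold spring
    rw [if_neg (by omega), if_neg (by omega), if_pos h]
  have s3 : a % 2 = 0 → spring n k1 k2 k31 k32 (a + 1) = k1 := fun h => by
    unfold spring
    rw [if_neg (by omega), if_neg (by omega), if_pos (by omega)]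
  have s4 : a % 2 = 1 → a + 1 < 2 * n → spring n k1 k2 k31 k32 (a + 1) = k2 := fun h h' => by
    unfold spring
    rw [if_neg (by omega), if_neg (by omega), if_neg (by omega)]
  have s5 : a + 1 = 2 * n → spring n k1 k2 k31 k32 (a + 1) = k32 := fun h => by
    unfold spring
    rw [if_neg (by omega), if_pos h]
  rcases Nat.mod_two_eq_zero_or_one a with h | h
  · rw [if_pos h, s3 h, if_pos (by omega)]
    by_cases ha : a = 0
    · rw [s0 ha, if_pos ha, ha]
      linarith
    · rw [s1 ha h, if_neg ha]
      ring
  · rw [if_neg (by omega : ¬ a % 2 = 0), s2 h, if_neg (by omega : ¬ a = 0)]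
    by_cases hl : a + 1 < 2 * n
    · rw [if_pos hl, s4 h hl]
      ring
    · have hal : a + 1 = 2 * n := by omega
      rw [if_neg hl, s5 hal, show a + 2 = 2 * n + 1 by omega, hN, hal]
      ring

theorem IsChainSeq.mulVec_eq {n : ℕ} {k1 k2 k31 k32 ν : ℝ} {q : ℕ → ℝ}
    (h : IsChainSeq n k1 k2 k31 k32 ν q) :
    (chainMatrix n k1 k2 k31 k32).mulVec (fun p => q (p + 1)) =
      (-(ν + (k1 + k2))) • (fun p : Fin (2 * n) => q (p + 1)) := by
  ext i
  rw [chainMatrix_mulVec h.left h.right]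
  have hi := i.2
  simp only [Pi.smul_apply, smul_eq_mul]
  rcases Nat.even_or_odd' (i : ℕ) with ⟨p, hp | hp⟩
  · have := h.odd p (by omega)
    rw [if_pos (by omega), hp]
    linarith
  · have := h.even p (by omega)
    rw [if_neg (by omega), hp]
    simp only [add_assoc] at this ⊢
    norm_num at this ⊢
    linarith

theorem exists_isChainSeq {n : ℕ} {k1 k2 k31 k32 ν : ℝ} (hn : 0 < n) (hk2 : k2 ≠ 0)
    {v : Fin (2 * n) → ℝ}
    (h : (chainMatrix n k1 k2 k31 k32).mulVec v = (-(ν + (k1 + k2))) • v) :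
    ∃ q : ℕ → ℝ, IsChainSeq n k1 k2 k31 k32 ν q ∧ ∀ i : Fin (2 * n), v i = q (i + 1) := by
  let q : ℕ → ℝ := fun p =>
    if p = 0 then (k2 - k31) / k2 * v ⟨0, by omega⟩
    else if hp : p - 1 < 2 * n then v ⟨p - 1, hp⟩
    else (k2 - k32) / k2 * v ⟨2 * n - 1, by omega⟩
  have hq : ∀ i : Fin (2 * n), v i = q (i + 1) := by
    intro i
    simp [q]
  have hl : k2 * q 0 = (k2 - k31) * q 1 := by
    have : q 1 = v ⟨0, by omega⟩ := (hq ⟨0, by omega⟩).symm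
    rw [this]; simp [q]; field_simp
  have hr : k2 * q (2 * n + 1) = (k2 - k32) * q (2 * n) := by
    have : q (2 * n) = v ⟨2 * n - 1, by omega⟩ := by
      rw [hq]; congr 1; simp; omega
    rw [this]; simp [q]; field_simp
  have hv : v = fun p : Fin (2 * n) => q (p + 1) := funext hq
  have hrow : ∀ i : Fin (2 * n), -ν * q (i + 1) =
      (if (i : ℕ) % 2 = 0 then k2 * q i + k1 * q (i + 2) else k1 * q i + k2 * q (i + 2)) := by
    intro i
    have h1 := congrFun h i
    rw [hv, chainMatrix_mulVec hl hr] at h1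
    simp only [Pi.smul_apply, smul_eq_mul] at h1
    linarith
  refine ⟨q, ⟨hl, hr, ?_, ?_⟩, hq⟩
  · intro p hp
    have := hrow ⟨2 * p, by omega⟩
    rwa [if_pos (by simp)] at this
  · intro p hp
    have := hrow ⟨2 * p + 1, by omega⟩
    rwa [if_neg (by simp)] at this

theorem chainMatrix_symm {n : ℕ} {k1 k2 k31 k32 : ℝ} (i p : Fin (2 * n)) :
    chainMatrix n k1 k2 k31 k32 i p = chainMatrix n k1 k2 k31 k32 p i := by
  unfold chainMatrix
  by_cases h : p = i
  · subst h; rfl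
  · rw [if_neg h, if_neg (Ne.symm h)]
    have h1' : (p : ℕ) ≠ i := fun h' => h (Fin.ext h')
    by_cases h2 : (p : ℕ) = i + 1
    · rw [if_pos h2, if_neg (by omega), if_pos h2, h2]
    · by_cases h3 : (i : ℕ) = p + 1
      · rw [if_neg h2, if_pos h3, if_pos h3, h3]
      · rw [if_neg h2, if_neg h3, if_neg h3, if_neg h2]

theorem dotProduct_chainMatrix_mulVec {n : ℕ} {k1 k2 k31 k32 : ℝ} (v w : Fin (2 * n) → ℝ) :
    v ⬝ᵥ (chainMatrix n k1 k2 k31 k32).mulVec w =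
      (chainMatrix n k1 k2 k31 k32).mulVec v ⬝ᵥ w := by
  rw [Matrix.dotProduct_mulVec, ← Matrix.mulVec_transpose]
  congr 2
  ext i p
  exact chainMatrix_symm p i

theorem sq_sum_pos {N : ℕ} {v : Fin N → ℝ} (hv : v ≠ 0) : 0 < ∑ p, v p ^ 2 := by
  obtain ⟨i, hi⟩ := Function.ne_iff.mp hv
  exact Finset.sum_pos' (fun p _ => sq_nonneg _) ⟨i, Finset.mem_univ _, by
    have : v i ≠ 0 := hi
    positivity⟩

theorem unitState_eq_smul {N : ℕ} (v : Fin N → ℝ) :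
    unitState v = (Real.sqrt (∑ p, v p ^ 2))⁻¹ • v := by
  ext i; simp [unitState, div_eq_inv_mul]

theorem sum_unitState_sq {N : ℕ} {v : Fin N → ℝ} (hv : v ≠ 0) :
    ∑ i, unitState v i ^ 2 = 1 := by
  have h := sq_sum_pos hv
  simp only [unitState, div_pow, Real.sq_sqrt h.le]
  rw [← Finset.sum_div, div_self h.ne']

section Spectrum
variable {n : ℕ} {k1 k2 k31 k32 : ℝ} {n1 n2 : ℕ} {Ω : ℕ → ℝ} {u : ℕ → Fin (2 * n) → ℝ}

theorem IsSpectrum.unitState_eigen (hS : IsSpectrum n k1 k2 k31 k32 n1 n2 Ω u) {j : ℕ}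
    (hj : j ∈ Finset.Icc 1 (2 * n)) :
    (chainMatrix n k1 k2 k31 k32).mulVec (unitState (u j)) = (-(Ω j) ^ 2) • unitState (u j) := by
  rw [unitState_eq_smul, Matrix.mulVec_smul, hS.eigen j hj, smul_comm]

theorem IsSpectrum.sq_injOn (hS : IsSpectrum n k1 k2 k31 k32 n1 n2 Ω u) {i j : ℕ}
    (hi : i ∈ Finset.Icc 1 (2 * n)) (hj : j ∈ Finset.Icc 1 (2 * n)) (h : Ω i ^ 2 = Ω j ^ 2) :
    i = j := by
  apply hS.injOn (by simpa using hi) (by simpa using hj)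
  exact (pow_left_inj₀ (hS.pos i hi).le (hS.pos j hj).le two_ne_zero).mp h

theorem dotProduct_eq_zero_of_eigen {v w : Fin (2 * n) → ℝ} {a b : ℝ}
    (hv : (chainMatrix n k1 k2 k31 k32).mulVec v = a • v)
    (hw : (chainMatrix n k1 k2 k31 k32).mulVec w = b • w) (hab : a ≠ b) : v ⬝ᵥ w = 0 := by
  have h := dotProduct_chainMatrix_mulVec (k1 := k1) (k2 := k2) (k31 := k31) (k32 := k32) v w
  rw [hv, hw, dotProduct_smul, smul_dotProduct, smul_eq_mul, smul_eq_mul] at h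
  have : (a - b) * (v ⬝ᵥ w) = 0 := by linarith
  exact (mul_eq_zero.mp this).resolve_left (sub_ne_zero.mpr hab)

theorem IsSpectrum.orthonormal (hS : IsSpectrum n k1 k2 k31 k32 n1 n2 Ω u) {i j : ℕ}
    (hi : i ∈ Finset.Icc 1 (2 * n)) (hj : j ∈ Finset.Icc 1 (2 * n)) :
    ∑ p, unitState (u i) p * unitState (u j) p = if i = j then 1 else 0 := by
  split_ifs with h
  · subst h
    simpa [sq] using sum_unitState_sq (hS.ne_zero i hi)
  · refine dotProduct_eq_zero_of_eigen (hS.unitState_eigen hi) (hS.unitState_eigen hj) ?_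
    intro h'
    exact h (hS.sq_injOn hi hj (by linarith))

theorem sum_Icc_eq_sum_fin (N : ℕ) (f : ℕ → ℝ) :
    ∑ j ∈ Finset.Icc 1 N, f j = ∑ j : Fin N, f (j + 1) := by
  rw [Fin.sum_univ_eq_sum_range (fun j => f (j + 1)), Finset.range_eq_Ico,
    Finset.sum_Ico_add' f 0 N 1]
  rfl

/-- There are as many modes as masses, and a square matrix with orthonormal rows has orthonormal
columns. -/
theorem IsSpectrum.complete (hS : IsSpectrum n k1 k2 k31 k32 n1 n2 Ω u) (i p : Fin (2 * n)) :
    ∑ j ∈ Finset.Icc 1 (2 * n), unitState (u j) i * unitState (u j) p =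
      if i = p then 1 else 0 := by
  let P : Matrix (Fin (2 * n)) (Fin (2 * n)) ℝ := fun j i => unitState (u (j + 1)) i
  have hmem : ∀ j : Fin (2 * n), (j : ℕ) + 1 ∈ Finset.Icc 1 (2 * n) := by
    intro j; have := j.2; simp only [Finset.mem_Icc]; omega
  have h1 : P * P.transpose = 1 := by
    ext a b
    rw [Matrix.mul_apply, Matrix.one_apply]
    change ∑ x, unitState (u (a + 1)) x * unitState (u (b + 1)) x = _
    rw [hS.orthonormal (hmem a) (hmem b)]
    simp [Fin.ext_iff]
  have h2 : P.transpose * P = 1 := mul_eq_one_comm.mp h1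
  have h3 := congrFun (congrFun h2 i) p
  rw [Matrix.mul_apply, Matrix.one_apply] at h3
  rw [sum_Icc_eq_sum_fin]
  exact h3

theorem IsSpectrum.expand (hS : IsSpectrum n k1 k2 k31 k32 n1 n2 Ω u) (v : Fin (2 * n) → ℝ)
    (i : Fin (2 * n)) :
    v i = ∑ j ∈ Finset.Icc 1 (2 * n), (∑ p, unitState (u j) p * v p) * unitState (u j) i := by
  simp only [Finset.sum_mul]
  rw [Finset.sum_comm]
  have : ∀ p, ∑ j ∈ Finset.Icc 1 (2 * n), unitState (u j) p * v p * unitState (u j) i =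
      (if i = p then 1 else 0) * v p := by
    intro p
    rw [← hS.complete i p, Finset.sum_mul]
    exact Finset.sum_congr rfl fun j _ => by ring
  rw [Finset.sum_congr rfl fun p _ => this p]
  simp

theorem IsSpectrum.parseval (hS : IsSpectrum n k1 k2 k31 k32 n1 n2 Ω u) (v : Fin (2 * n) → ℝ) :
    ∑ j ∈ Finset.Icc 1 (2 * n), (∑ p, unitState (u j) p * v p) ^ 2 = ∑ i, v i ^ 2 := by
  have h : ∀ i, v i ^ 2 = ∑ j ∈ Finset.Icc 1 (2 * n),
      (∑ p, unitState (u j) p * v p) * (unitState (u j) i * v i) := by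
    intro i
    rw [sq]
    nth_rewrite 1 [hS.expand v i]
    rw [Finset.sum_mul]
    exact Finset.sum_congr rfl fun j _ => by ring
  rw [Finset.sum_congr rfl fun i _ => h i, Finset.sum_comm]
  refine Finset.sum_congr rfl fun j _ => ?_
  rw [← Finset.mul_sum, sq]

/-- An eigenvector for any other eigenvalue would be orthogonal to the whole basis. This identifies
explicitly constructed eigenvectors with members of the list. -/
theorem IsSpectrum.exists_index (hS : IsSpectrum n k1 k2 k31 k32 n1 n2 Ω u)
    {v : Fin (2 * n) → ℝ} (hv : v ≠ 0) {a : ℝ}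
    (h : (chainMatrix n k1 k2 k31 k32).mulVec v = (-a) • v) :
    ∃ j ∈ Finset.Icc 1 (2 * n), Ω j ^ 2 = a := by
  by_contra! hcon
  apply hv
  ext i
  rw [hS.expand v i]
  apply Finset.sum_eq_zero
  intro j hj
  have : unitState (u j) ⬝ᵥ v = 0 := by
    refine dotProduct_eq_zero_of_eigen (hS.unitState_eigen hj) h ?_
    intro h'
    exact hcon j hj (by linarith)
  have h2 : ∑ p, unitState (u j) p * v p = 0 := this
  rw [h2, zero_mul]

end Spectrum
end DiatomicChain
end

/-! ### Size of the eigenvectors in the bands and in the gap, and the characteristic equation. -/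

noncomputable section
namespace DiatomicChain
open Finset

section Sequences

/-- In `t` both sides satisfy the recurrence of `cos (t α)`. Arguing through reflections avoids an
explicit formula for `x`, which would degenerate when `sin α = 0`. -/
theorem add_reflect_eq_cos_mul {N : ℕ} {α : ℝ} {x : ℕ → ℝ}
    (h : ∀ p, p + 2 < N → x (p + 2) + x p = 2 * Real.cos α * x (p + 1)) (m : ℕ) :
    ∀ t, t ≤ m → m + t < N → x (m + t) + x (m - t) = 2 * Real.cos (t * α) * x m
  | 0, _, _ => by simp; ring
  | 1, ht, hN => by
      obtain ⟨k, rfl⟩ := Nat.exists_eq_add_of_le' ht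
      have := h k (by omega)
      simpa [add_assoc] using this
  | t + 2, ht, hN => by
      have h1 := add_reflect_eq_cos_mul h m t (by omega) (by omega)
      have h2 := add_reflect_eq_cos_mul h m (t + 1) (by omega) (by omega)
      have h3 := h (m + t) (by omega)
      have h4 := h (m - (t + 2)) (by omega)
      rw [show m - (t + 2) + 2 = m - t by omega, show m - (t + 2) + 1 = m - (t + 1) by omega] at h4
      have h5 : Real.cos ((t + 2 : ℕ) * α) =
          2 * Real.cos α * Real.cos ((t + 1 : ℕ) * α) - Real.cos (t * α) := by
        have e1 : ((t + 2 : ℕ) : ℝ) * α = ((t + 1 : ℕ) : ℝ) * α + α := by push_cast; ring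
        have e2 : (t : ℝ) * α = ((t + 1 : ℕ) : ℝ) * α - α := by push_cast; ring
        rw [e1, e2, Real.cos_add, Real.cos_sub]; ring
      rw [h5, show m + (t + 2) = m + t + 2 by omega]
      have h2' : x (m + t + 1) + x (m - (t + 1)) = 2 * Real.cos ((t + 1 : ℕ) * α) * x m := h2
      linear_combination h3 + h4 - h1 + 2 * Real.cos α * h2'

/-- The reflection identity expresses `x p` by a midpoint and a far point in `T` different ways;
averaging their squares shows that no single value can dominate. -/
theorem sq_mul_le_sum_sq_right {N T : ℕ} {α : ℝ} {x : ℕ → ℝ}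
    (h : ∀ p, p + 2 < N → x (p + 2) + x p = 2 * Real.cos α * x (p + 1)) {p : ℕ}
    (hT : p + 2 * T < N) : x p ^ 2 * T ≤ 9 * ∑ i ∈ range N, x i ^ 2 := by
  have key : ∀ t ∈ range T, x p ^ 2 ≤ 6 * x (p + t + 1) ^ 2 + 3 * x (p + 2 * (t + 1)) ^ 2 := by
    intro t ht
    have ht' := mem_range.mp ht
    have h1 := add_reflect_eq_cos_mul h (p + t + 1) (t + 1) (by omega) (by omega)
    rw [show p + t + 1 + (t + 1) = p + 2 * (t + 1) by ring,
      show p + t + 1 - (t + 1) = p by omega] at h1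
    have hc := Real.cos_sq_le_one (((t + 1 : ℕ) : ℝ) * α)
    have hx : x p = 2 * Real.cos (((t + 1 : ℕ) : ℝ) * α) * x (p + t + 1) - x (p + 2 * (t + 1)) := by
      linarith
    rw [hx]
    set C := Real.cos (((t + 1 : ℕ) : ℝ) * α)
    -- The weights come from `(2 C a - b)² + 2 (C a + b)² = 6 C² a² + 3 b²`.
    nlinarith [sq_nonneg (C * x (p + t + 1) + x (p + 2 * (t + 1))),
      mul_le_mul_of_nonneg_right hc (sq_nonneg (x (p + t + 1)))]
  have h1 : ∑ t ∈ range T, x (p + t + 1) ^ 2 ≤ ∑ i ∈ range N, x i ^ 2 := by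
    rw [← sum_image (f := fun i => x i ^ 2) (g := fun t => p + t + 1) (s := range T)
      (fun a _ b _ hab => by simp only at hab; omega)]
    refine sum_le_sum_of_subset_of_nonneg ?_ fun _ _ _ => sq_nonneg _
    intro i hi
    simp only [mem_image, mem_range] at hi ⊢
    omega
  have h2 : ∑ t ∈ range T, x (p + 2 * (t + 1)) ^ 2 ≤ ∑ i ∈ range N, x i ^ 2 := by
    rw [← sum_image (f := fun i => x i ^ 2) (g := fun t => p + 2 * (t + 1)) (s := range T)
      (fun a _ b _ hab => by simp only at hab; omega)]
    refine sum_le_sum_of_subset_of_nonneg ?_ fun _ _ _ => sq_nonneg _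
    intro i hi
    simp only [mem_image, mem_range] at hi ⊢
    omega
  have h3 := sum_le_sum key
  rw [sum_const, card_range, nsmul_eq_mul, sum_add_distrib, ← mul_sum, ← mul_sum] at h3
  linarith

/-- With `T = (N - 1) / 4` there is always room for `2 T` steps to one side of `p`; the left side is
reduced to the right one by reversing the sequence. From `N = 16` on, `9 N ≤ 49 T`. -/
theorem sq_mul_le_sum_sq {N : ℕ} (hN : 16 ≤ N) {α : ℝ} {x : ℕ → ℝ}
    (h : ∀ p, p + 2 < N → x (p + 2) + x p = 2 * Real.cos α * x (p + 1)) {p : ℕ} (hp : p < N) :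
    x p ^ 2 * N ≤ 49 * ∑ i ∈ range N, x i ^ 2 := by
  have key : x p ^ 2 * ((N - 1) / 4 : ℕ) ≤ 9 * ∑ i ∈ range N, x i ^ 2 := by
    by_cases hp2 : p + 2 * ((N - 1) / 4) < N
    · exact sq_mul_le_sum_sq_right h hp2
    · have h' : ∀ p, p + 2 < N → x (N - 1 - (p + 2)) + x (N - 1 - p) =
          2 * Real.cos α * x (N - 1 - (p + 1)) := by
        intro p hp
        have := h (N - 1 - (p + 2)) (by omega)
        rw [show N - 1 - (p + 2) + 2 = N - 1 - p by omega,
          show N - 1 - (p + 2) + 1 = N - 1 - (p + 1) by omega] at this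
        linarith
      have := sq_mul_le_sum_sq_right (x := fun i => x (N - 1 - i)) h' (p := N - 1 - p)
        (T := (N - 1) / 4) (by omega)
      rw [sum_range_reflect (fun i => x i ^ 2) N] at this
      rwa [show N - 1 - (N - 1 - p) = p by omega] at this
  have hT : (N : ℝ) ≤ 49 / 9 * ((N - 1) / 4 : ℕ) := by
    have h1 : 9 * N ≤ 49 * ((N - 1) / 4) := by omega
    have h2 : (9 : ℝ) * N ≤ 49 * ((N - 1) / 4 : ℕ) := by exact_mod_cast h1
    linarith
  have := mul_le_mul_of_nonneg_left hT (sq_nonneg (x p))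
  linarith

/-- Summing the strict convexity inequality telescopes everything except `κ` times the sum and
boundary terms, so the bound does not depend on the length. -/
theorem mul_sum_abs_le_of_convex {κ : ℝ} {y : ℕ → ℝ} (M : ℕ) (hy0 : ∀ p, 0 ≤ y p)
    (hy1 : ∀ p < M + 2, y p ≤ 1)
    (h : ∀ p < M, (2 + κ) * y (p + 1) ≤ y p + y (p + 2)) (hκ : 0 ≤ κ) :
    κ * ∑ i ∈ range (M + 2), y i ≤ 2 + 2 * κ := by
  have h1 := sum_le_sum fun p (hp : p ∈ range M) => h p (mem_range.mp hp)
  rw [sum_add_distrib, ← mul_sum] at h1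
  have h2 : ∑ p ∈ range (M + 1), y p = ∑ p ∈ range M, y (p + 1) + y 0 := sum_range_succ' _ _
  have h3 : ∑ p ∈ range (M + 1), y p = ∑ p ∈ range M, y p + y M := sum_range_succ _ _
  have h4 : ∑ p ∈ range (M + 1), y (p + 1) = ∑ p ∈ range M, y (p + 2) + y 1 := sum_range_succ' _ _
  have h5 : ∑ p ∈ range (M + 1), y (p + 1) = ∑ p ∈ range M, y (p + 1) + y (M + 1) :=
    sum_range_succ _ _
  have h6 : ∑ i ∈ range (M + 2), y i = ∑ p ∈ range (M + 1), y (p + 1) + y 0 := sum_range_succ' _ _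
  have a0 := hy1 0 (by omega)
  have a1 := hy1 (M + 1) (by omega)
  have b1 := hy0 M
  have b2 := hy0 1
  rw [h6, h5]
  nlinarith

end Sequences

theorem sum_fin_two_mul (n : ℕ) (f : ℕ → ℝ) :
    ∑ i : Fin (2 * n), f i = ∑ p ∈ range n, f (2 * p) + ∑ p ∈ range n, f (2 * p + 1) := by
  rw [Fin.sum_univ_eq_sum_range f, ← sum_add_distrib]
  induction n with
  | zero => simp
  | succ n ih => rw [sum_range_succ, ← ih, show 2 * (n + 1) = 2 * n + 1 + 1 by ring,
      sum_range_succ, sum_range_succ, add_assoc]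

section Chain
variable {n : ℕ} {k1 k2 k31 k32 ν : ℝ} {q : ℕ → ℝ}

theorem IsChainSeq.even_step (h : IsChainSeq n k1 k2 k31 k32 ν q) {p : ℕ} (hp : p + 1 < n) :
    k1 * k2 * (q (2 * p + 4) + q (2 * p)) = (ν ^ 2 - k1 ^ 2 - k2 ^ 2) * q (2 * p + 2) := by
  have h1 := h.odd p (by omega)
  have h2 := h.even p (by omega)
  have h3 := h.odd (p + 1) hp
  rw [show 2 * (p + 1) + 1 = 2 * p + 3 by ring, show 2 * (p + 1) = 2 * p + 2 by ring,
    show 2 * p + 2 + 2 = 2 * p + 4 by ring] at h3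
  linear_combination ν * h2 - k1 * h1 - k2 * h3

theorem IsChainSeq.odd_step (h : IsChainSeq n k1 k2 k31 k32 ν q) {p : ℕ} (hp : p + 1 < n) :
    k1 * k2 * (q (2 * p + 5) + q (2 * p + 1)) = (ν ^ 2 - k1 ^ 2 - k2 ^ 2) * q (2 * p + 3) := by
  have h1 := h.even p (by omega)
  have h2 := h.even (p + 1) (by omega)
  have h3 := h.odd (p + 1) hp
  rw [show 2 * (p + 1) + 1 = 2 * p + 3 by ring, show 2 * (p + 1) = 2 * p + 2 by ring,
    show 2 * p + 2 + 2 = 2 * p + 4 by ring] at h3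
  rw [show 2 * (p + 1) + 1 = 2 * p + 3 by ring, show 2 * (p + 1) + 3 = 2 * p + 5 by ring,
    show 2 * (p + 1) + 2 = 2 * p + 4 by ring] at h2
  linear_combination ν * h3 - k2 * h1 - k1 * h2

/-- The band conditions on `ν²` say exactly that the sublattice recurrence has a coefficient of the
form `2 cos α`; the constant `7` is the square root of the `49` in `sq_mul_le_sum_sq`. -/
theorem abs_le_of_band (hn : 16 ≤ n) (hk1 : 0 < k1) (hk2 : 0 < k2)
    (hlo : (k2 - k1) ^ 2 ≤ ν ^ 2) (hhi : ν ^ 2 ≤ (k1 + k2) ^ 2) {v : Fin (2 * n) → ℝ}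
    (hv : (chainMatrix n k1 k2 k31 k32).mulVec v = (-(ν + (k1 + k2))) • v)
    (hv1 : ∑ i, v i ^ 2 = 1) (i : Fin (2 * n)) : |v i| ≤ 7 / Real.sqrt n := by
  obtain ⟨q, hq, hvq⟩ := exists_isChainSeq (by omega) hk2.ne' hv
  have hkk : 0 < k1 * k2 := mul_pos hk1 hk2
  have hcos : Real.cos (Real.arccos ((ν ^ 2 - k1 ^ 2 - k2 ^ 2) / (2 * (k1 * k2)))) =
      (ν ^ 2 - k1 ^ 2 - k2 ^ 2) / (2 * (k1 * k2)) := by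
    apply Real.cos_arccos
    · rw [le_div_iff₀ (by positivity)]; nlinarith
    · rw [div_le_iff₀ (by positivity)]; nlinarith
  have hsum : ∑ p ∈ range n, q (2 * p + 1) ^ 2 + ∑ p ∈ range n, q (2 * p + 2) ^ 2 = 1 := by
    rw [← hv1]
    simp only [hvq]
    rw [sum_fin_two_mul n (fun i => q (i + 1) ^ 2)]
  have ha := sum_nonneg fun p (_ : p ∈ range n) => sq_nonneg (q (2 * p + 1))
  have hb := sum_nonneg fun p (_ : p ∈ range n) => sq_nonneg (q (2 * p + 2))
  have hn0 : (0 : ℝ) < n := by exact_mod_cast (by omega : 0 < n)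
  have key : v i ^ 2 * n ≤ 49 := by
    rw [hvq]
    have hi := i.2
    rcases Nat.even_or_odd' (i : ℕ) with ⟨p, hp | hp⟩
    · have := sq_mul_le_sum_sq (x := fun p => q (2 * p + 1)) hn
        (α := Real.arccos ((ν ^ 2 - k1 ^ 2 - k2 ^ 2) / (2 * (k1 * k2)))) (by
          intro p hp
          have := hq.odd_step (p := p) (by omega)
          rw [hcos]
          simp only [show 2 * (p + 2) + 1 = 2 * p + 5 by ring,
            show 2 * (p + 1) + 1 = 2 * p + 3 by ring]
          field_simp
          linarith) (p := p) (by omega)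
      rw [hp]
      linarith
    · have := sq_mul_le_sum_sq (x := fun p => q (2 * p + 2)) hn
        (α := Real.arccos ((ν ^ 2 - k1 ^ 2 - k2 ^ 2) / (2 * (k1 * k2)))) (by
          intro p hp
          have := hq.even_step (p := p + 1) (by omega)
          rw [hcos]
          simp only [show 2 * (p + 1) = 2 * p + 2 by ring, show 2 * p + 2 + 4 = 2 * p + 6 by ring,
            show 2 * p + 2 + 2 = 2 * p + 4 by ring,
            show 2 * (p + 2) + 2 = 2 * p + 6 by ring] at this ⊢
          field_simp
          linarith) (p := p) (by omega)
      rw [hp]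
      simp only [add_assoc] at this ⊢
      norm_num at this ⊢
      linarith
  rw [le_div_iff₀ (Real.sqrt_pos.mpr hn0)]
  apply abs_le_of_sq_le_sq' _ (by norm_num) |>.2
  rw [mul_pow, sq_abs, Real.sq_sqrt hn0.le]
  linarith

/-- Inside the gap the coefficient of the recurrence exceeds `2` in modulus by at least `d / (k1
k2)`, so the moduli on each sublattice are strictly convex. -/
theorem sum_abs_le_of_gap (hn : 2 ≤ n) (hk1 : 0 < k1) (hk2 : 0 < k2) {d : ℝ} (hd : 0 < d)
    (hν : ν ^ 2 ≤ (k2 - k1) ^ 2 - d) {v : Fin (2 * n) → ℝ}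
    (hv : (chainMatrix n k1 k2 k31 k32).mulVec v = (-(ν + (k1 + k2))) • v)
    (hv1 : ∑ i, v i ^ 2 = 1) : ∑ i, |v i| ≤ 4 + 4 * (k1 * k2) / d := by
  obtain ⟨q, hq, hvq⟩ := exists_isChainSeq (by omega) hk2.ne' hv
  have hkk : 0 < k1 * k2 := mul_pos hk1 hk2
  have hle : ∀ i, |v i| ≤ 1 := by
    intro i
    apply abs_le_one_iff_mul_self_le_one.mpr
    rw [← sq, ← hv1]
    exact single_le_sum (f := fun i => v i ^ 2) (fun i _ => sq_nonneg _) (mem_univ i)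
  have hle' : ∀ p < 2 * n, |q (p + 1)| ≤ 1 := fun p hp => by
    have := hle ⟨p, hp⟩
    rwa [hvq] at this
  have step : ∀ a b c : ℝ, k1 * k2 * (c + a) = (ν ^ 2 - k1 ^ 2 - k2 ^ 2) * b →
      (2 + d / (k1 * k2)) * |b| ≤ |a| + |c| := by
    intro a b c h
    have h1 : k1 * k2 * |c + a| = (k1 ^ 2 + k2 ^ 2 - ν ^ 2) * |b| := by
      have h0 := congrArg abs h
      rw [abs_mul, abs_mul _ b, abs_of_pos hkk, abs_of_nonpos
        (show ν ^ 2 - k1 ^ 2 - k2 ^ 2 ≤ 0 by nlinarith)] at h0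
      rw [h0]; ring
    have h2 : (2 * (k1 * k2) + d) * |b| ≤ k1 * k2 * |c + a| := by
      rw [h1]
      exact mul_le_mul_of_nonneg_right (by nlinarith) (abs_nonneg _)
    have h3 : k1 * k2 * ((2 + d / (k1 * k2)) * |b|) ≤ k1 * k2 * (|a| + |c|) := by
      have e : k1 * k2 * ((2 + d / (k1 * k2)) * |b|) = (2 * (k1 * k2) + d) * |b| := by
        field_simp
      rw [e]
      refine h2.trans (mul_le_mul_of_nonneg_left ?_ hkk.le)
      rw [add_comm |a|]
      exact abs_add_le _ _
    exact le_of_mul_le_mul_left h3 hkk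
  obtain ⟨M, rfl⟩ := Nat.exists_eq_add_of_le' hn
  have hκ : 0 < d / (k1 * k2) := by positivity
  have A := mul_sum_abs_le_of_convex (y := fun p => |q (2 * p + 1)|) M (fun p => abs_nonneg _)
    (fun p hp => hle' _ (by omega)) (fun p hp => step _ _ _ (hq.odd_step (p := p) (by omega))) hκ.le
  have B := mul_sum_abs_le_of_convex (y := fun p => |q (2 * p + 2)|) M (fun p => abs_nonneg _)
    (fun p hp => hle' _ (by omega)) (fun p hp => step _ _ _
      (hq.even_step (p := p + 1) (by omega))) hκ.le
  have hsum : ∑ i, |v i| =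
      ∑ p ∈ range (M + 2), |q (2 * p + 1)| + ∑ p ∈ range (M + 2), |q (2 * p + 2)| := by
    simp only [hvq]
    rw [sum_fin_two_mul (M + 2) (fun i => |q (i + 1)|)]
  have key : d / (k1 * k2) * ∑ i, |v i| ≤ d / (k1 * k2) * (4 + 4 * (k1 * k2) / d) := by
    have e : d / (k1 * k2) * (4 + 4 * (k1 * k2) / d) = 4 * (d / (k1 * k2)) + 4 := by
      field_simp
    rw [hsum, e]
    linarith
  exact le_of_mul_le_mul_left key hκ

/-- An eigenvector is determined by its first entry. Hence `q 1` is nonzero and can be cancelled in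
the characteristic equation. -/
theorem IsChainSeq.eq_zero (h : IsChainSeq n k1 k2 k31 k32 ν q) (hk1 : k1 ≠ 0) (hk2 : k2 ≠ 0)
    (h1 : q 1 = 0) : ∀ p < n, q (2 * p) = 0 ∧ q (2 * p + 1) = 0 ∧ q (2 * p + 2) = 0 := by
  have aux : ∀ p < n, q (2 * p) = 0 → q (2 * p + 1) = 0 → q (2 * p + 2) = 0 := by
    intro p hp a b
    have := h.odd p hp
    rw [a, b] at this
    have : k1 * q (2 * p + 2) = 0 := by linarith
    exact (mul_eq_zero.mp this).resolve_left hk1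
  intro p
  induction p with
  | zero =>
    intro hp
    have h0 : q 0 = 0 := by
      have := h.left
      rw [h1, mul_zero] at this
      exact (mul_eq_zero.mp this).resolve_left hk2
    exact ⟨h0, h1, aux 0 hp h0 h1⟩
  | succ p ih =>
    intro hp
    obtain ⟨a, b, c⟩ := ih (by omega)
    have h3 := h.even p (by omega)
    rw [b, c] at h3
    have h4 : k2 * q (2 * p + 3) = 0 := by linarith
    have h5 := (mul_eq_zero.mp h4).resolve_left hk2
    exact ⟨c, h5, aux (p + 1) hp c h5⟩

/-- The coefficients of the characteristic equation of the chain. -/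
def secA (k1 k2 k31 k32 ν : ℝ) : ℝ :=
  (k2 ^ 2 + ν * (k2 - k32)) * (k2 * (ν + (k2 - k31))) + k1 ^ 2 * k2 * (k2 - k31)

/-- See `secA`. -/
def secP (k1 k2 k31 ν : ℝ) : ℝ := k1 * k2 ^ 2 * (ν + (k2 - k31))

/-- See `secA`. -/
def secR (k1 k2 k31 k32 ν : ℝ) : ℝ := (k2 ^ 2 + ν * (k2 - k32)) * (k1 * (k2 - k31))

/-- With alternating signs the even sites obey the recurrence of `s`, so agreement at the first two
indices suffices. The sequence `s` stays abstract: it will be `sin (p α)` in the optical band and `x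
^ p - y ^ p` in the gap. -/
theorem IsChainSeq.mul_eq (h : IsChainSeq n k1 k2 k31 k32 ν q) (hk1 : k1 ≠ 0) (hk2 : k2 ≠ 0)
    {c : ℝ} (hc : 2 * (k1 * k2) * c = k1 ^ 2 + k2 ^ 2 - ν ^ 2) {s : ℕ → ℝ} (hs0 : s 0 = 0)
    (hs : ∀ p, s (p + 2) = 2 * c * s (p + 1) - s p) :
    ∀ p < n, k1 * k2 * (-1) ^ (p + 1) * q (2 * p + 2) * s 1 =
      q 1 * (k2 * (ν + (k2 - k31)) * s (p + 1) - k1 * (k2 - k31) * s p)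
  | 0, hp => by
      have h1 := h.odd 0 hp
      have h2 := h.left
      simp only [mul_zero, zero_add] at h1 ⊢
      rw [hs0]
      linear_combination (k2 * h1 + k2 * h2) * s 1
  | 1, hp => by
      have h0 := IsChainSeq.mul_eq h hk1 hk2 hc hs0 hs 0 (by omega)
      have h3 := h.even_step (p := 0) hp
      have h2 := h.left
      have h5 := hs 0
      simp only [mul_zero, zero_add, mul_one] at *
      rw [h5]
      norm_num at *
      rw [hs0] at h0 ⊢
      have : k1 * k2 * q 4 = -(2 * (k1 * k2) * c) * q 2 - k1 * k2 * q 0 := by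
        rw [hc]; linear_combination h3
      linear_combination s 1 * this + 2 * c * h0 - k1 * s 1 * h2
  | p + 2, hp => by
      have h0 := IsChainSeq.mul_eq h hk1 hk2 hc hs0 hs p (by omega)
      have h1 := IsChainSeq.mul_eq h hk1 hk2 hc hs0 hs (p + 1) (by omega)
      have h3 := h.even_step (p := p + 1) (by omega)
      rw [show 2 * (p + 1) + 4 = 2 * (p + 2) + 2 by ring,
        show 2 * (p + 1) = 2 * p + 2 by ring, ← show 2 * (p + 1) + 2 = 2 * p + 2 + 2 by ring] at h3
      have : k1 * k2 * q (2 * (p + 2) + 2) =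
          -(2 * (k1 * k2) * c) * q (2 * (p + 1) + 2) - k1 * k2 * q (2 * p + 2) := by
        rw [hc]; linear_combination h3
      have e1 := hs (p + 1)
      have e2 := hs p
      rw [show p + 2 + 1 = p + 1 + 2 by ring, e1, pow_succ, pow_succ]
      rw [pow_succ] at h1
      rw [show p + 1 + 1 = p + 2 by ring] at *
      linear_combination (-1) ^ (p + 1) * s 1 * this + 2 * c * h1 - h0 +
        q 1 * (k1 * (k2 - k31)) * e2

/-- The right wall gives one linear relation between the last two even sites; inserting
`IsChainSeq.mul_eq` leaves a condition on `ν` alone. -/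
theorem IsChainSeq.secular (h : IsChainSeq n k1 k2 k31 k32 ν q) (hn : 2 ≤ n) (hk1 : k1 ≠ 0)
    (hk2 : k2 ≠ 0) (hq : q 1 ≠ 0)
    {c : ℝ} (hc : 2 * (k1 * k2) * c = k1 ^ 2 + k2 ^ 2 - ν ^ 2) {s : ℕ → ℝ} (hs0 : s 0 = 0)
    (hs : ∀ p, s (p + 2) = 2 * c * s (p + 1) - s p) :
    secA k1 k2 k31 k32 ν * s n =
      secP k1 k2 k31 ν * s (n + 1) + secR k1 k2 k31 k32 ν * s (n - 1) := by
  obtain ⟨m, rfl⟩ := Nat.exists_eq_add_of_le' hn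
  have h0 := h.mul_eq hk1 hk2 hc hs0 hs m (by omega)
  have h1 := h.mul_eq hk1 hk2 hc hs0 hs (m + 1) (by omega)
  have h2 := h.even (m + 1) (by omega)
  have h3 := h.odd (m + 1) (by omega)
  have h4 := h.right
  rw [show 2 * (m + 1) + 3 = 2 * (m + 2) + 1 by ring] at h2
  rw [show 2 * (m + 2) = 2 * (m + 1) + 2 by ring] at h2 h4
  rw [show 2 * (m + 1) = 2 * m + 2 by ring] at h1 h2 h3 h4
  rw [show m + 2 - 1 = m + 1 by omega]
  have e := hs (m + 1)
  have e0 := hs m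
  have h5 : (k2 ^ 2 + ν * (k2 - k32) - 2 * (k1 * k2) * c) * q (2 * m + 2 + 2) =
      k1 * k2 * q (2 * m + 2) := by
    rw [hc]
    linear_combination -ν * h4 - ν * h2 + k1 * h3
  rw [show m + 1 + 1 = m + 2 by ring, pow_succ] at h1
  have : q 1 * (secA k1 k2 k31 k32 ν * s (m + 2)) =
      q 1 * (secP k1 k2 k31 ν * s (m + 2 + 1) + secR k1 k2 k31 k32 ν * s (m + 1)) := by
    rw [show m + 2 + 1 = m + 1 + 2 by ring, e]
    unfold secA secP secR
    rw [show m + 1 + 1 = m + 2 by ring]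
    linear_combination -k1 * k2 * (-1) ^ (m + 1) * s 1 * h5 - k1 * k2 * h0 -
      (k2 ^ 2 + ν * (k2 - k32) - 2 * (k1 * k2) * c) * h1 + q 1 * k1 ^ 2 * k2 * (k2 - k31) * e0
  exact mul_left_cancel₀ hq this

end Chain
end DiatomicChain
end

/-! ### The isolated frequencies keep away from the edges of the gap. -/

noncomputable section
namespace DiatomicChain
open Finset Filter Topology

section GapEdges

/-- In the gap the characteristic roots are `X > 1` and `Y = 1 / X`, and the characteristic equation
becomes `(X ^ (2 n) - 1) Z = (P - R) (X - Y)`. Near the edge `Z` stays away from zero while the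
other coefficient is bounded, and the left factor is at least `2 n (X - 1)` whereas `X - Y ≤ 2 (X -
1)`. This is impossible for large `n`, however close `ν` is to the edge. -/
theorem exists_no_eigen_near_edge {k1 k2 k31 k32 e : ℝ} (hk1 : 0 < k1) (hk2 : 0 < k2)
    (he : e ^ 2 = (k2 - k1) ^ 2)
    (hZ : secA k1 k2 k31 k32 e - secP k1 k2 k31 e - secR k1 k2 k31 k32 e ≠ 0) :
    ∃ ε > 0, ∃ N : ℕ, ∀ n, N ≤ n → ∀ ν, |ν - e| < ε → ν ^ 2 < (k2 - k1) ^ 2 →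
      ∀ q, IsChainSeq n k1 k2 k31 k32 ν q → q 1 = 0 := by
  have hkk : 0 < k1 * k2 := mul_pos hk1 hk2
  let c : ℝ → ℝ := fun ν => (k1 ^ 2 + k2 ^ 2 - ν ^ 2) / (2 * (k1 * k2))
  let x : ℝ → ℝ := fun ν => c ν + Real.sqrt (c ν ^ 2 - 1)
  let y : ℝ → ℝ := fun ν => c ν - Real.sqrt (c ν ^ 2 - 1)
  let Z : ℝ → ℝ := fun ν => secA k1 k2 k31 k32 ν - secP k1 k2 k31 ν * x ν -
    secR k1 k2 k31 k32 ν * y ν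
  let B : ℝ → ℝ := fun ν => |secP k1 k2 k31 ν - secR k1 k2 k31 k32 ν|
  have hcc : Continuous c := by fun_prop
  have hZc : Continuous Z := by simp only [Z, x, y, secA, secP, secR]; fun_prop
  have hBc : Continuous B := by simp only [B, secP, secR]; fun_prop
  have hce : c e = 1 := by
    simp only [c]; rw [div_eq_one_iff_eq (by positivity), he]; ring
  have hZe : Z e = secA k1 k2 k31 k32 e - secP k1 k2 k31 e - secR k1 k2 k31 k32 e := by
    simp [Z, x, y, hce]
  have hZ0 : 0 < |Z e| := by rw [hZe]; exact abs_pos.mpr hZ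
  have ev1 : ∀ᶠ ν in 𝓝 e, |Z e| / 2 < |Z ν| :=
    (hZc.abs.tendsto e).eventually (lt_mem_nhds (by linarith))
  have ev2 : ∀ᶠ ν in 𝓝 e, B ν < B e + 1 :=
    (hBc.tendsto e).eventually (gt_mem_nhds (by linarith))
  obtain ⟨ε, hε, hball⟩ := Metric.eventually_nhds_iff.mp (ev1.and ev2)
  -- This threshold makes `n |Z e| / 2` exceed the bound `B e + 1` on the right-hand coefficient.
  obtain ⟨N, hN⟩ := exists_nat_gt ((B e + 1) / (|Z e| / 2))
  refine ⟨ε, hε, N + 2, fun n hn ν hν hgap q hq => ?_⟩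
  by_contra hq1
  obtain ⟨h1, h2⟩ := hball (by rwa [Real.dist_eq] : dist ν e < ε)
  have hc1 : 1 < c ν := by
    simp only [c]; rw [lt_div_iff₀ (by positivity)]; nlinarith
  have hs : Real.sqrt (c ν ^ 2 - 1) ^ 2 = c ν ^ 2 - 1 := Real.sq_sqrt (by nlinarith)
  have hs0 := Real.sqrt_nonneg (c ν ^ 2 - 1)
  have hxy : x ν * y ν = 1 := by simp only [x, y]; linear_combination -hs
  have hx1 : 1 < x ν := by simp only [x]; linarith
  have hy0 : 0 < y ν := by
    by_contra hneg
    nlinarith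
  have hsum : x ν + y ν = 2 * c ν := by simp only [x, y]; ring
  have hXY0 : 0 ≤ x ν - y ν := by simp only [x, y]; linarith
  have hsec := hq.secular (by omega) hk1.ne' hk2.ne' hq1 (c := c ν)
    (by simp only [c]; field_simp) (s := fun p => x ν ^ p - y ν ^ p) (by simp) (by
      intro p
      simp only [← hsum]
      linear_combination (y ν ^ p - x ν ^ p) * hxy)
  obtain ⟨m, rfl⟩ : ∃ m, n = m + 1 := ⟨n - 1, by omega⟩
  simp only [Nat.add_sub_cancel] at hsec
  set X := x ν
  set Y := y ν
  have hYp : ∀ p, X ^ p * Y ^ p = 1 := fun p => by rw [← mul_pow, hxy, one_pow]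
  have hkey : (X ^ (2 * (m + 1)) - 1) * Z ν =
      (secP k1 k2 k31 ν - secR k1 k2 k31 k32 ν) * (X - Y) := by
    have e1 := hYp (m + 1)
    have e2 := hYp m
    have e3 : X ^ (m + 1) * Y ^ (m + 1 + 1) = Y := by rw [pow_succ Y, ← mul_assoc, e1, one_mul]
    have e4 : X ^ (m + 1) * Y ^ m = X := by rw [pow_succ X, mul_right_comm, e2, one_mul]
    have e5 : X ^ (2 * (m + 1)) = X ^ (m + 1) * X ^ (m + 1) := by ring
    have e6 : X ^ (m + 1) * Y = X ^ m := by rw [pow_succ X, mul_assoc, hxy, mul_one]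
    have hZν : Z ν = secA k1 k2 k31 k32 ν - secP k1 k2 k31 ν * X - secR k1 k2 k31 k32 ν * Y := rfl
    have e7 : X ^ (m + 1 + 1) = X ^ (m + 1) * X := pow_succ _ _
    rw [hZν, e5]
    rw [e7] at hsec
    linear_combination X ^ (m + 1) * hsec + secA k1 k2 k31 k32 ν * e1 -
      secP k1 k2 k31 ν * e3 - secR k1 k2 k31 k32 ν * e4 - 
      secR k1 k2 k31 k32 ν * X ^ (m + 1) * e6
  have hbern : 1 + (2 * (m + 1) : ℕ) * (X - 1) ≤ X ^ (2 * (m + 1)) := by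
    have := one_add_mul_le_pow (a := X - 1) (by linarith) (2 * (m + 1))
    simpa using this
  have hXY : X - Y ≤ 2 * (X - 1) := by linarith
  have habs := congrArg abs hkey
  rw [abs_mul, abs_mul] at habs
  have hp0 : 0 ≤ X ^ (2 * (m + 1)) - 1 := by
    have := one_le_pow₀ hx1.le (n := 2 * (m + 1)); linarith
  rw [abs_of_nonneg hp0, abs_of_nonneg hXY0] at habs
  change _ = B ν * _ at habs
  have hm : ((B e + 1) / (|Z e| / 2)) < (m + 1 : ℕ) :=
    hN.trans_le (by exact_mod_cast (by omega : N ≤ m + 1))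
  rw [div_lt_iff₀ (by linarith)] at hm
  push_cast at hbern hm
  have l1 : 2 * (m + 1) * (X - 1) * (|Z e| / 2) ≤ (X ^ (2 * (m + 1)) - 1) * |Z ν| := by
    apply mul_le_mul (by linarith) h1.le (by positivity) hp0
  have l2 : B ν * (X - Y) ≤ (B e + 1) * (2 * (X - 1)) :=
    mul_le_mul h2.le hXY hXY0 (by have := abs_nonneg (secP k1 k2 k31 e - secR k1 k2 k31 k32 e); linarith)
  have l3 := mul_lt_mul_of_pos_right hm (by linarith : 0 < 2 * (X - 1))
  linarith

theorem exists_gap_bound {k1 k2 k31 k32 : ℝ} (hk1 : 0 < k1) (hk12 : k1 < k2)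
    (hk31 : 0 < k31) (hk32 : 0 < k32) (hk31' : k31 ≠ 2 * k2) (hk32' : k32 ≠ 2 * k2) :
    ∃ ε > 0, ∃ N : ℕ, ∀ n, N ≤ n → ∀ ν, ν ^ 2 < (k2 - k1) ^ 2 →
      ∀ q, IsChainSeq n k1 k2 k31 k32 ν q → q 1 ≠ 0 → |ν| ≤ k2 - k1 - ε := by
  have hk2 : 0 < k2 := hk1.trans hk12
  have h0 : 0 < k2 - k1 := by linarith
  obtain ⟨ε1, hε1, N1, H1⟩ := exists_no_eigen_near_edge (k31 := k31) (k32 := k32) hk1 hk2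
    (e := k2 - k1) rfl (by
      -- At the upper edge the nondegeneracy condition factors over the two ends: it fails exactly
      -- when an end spring equals `2 k2`.
      have : secA k1 k2 k31 k32 (k2 - k1) - secP k1 k2 k31 (k2 - k1) -
          secR k1 k2 k31 k32 (k2 - k1) = (k2 - k1) ^ 2 * ((2 * k2 - k31) * (2 * k2 - k32)) := by
        unfold secA secP secR; ring
      rw [this]
      have a := sub_ne_zero.mpr hk31'.symm
      have b := sub_ne_zero.mpr hk32'.symm
      positivity)
  obtain ⟨ε2, hε2, N2, H2⟩ := exists_no_eigen_near_edge (k31 := k31) (k32 := k32) hk1 hk2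
    (e := -(k2 - k1)) (by ring) (by
      -- At the lower edge only positivity of the end springs is needed.
      have : secA k1 k2 k31 k32 (-(k2 - k1)) - secP k1 k2 k31 (-(k2 - k1)) -
          secR k1 k2 k31 k32 (-(k2 - k1)) = -((k2 - k1) ^ 2 * (k31 * k32)) := by
        unfold secA secP secR; ring
      rw [this, neg_ne_zero]
      positivity)
  refine ⟨min ε1 ε2, lt_min hε1 hε2, max N1 N2, fun n hn ν hν q hq hq1 => ?_⟩
  obtain ⟨l1, l2⟩ := abs_lt_of_sq_lt_sq' hν h0.le
  have a1 : ε1 ≤ |ν - (k2 - k1)| := by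
    by_contra! hcon
    exact hq1 (H1 n (le_of_max_le_left hn) ν hcon hν q hq)
  have a2 : ε2 ≤ |ν - -(k2 - k1)| := by
    by_contra! hcon
    exact hq1 (H2 n (le_of_max_le_right hn) ν hcon hν q hq)
  rw [abs_of_neg (by linarith)] at a1
  rw [abs_of_pos (by linarith)] at a2
  have m1 := min_le_left ε1 ε2
  have m2 := min_le_right ε1 ε2
  rw [abs_le]
  constructor <;> linarith

end GapEdges

/-! ### The optical dispersion relation and the phase form of the characteristic equation. -/

section Dispersion

/-- The optical branch `ν = ω² - (k1 + k2)` of the dispersion relation; `α` is the distance of the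
wave number from the band edge. -/
def disp (k1 k2 α : ℝ) : ℝ := Real.sqrt (k1 ^ 2 + k2 ^ 2 - 2 * (k1 * k2) * Real.cos α)

theorem disp_arg_pos {k1 k2 : ℝ} (hk1 : 0 < k1) (hk12 : k1 < k2) (α : ℝ) :
    (k2 - k1) ^ 2 ≤ k1 ^ 2 + k2 ^ 2 - 2 * (k1 * k2) * Real.cos α := by
  have := mul_le_mul_of_nonneg_left (Real.cos_le_one α) (mul_pos hk1 (hk1.trans hk12)).le
  nlinarith

theorem disp_sq {k1 k2 : ℝ} (hk1 : 0 < k1) (hk12 : k1 < k2) (α : ℝ) :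
    disp k1 k2 α ^ 2 = k1 ^ 2 + k2 ^ 2 - 2 * (k1 * k2) * Real.cos α :=
  Real.sq_sqrt ((sq_nonneg _).trans (disp_arg_pos hk1 hk12 α))

theorem le_disp {k1 k2 : ℝ} (hk1 : 0 < k1) (hk12 : k1 < k2) (α : ℝ) : k2 - k1 ≤ disp k1 k2 α :=
  Real.le_sqrt_of_sq_le (disp_arg_pos hk1 hk12 α)

theorem disp_pos {k1 k2 : ℝ} (hk1 : 0 < k1) (hk12 : k1 < k2) (α : ℝ) : 0 < disp k1 k2 α :=
  (sub_pos.mpr hk12).trans_le (le_disp hk1 hk12 α)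

theorem disp_zero {k1 k2 : ℝ} (hk12 : k1 < k2) : disp k1 k2 0 = k2 - k1 := by
  unfold disp
  rw [Real.cos_zero, show k1 ^ 2 + k2 ^ 2 - 2 * (k1 * k2) * 1 = (k2 - k1) ^ 2 by ring,
    Real.sqrt_sq (by linarith)]

theorem disp_strictMonoOn {k1 k2 : ℝ} (hk1 : 0 < k1) (hk12 : k1 < k2) :
    StrictMonoOn (disp k1 k2) (Set.Icc 0 Real.pi) := by
  intro a ha b hb hab
  have hc := Real.strictAntiOn_cos ha hb hab
  have hkk : 0 < k1 * k2 := mul_pos hk1 (hk1.trans hk12)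
  apply Real.sqrt_lt_sqrt ((sq_nonneg _).trans (disp_arg_pos hk1 hk12 a))
  nlinarith

theorem contDiff_disp {k1 k2 : ℝ} (hk1 : 0 < k1) (hk12 : k1 < k2) :
    ContDiff ℝ 1 (disp k1 k2) := by
  unfold disp
  apply ContDiff.sqrt
  · fun_prop
  · intro α
    have := disp_arg_pos hk1 hk12 α
    have : 0 < (k2 - k1) ^ 2 := by have : 0 < k2 - k1 := by linarith
                                   positivity
    linarith

/-- `X` in the optical characteristic equation `X sin (n α) = Y sin α cos (n α)`. -/
def phaseX (k1 k2 k31 k32 α : ℝ) : ℝ :=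
  secA k1 k2 k31 k32 (disp k1 k2 α) -
    (secP k1 k2 k31 (disp k1 k2 α) + secR k1 k2 k31 k32 (disp k1 k2 α)) * Real.cos α

/-- See `phaseX`. -/
def phaseY (k1 k2 k31 k32 α : ℝ) : ℝ :=
  secP k1 k2 k31 (disp k1 k2 α) - secR k1 k2 k31 k32 (disp k1 k2 α)

/-- The phase shift caused by both ends of the chain. -/
def phase (k1 k2 k31 k32 α : ℝ) : ℝ :=
  Real.arctan (phaseY k1 k2 k31 k32 α * Real.sin α / phaseX k1 k2 k31 k32 α)

theorem phase_zero (k1 k2 k31 k32 : ℝ) : phase k1 k2 k31 k32 0 = 0 := by simp [phase]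

theorem phaseX_zero_ne {k1 k2 k31 k32 : ℝ} (hk12 : k1 < k2)
    (hk31' : k31 ≠ 2 * k2) (hk32' : k32 ≠ 2 * k2) : phaseX k1 k2 k31 k32 0 ≠ 0 := by
  have : phaseX k1 k2 k31 k32 0 = (k2 - k1) ^ 2 * ((2 * k2 - k31) * (2 * k2 - k32)) := by
    unfold phaseX secA secP secR; rw [disp_zero hk12, Real.cos_zero]; ring
  rw [this]
  have a := sub_ne_zero.mpr hk31'.symm
  have b := sub_ne_zero.mpr hk32'.symm
  have c := sub_ne_zero.mpr hk12.ne'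
  positivity

/-- The denominator `phaseX` is nonzero at the band edge, by the conditions on the end springs, so
the phase is continuously differentiable there. -/
theorem exists_phase_lipschitz {k1 k2 k31 k32 : ℝ} (hk1 : 0 < k1) (hk12 : k1 < k2)
    (hk31' : k31 ≠ 2 * k2) (hk32' : k32 ≠ 2 * k2) :
    ∃ a > 0, a ≤ 1 ∧ ∃ B : ℝ, 0 ≤ B ∧ (∀ α, 0 ≤ α → α ≤ a → phaseX k1 k2 k31 k32 α ≠ 0) ∧
      ∀ α β, 0 ≤ α → α ≤ a → 0 ≤ β → β ≤ a →
        |phase k1 k2 k31 k32 α - phase k1 k2 k31 k32 β| ≤ B * |α - β| := by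
  have hd := contDiff_disp hk1 hk12
  have hX : ContDiff ℝ 1 (phaseX k1 k2 k31 k32) := by
    unfold phaseX secA secP secR
    fun_prop
  have hY : ContDiff ℝ 1 (phaseY k1 k2 k31 k32) := by
    unfold phaseY secP secR
    fun_prop
  have hX0 := phaseX_zero_ne hk12 hk31' hk32' (k1 := k1)
  have hg : ContDiffAt ℝ 1 (phase k1 k2 k31 k32) 0 := by
    unfold phase
    exact Real.contDiff_arctan.contDiffAt.comp _
      (ContDiffAt.div (by fun_prop) hX.contDiffAt hX0)
  obtain ⟨K, t, ht, hL⟩ := hg.exists_lipschitzOnWith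
  have hXe : ∀ᶠ α in 𝓝 (0 : ℝ), phaseX k1 k2 k31 k32 α ≠ 0 :=
    hX.continuous.continuousAt.eventually_ne hX0
  obtain ⟨ε, hε, hball⟩ := Metric.eventually_nhds_iff.mp (hXe.and ht)
  have hmem : ∀ α, 0 ≤ α → α ≤ min (ε / 2) 1 → dist α 0 < ε := by
    intro α h0 h1
    rw [Real.dist_eq, sub_zero, abs_of_nonneg h0]
    have := min_le_left (ε / 2) 1
    linarith
  refine ⟨min (ε / 2) 1, by positivity, min_le_right _ _, K, K.2,
    fun α h0 h1 => (hball (hmem α h0 h1)).1, fun α β h0 h1 h2 h3 => ?_⟩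
  have := hL.dist_le_mul α (hball (hmem α h0 h1)).2 β (hball (hmem β h2 h3)).2
  simpa [Real.dist_eq] using this

/-- The addition theorem puts the equation in the form `X sin (n α) = Y sin α cos (n α)`. Reading `Y
sin α / X` as a tangent, with the positive cosine of an arctangent, turns it into a single sine. -/
theorem secular_sin_iff {k1 k2 k31 k32 α : ℝ} (hX : phaseX k1 k2 k31 k32 α ≠ 0) (n : ℕ) :
    secA k1 k2 k31 k32 (disp k1 k2 α) * Real.sin (n * α) =
      secP k1 k2 k31 (disp k1 k2 α) * Real.sin ((n + 1) * α) +
      secR k1 k2 k31 k32 (disp k1 k2 α) * Real.sin ((n - 1) * α) ↔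
    Real.sin (n * α - phase k1 k2 k31 k32 α) = 0 := by
  set g := phase k1 k2 k31 k32 α with hg
  have hcos : 0 < Real.cos g := Real.cos_arctan_pos _
  have htan : Real.sin g = Real.cos g *
      (phaseY k1 k2 k31 k32 α * Real.sin α / phaseX k1 k2 k31 k32 α) := by
    have := Real.tan_arctan (phaseY k1 k2 k31 k32 α * Real.sin α / phaseX k1 k2 k31 k32 α)
    change Real.tan g = _ at this
    rw [← this, Real.tan_eq_sin_div_cos]
    field_simp
  rw [Real.sin_sub, htan, add_mul, sub_mul, one_mul, Real.sin_add, Real.sin_sub]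
  have e : Real.sin (n * α) * Real.cos g - Real.cos (n * α) * (Real.cos g *
      (phaseY k1 k2 k31 k32 α * Real.sin α / phaseX k1 k2 k31 k32 α)) =
      Real.cos g / phaseX k1 k2 k31 k32 α * (phaseX k1 k2 k31 k32 α * Real.sin (n * α) -
        phaseY k1 k2 k31 k32 α * Real.sin α * Real.cos (n * α)) := by
    field_simp
  rw [e, mul_eq_zero, or_iff_right (div_ne_zero hcos.ne' hX)]
  unfold phaseX phaseY
  constructor <;> intro h <;> linear_combination h

end Dispersion
end DiatomicChain
end

/-! ### Location of the optical wave numbers near the band edge. -/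

noncomputable section
namespace DiatomicChain
open Finset Filter Topology

/-- A converse to `IsChainSeq.secular`: the even sites are prescribed as sines, each odd site is
defined by its own row, and the characteristic equation is exactly the right wall condition. It
produces an optical eigenfrequency. -/
theorem exists_isChainSeq_of_secular {n : ℕ} {k1 k2 k31 k32 ν α : ℝ} (hν : ν ≠ 0)
    (hc : 2 * (k1 * k2) * Real.cos α = k1 ^ 2 + k2 ^ 2 - ν ^ 2)
    (hsec : secA k1 k2 k31 k32 ν * Real.sin (n * α) =
      secP k1 k2 k31 ν * Real.sin ((n + 1) * α) +
      secR k1 k2 k31 k32 ν * Real.sin ((n - 1) * α)) :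
    ∃ q, IsChainSeq n k1 k2 k31 k32 ν q ∧ q 1 = k1 * k2 * Real.sin α := by
  let a : ℕ → ℝ := fun p => k2 * (ν + (k2 - k31)) * Real.sin (p * α) -
    k1 * (k2 - k31) * Real.sin ((p - 1) * α)
  let b : ℕ → ℝ := fun p => (k1 * a (p + 1) - k2 * a p) / ν
  let q : ℕ → ℝ := fun m => (-1) ^ (m / 2) * if m % 2 = 0 then a (m / 2) else b (m / 2)
  have hq0 : ∀ p, q (2 * p) = (-1) ^ p * a p := fun p => by simp [q]
  have hq1 : ∀ p, q (2 * p + 1) = (-1) ^ p * b p := fun p => by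
    simp only [q]
    rw [show (2 * p + 1) / 2 = p by omega, if_neg (by omega)]
  have hb : ∀ p, ν * b p = k1 * a (p + 1) - k2 * a p := fun p => by
    simp only [b]; field_simp
  have ha : ∀ p, k1 * k2 * (a (p + 2) + a p) =
      (k1 ^ 2 + k2 ^ 2 - ν ^ 2) * a (p + 1) := by
    intro p
    rw [← hc]
    simp only [a]
    have e1 : ((p + 2 : ℕ) : ℝ) * α = ((p + 1 : ℕ) : ℝ) * α + α := by push_cast; ring
    have e2 : (p : ℝ) * α = ((p + 1 : ℕ) : ℝ) * α - α := by push_cast; ring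
    have e3 : (((p + 2 : ℕ) : ℝ) - 1) * α = (((p + 1 : ℕ) : ℝ) - 1) * α + α := by push_cast; ring
    have e4 : ((p : ℝ) - 1) * α = (((p + 1 : ℕ) : ℝ) - 1) * α - α := by push_cast; ring
    rw [e1, e2, e3, e4, Real.sin_add, Real.sin_sub, Real.sin_add, Real.sin_sub]
    ring
  have ha0 : a 0 = k1 * (k2 - k31) * Real.sin α := by simp [a]
  have ha1 : a 1 = k2 * (ν + (k2 - k31)) * Real.sin α := by simp [a]
  have hb0 : b 0 = k1 * k2 * Real.sin α := by
    apply mul_left_cancel₀ hν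
    rw [hb, ha0, ha1]; ring
  have hright : k2 * b n = (k2 - k32) * a n := by
    apply mul_left_cancel₀ hν
    have e1 : (((n + 1 : ℕ) : ℝ)) * α = (n + 1) * α := by push_cast; ring
    have e2 : (((n + 1 : ℕ) : ℝ) - 1) * α = n * α := by push_cast; ring
    have : ν * (k2 * b n) = k2 * (ν * b n) := by ring
    rw [this, hb]
    simp only [a]
    rw [e1, e2]
    unfold secA secP secR at hsec
    linear_combination -hsec
  refine ⟨q, ⟨?_, ?_, ?_, ?_⟩, ?_⟩
  · have h0 := hq0 0
    have h1 := hq1 0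
    simp only [mul_zero, pow_zero, one_mul, zero_add] at h0 h1
    rw [h0, h1, ha0, hb0]; ring
  · rw [hq1, hq0]
    linear_combination (-1) ^ n * hright
  · intro p _
    rw [show 2 * p + 2 = 2 * (p + 1) by ring, hq0, hq0, hq1, pow_succ]
    linear_combination -(-1) ^ p * hb p
  · intro p _
    rw [show 2 * p + 2 = 2 * (p + 1) by ring, show 2 * p + 3 = 2 * (p + 1) + 1 by ring, hq0, hq1,
      hq1, pow_succ]
    apply mul_left_cancel₀ hν
    linear_combination (-1) ^ p * (-k1 * hb p + k2 * hb (p + 1) + ha p)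
  · have h1 := hq1 0
    simp only [mul_zero, pow_zero, one_mul, zero_add] at h1
    rw [h1, hb0]

theorem exists_chainSeq_of_eigen {n : ℕ} {k1 k2 k31 k32 ν : ℝ} (hn : 0 < n) (hk1 : k1 ≠ 0)
    (hk2 : k2 ≠ 0) {v : Fin (2 * n) → ℝ} (hv0 : v ≠ 0)
    (h : (chainMatrix n k1 k2 k31 k32).mulVec v = (-(ν + (k1 + k2))) • v) :
    ∃ q : ℕ → ℝ, IsChainSeq n k1 k2 k31 k32 ν q ∧ (∀ i : Fin (2 * n), v i = q (i + 1)) ∧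
      q 1 ≠ 0 := by
  obtain ⟨q, hq, hvq⟩ := exists_isChainSeq hn hk2 h
  refine ⟨q, hq, hvq, fun h1 => hv0 ?_⟩
  ext i
  have hi := i.2
  rw [hvq]
  rcases Nat.even_or_odd' (i : ℕ) with ⟨p, hp | hp⟩
  · rw [hp]; exact (hq.eq_zero hk1 hk2 h1 p (by omega)).2.1
  · rw [hp]; exact (hq.eq_zero hk1 hk2 h1 p (by omega)).2.2

section Spectrum
variable {n : ℕ} {k1 k2 k31 k32 : ℝ} {n1 n2 : ℕ} {Ω : ℕ → ℝ} {u : ℕ → Fin (2 * n) → ℝ}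

theorem unitState_ne_zero {N : ℕ} {v : Fin N → ℝ} (hv : v ≠ 0) : unitState v ≠ 0 := by
  intro h
  have := sum_unitState_sq hv
  simp [h] at this

theorem IsSpectrum.exists_chainSeq (hS : IsSpectrum n k1 k2 k31 k32 n1 n2 Ω u) (hk1 : k1 ≠ 0)
    (hk2 : k2 ≠ 0) {j : ℕ} (hj : j ∈ Finset.Icc 1 (2 * n)) :
    ∃ q : ℕ → ℝ, IsChainSeq n k1 k2 k31 k32 (Ω j ^ 2 - (k1 + k2)) q ∧
      (∀ i : Fin (2 * n), unitState (u j) i = q (i + 1)) ∧ q 1 ≠ 0 := by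
  have hn : 0 < n := by
    have := Finset.mem_Icc.mp hj
    omega
  apply exists_chainSeq_of_eigen hn hk1 hk2 (unitState_ne_zero (hS.ne_zero j hj))
  rw [hS.unitState_eigen hj, sub_add_cancel]

theorem IsSpectrum.mem_of_mem_optical (hS : IsSpectrum n k1 k2 k31 k32 n1 n2 Ω u) {j : ℕ}
    (hj : j ∈ Finset.Icc 1 n1) : j ∈ Finset.Icc 1 (2 * n) := by
  have := hS.count
  rw [Finset.mem_Icc] at *
  omega

/-- The distance from the band edge of the wave number of an optical eigenfrequency `Ω`. -/
def waveNumber (k1 k2 ω : ℝ) : ℝ :=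
  Real.arccos ((k1 ^ 2 + k2 ^ 2 - (ω ^ 2 - (k1 + k2)) ^ 2) / (2 * (k1 * k2)))

theorem waveNumber_spec {k1 k2 ω : ℝ} (hk1 : 0 < k1) (hk12 : k1 < k2) (h1 : 2 * k2 < ω ^ 2)
    (h2 : ω ^ 2 < 2 * k1 + 2 * k2) :
    0 < waveNumber k1 k2 ω ∧ waveNumber k1 k2 ω < Real.pi ∧
      disp k1 k2 (waveNumber k1 k2 ω) = ω ^ 2 - (k1 + k2) ∧
      2 * (k1 * k2) * Real.cos (waveNumber k1 k2 ω) =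
        k1 ^ 2 + k2 ^ 2 - (ω ^ 2 - (k1 + k2)) ^ 2 := by
  have hkk : 0 < k1 * k2 := mul_pos hk1 (hk1.trans hk12)
  have l1 : -1 < (k1 ^ 2 + k2 ^ 2 - (ω ^ 2 - (k1 + k2)) ^ 2) / (2 * (k1 * k2)) := by
    rw [lt_div_iff₀ (by positivity)]; nlinarith
  have l2 : (k1 ^ 2 + k2 ^ 2 - (ω ^ 2 - (k1 + k2)) ^ 2) / (2 * (k1 * k2)) < 1 := by
    rw [div_lt_iff₀ (by positivity)]; nlinarith
  have hc : 2 * (k1 * k2) * Real.cos (waveNumber k1 k2 ω) =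
      k1 ^ 2 + k2 ^ 2 - (ω ^ 2 - (k1 + k2)) ^ 2 := by
    unfold waveNumber
    rw [Real.cos_arccos l1.le l2.le, mul_div_cancel₀ _ (by positivity)]
  refine ⟨Real.arccos_pos.mpr l2, ?_, ?_, hc⟩
  · refine lt_of_le_of_ne (Real.arccos_le_pi _) fun h => ?_
    have := Real.arccos_eq_pi.mp h
    linarith
  · unfold disp
    rw [hc, sub_sub_cancel, Real.sqrt_sq (by linarith)]

theorem sin_phase_eq_zero {n : ℕ} {k1 k2 k31 k32 α : ℝ} (hn : 2 ≤ n) (hk1 : 0 < k1)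
    (hk12 : k1 < k2) (hX : phaseX k1 k2 k31 k32 α ≠ 0) {q : ℕ → ℝ}
    (hq : IsChainSeq n k1 k2 k31 k32 (disp k1 k2 α) q) (hq1 : q 1 ≠ 0) :
    Real.sin (n * α - phase k1 k2 k31 k32 α) = 0 := by
  rw [← secular_sin_iff hX]
  have := hq.secular hn hk1.ne' (hk1.trans hk12).ne' hq1 (c := Real.cos α)
    (by rw [disp_sq hk1 hk12]; ring) (s := fun p => Real.sin (p * α)) (by simp) (by
      intro p
      have e1 : ((p + 2 : ℕ) : ℝ) * α = ((p + 1 : ℕ) : ℝ) * α + α := by push_cast; ring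
      have e2 : (p : ℝ) * α = ((p + 1 : ℕ) : ℝ) * α - α := by push_cast; ring
      rw [e1, e2, Real.sin_add, Real.sin_sub]; ring)
  have e1 : ((n + 1 : ℕ) : ℝ) = n + 1 := by push_cast; ring
  have e2 : ((n - 1 : ℕ) : ℝ) = n - 1 := by rw [Nat.cast_sub (by omega)]; simp
  simpa only [e1, e2] using this

end Spectrum

/-- On `[0, a]` the map `Φ α = n α - g α` is strictly increasing once `n` exceeds the Lipschitz
constant of `g`, and the optical wave numbers in `(0, a]` are exactly its solutions of `Φ ∈ π ℤ`.
Since `Φ` vanishes at `0`, the first one has `Φ = π`, and the one numbered `j`, if it lies in `(0,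
a]`, has `Φ ≥ j π`. -/
theorem exists_optical_phases {k1 k2 k31 k32 : ℝ} (hk1 : 0 < k1) (hk12 : k1 < k2)
    (hk31' : k31 ≠ 2 * k2) (hk32' : k32 ≠ 2 * k2) :
    ∃ a > 0, a ≤ 1 ∧ ∃ B : ℝ, 0 ≤ B ∧ ∃ N : ℕ, ∀ n, N ≤ n → ∀ (n1 n2 : ℕ) (Ω : ℕ → ℝ)
      (u : ℕ → Fin (2 * n) → ℝ), IsSpectrum n k1 k2 k31 k32 n1 n2 Ω u →
      1 ≤ n1 ∧ waveNumber k1 k2 (Ω 1) ≤ a ∧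
        |n * waveNumber k1 k2 (Ω 1) - Real.pi| ≤ B * waveNumber k1 k2 (Ω 1) ∧
        ∀ j ∈ Finset.Icc 1 n1, waveNumber k1 k2 (Ω j) ≤ a →
          j * Real.pi ≤ (n + B) * waveNumber k1 k2 (Ω j) := by
  have hk2 : 0 < k2 := hk1.trans hk12
  obtain ⟨a, ha, ha1, B, hB, hX, hL⟩ := exists_phase_lipschitz (k31 := k31) (k32 := k32) hk1 hk12
    hk31' hk32'
  obtain ⟨N, hN⟩ := exists_nat_gt (B + 4 / a)
  refine ⟨a, ha, ha1, B, hB, N + 2, fun n hn n1 n2 Ω u hS => ?_⟩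
  have hpi := Real.pi_gt_three
  have hpi4 := Real.pi_le_four
  have hnN : B + 4 / a < n := hN.trans_le (by exact_mod_cast (by omega : N ≤ n))
  have hnB : B < n := by have : 0 < 4 / a := by positivity
                         linarith
  set g := phase k1 k2 k31 k32 with hg
  let Φ : ℝ → ℝ := fun α => n * α - g α
  have hΦ0 : Φ 0 = 0 := by simp [Φ, hg, phase_zero]
  have hmono : ∀ α β, 0 ≤ α → α < β → β ≤ a → Φ α < Φ β := by
    intro α β h0 h1 h2
    have := (abs_le.mp (hL β α (h0.trans h1.le) h2 h0 (h1.le.trans h2))).2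
    rw [abs_of_pos (sub_pos.mpr h1)] at this
    have h3 := mul_lt_mul_of_pos_right hnB (sub_pos.mpr h1)
    simp only [Φ]
    linarith
  have hgle : ∀ α, 0 ≤ α → α ≤ a → |g α| ≤ B * α := by
    intro α h0 h1
    have := hL α 0 h0 h1 le_rfl ha.le
    rwa [hg, phase_zero, sub_zero, sub_zero, abs_of_nonneg h0] at this
  have hcont : ContinuousOn Φ (Set.Icc 0 a) := by
    have : LipschitzOnWith B.toNNReal g (Set.Icc 0 a) := by
      apply LipschitzOnWith.of_dist_le_mul
      intro x hx y hy
      rw [Real.dist_eq, Real.dist_eq, Real.coe_toNNReal B hB]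
      exact hL x y hx.1 hx.2 hy.1 hy.2
    exact (continuousOn_const.mul continuousOn_id).sub this.continuousOn
  have hΦa : Real.pi ≤ Φ a := by
    have h1 := (abs_le.mp (hgle a ha.le le_rfl)).2
    have h2 : 4 / a * a = 4 := by field_simp
    have h3 := mul_lt_mul_of_pos_right hnN ha
    simp only [Φ]
    linarith
  -- The solution of `Φ = π` is an actual eigenfrequency. This shows that the optical band is
  -- nonempty and bounds the first wave number from above.
  obtain ⟨α0, hα0, hΦα0⟩ := intermediate_value_Icc ha.le hcont
    (show Real.pi ∈ Set.Icc (Φ 0) (Φ a) from ⟨by rw [hΦ0]; linarith, hΦa⟩)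
  have hα0pos : 0 < α0 := by
    refine lt_of_le_of_ne hα0.1 fun h => ?_
    rw [← h, hΦ0] at hΦα0
    linarith
  have hsinpos : 0 < Real.sin α0 := Real.sin_pos_of_pos_of_lt_pi hα0pos (by linarith [hα0.2])
  obtain ⟨q, hq, hq1⟩ := exists_isChainSeq_of_secular (n := n) (k31 := k31) (k32 := k32)
    (disp_pos hk1 hk12 α0).ne' (α := α0) (by rw [disp_sq hk1 hk12]; ring)
    ((secular_sin_iff (hX α0 hα0.1 hα0.2) n).mpr (by
      change Real.sin (Φ α0) = 0
      rw [hΦα0, Real.sin_pi]))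
  obtain ⟨j0, hj0, hΩ0⟩ := hS.exists_index (v := fun i => q (i + 1)) (by
      intro h
      have := congrFun h ⟨0, by omega⟩
      simp only [zero_add, Pi.zero_apply, hq1] at this
      have h2 : 0 < k1 * k2 * Real.sin α0 := by positivity
      linarith) hq.mulVec_eq
  have hcount := hS.count
  have hdisp0 : k2 - k1 < disp k1 k2 α0 := by
    have := disp_strictMonoOn hk1 hk12 (by simp; linarith) (by constructor <;> linarith [hα0.2])
      hα0pos
    rwa [disp_zero hk12] at this
  have hj0' : j0 ∈ Finset.Icc 1 n1 := by
    rw [Finset.mem_Icc] at hj0 ⊢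
    refine ⟨hj0.1, ?_⟩
    by_contra! hcon
    by_cases h : j0 ≤ n1 + 2
    · have := (hS.gap j0 (Finset.mem_Icc.mpr ⟨by omega, h⟩)).2
      linarith
    · have := hS.acoustic j0 (Finset.mem_Icc.mpr ⟨by omega, hj0.2⟩)
      linarith
  have hn1 : 1 ≤ n1 := (Finset.mem_Icc.mp hj0').1.trans (Finset.mem_Icc.mp hj0').2
  have hspec : ∀ j ∈ Finset.Icc 1 n1, _ := fun j hj =>
    waveNumber_spec hk1 hk12 (hS.optical j hj).1 (hS.optical j hj).2
  have hWmono : ∀ i ∈ Finset.Icc 1 n1, ∀ j ∈ Finset.Icc 1 n1, i < j →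
      waveNumber k1 k2 (Ω i) < waveNumber k1 k2 (Ω j) := by
    intro i hi j hj hij
    have h1 := hS.optical_mono (by simpa using hi) (by simpa using hj) hij
    have h2 := pow_lt_pow_left₀ h1 (hS.pos i (hS.mem_of_mem_optical hi)).le two_ne_zero
    obtain ⟨i1, i2, i3, -⟩ := hspec i hi
    obtain ⟨j1, j2, j3, -⟩ := hspec j hj
    refine ((disp_strictMonoOn hk1 hk12).lt_iff_lt ⟨i1.le, i2.le⟩ ⟨j1.le, j2.le⟩).mp ?_
    rw [i3, j3]; linarith
  have h1mem : 1 ∈ Finset.Icc 1 n1 := Finset.mem_Icc.mpr ⟨le_rfl, hn1⟩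
  have hW0 : waveNumber k1 k2 (Ω j0) = α0 := by
    obtain ⟨i1, i2, i3, -⟩ := hspec j0 hj0'
    refine (disp_strictMonoOn hk1 hk12).injOn ⟨i1.le, i2.le⟩ ⟨hα0.1, by linarith [hα0.2]⟩ ?_
    rw [i3, hΩ0]; ring
  have hW1 : waveNumber k1 k2 (Ω 1) ≤ α0 := by
    rw [← hW0]
    rcases eq_or_lt_of_le (Finset.mem_Icc.mp hj0').1 with h | h
    · rw [← h]
    · exact (hWmono 1 h1mem j0 hj0' h).le
  have hmult : ∀ j ∈ Finset.Icc 1 n1, waveNumber k1 k2 (Ω j) ≤ a →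
      ∃ m : ℤ, (m : ℝ) * Real.pi = Φ (waveNumber k1 k2 (Ω j)) := by
    intro j hj hja
    obtain ⟨i1, i2, i3, -⟩ := hspec j hj
    obtain ⟨q, hq, -, hq1⟩ := hS.exists_chainSeq hk1.ne' hk2.ne' (hS.mem_of_mem_optical hj)
    rw [← i3] at hq
    exact Real.sin_eq_zero_iff.mp
      (sin_phase_eq_zero (by omega) hk1 hk12 (hX _ i1.le hja) hq hq1)
  -- Strictly increasing values in `π ℤ`, the first of them positive, grow at least by `π` at each
  -- step.
  have hlow : ∀ j : ℕ, j + 1 ∈ Finset.Icc 1 n1 → waveNumber k1 k2 (Ω (j + 1)) ≤ a →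
      ((j + 1 : ℕ) : ℝ) * Real.pi ≤ Φ (waveNumber k1 k2 (Ω (j + 1))) := by
    intro j
    induction j with
    | zero =>
      intro hj hja
      obtain ⟨m, hm⟩ := hmult _ hj hja
      have h1 := hmono 0 _ le_rfl (hspec _ hj).1 hja
      rw [hΦ0, ← hm] at h1
      rw [← hm]
      have : (0 : ℝ) < m := by
        by_contra! hcon
        nlinarith
      have h2 : 1 ≤ m := by exact_mod_cast this
      have h3 : (1 : ℝ) ≤ m := by exact_mod_cast h2
      push_cast
      nlinarith
    | succ j ih =>
      intro hj hja
      have hj' : j + 1 ∈ Finset.Icc 1 n1 := by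
        rw [Finset.mem_Icc] at hj ⊢; omega
      have hlt := hWmono _ hj' _ hj (Nat.lt_succ_self _)
      have h0 := ih hj' (hlt.le.trans hja)
      obtain ⟨m, hm⟩ := hmult _ hj hja
      have h1 := hmono _ _ (hspec _ hj').1.le hlt hja
      rw [← hm] at h1 ⊢
      have : ((j + 1 : ℕ) : ℝ) < m := by
        by_contra! hcon
        nlinarith
      have h2 : ((j + 1 : ℕ) : ℤ) < m := by exact_mod_cast this
      have h3 : ((j + 1 + 1 : ℕ) : ℝ) ≤ m := by exact_mod_cast h2
      nlinarith
  have hW1a := hW1.trans hα0.2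
  refine ⟨hn1, hW1a, ?_, ?_⟩
  · have h1 := hlow 0 h1mem hW1a
    have h2 : Φ (waveNumber k1 k2 (Ω 1)) ≤ Real.pi := by
      rcases eq_or_lt_of_le hW1 with h | h
      · rw [h, hΦα0]
      · rw [← hΦα0]
        exact (hmono _ _ (hspec 1 h1mem).1.le h hα0.2).le
    have h3 : Φ (waveNumber k1 k2 (Ω 1)) = Real.pi := by
      apply le_antisymm h2
      simpa using h1
    have h4 := hgle _ (hspec 1 h1mem).1.le hW1a
    rwa [← h3, show n * waveNumber k1 k2 (Ω 1) - Φ (waveNumber k1 k2 (Ω 1)) =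
      g (waveNumber k1 k2 (Ω 1)) by simp only [Φ]; ring]
  · intro j hj hja
    obtain ⟨i, rfl⟩ := Nat.exists_eq_add_of_le' (Finset.mem_Icc.mp hj).1
    have h1 := hlow i hj hja
    have h2 := (abs_le.mp (hgle _ (hspec _ hj).1.le hja)).1
    simp only [Φ] at h1
    linarith

end DiatomicChain
end

/-! ### Sine sums, curvature of the dispersion relation and spacing of the optical frequencies. -/

noncomputable section
namespace DiatomicChain
open Finset Filter Topology

section SineSums

theorem two_sin_mul_sum_cos (h : ℝ) (m : ℕ) :
    2 * Real.sin h * ∑ p ∈ range m, Real.cos (2 * p * h) =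
      Real.sin ((2 * m - 1) * h) + Real.sin h := by
  induction m with
  | zero => simp [Real.sin_neg]
  | succ m ih =>
    rw [sum_range_succ, mul_add, ih]
    have e1 : (2 * ((m + 1 : ℕ) : ℝ) - 1) * h = 2 * m * h + h := by push_cast; ring
    have e2 : (2 * (m : ℝ) - 1) * h = 2 * m * h - h := by ring
    rw [e1, e2, Real.sin_add, Real.sin_sub]; ring

theorem sum_cos_eq_zero {n t : ℕ} (ht : 0 < t) (htn : t < n) :
    ∑ p ∈ range n, Real.cos (2 * p * (t * Real.pi / n)) = 0 := by
  have hn : (0 : ℝ) < n := by exact_mod_cast ht.trans htn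
  have ht' : (0 : ℝ) < t := by exact_mod_cast ht
  have hsin : 0 < Real.sin (t * Real.pi / n) := by
    apply Real.sin_pos_of_pos_of_lt_pi
    · positivity
    · rw [div_lt_iff₀ hn, mul_comm]
      exact mul_lt_mul_of_pos_left (by exact_mod_cast htn) Real.pi_pos
  have h := two_sin_mul_sum_cos (t * Real.pi / n) n
  have e : (2 * (n : ℝ) - 1) * (t * Real.pi / n) = t * (2 * Real.pi) - t * Real.pi / n := by
    field_simp
  rw [e, Real.sin_nat_mul_two_pi_sub, neg_add_cancel] at h
  exact (mul_eq_zero.mp h).resolve_left (by positivity)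

theorem sum_sin_sq {n : ℕ} (hn : 3 ≤ n) :
    ∑ p ∈ range n, Real.sin (p * Real.pi / n) ^ 2 = n / 2 := by
  have h1 := sum_cos_eq_zero (n := n) (t := 1) (by norm_num) (by omega)
  have : ∀ p ∈ range n, Real.sin (p * Real.pi / n) ^ 2 =
      1 / 2 - 1 / 2 * Real.cos (2 * p * ((1 : ℕ) * Real.pi / n)) := by
    intro p _
    rw [show 2 * (p : ℝ) * ((1 : ℕ) * Real.pi / n) = 2 * (p * Real.pi / n) by push_cast; ring,
      Real.cos_two_mul, Real.sin_sq]
    ring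
  rw [sum_congr rfl this, sum_sub_distrib, ← mul_sum, h1]
  simp; ring

theorem sum_sin_pow_four {n : ℕ} (hn : 3 ≤ n) :
    ∑ p ∈ range n, Real.sin (p * Real.pi / n) ^ 4 = 3 * n / 8 := by
  have h1 := sum_cos_eq_zero (n := n) (t := 1) (by norm_num) (by omega)
  have h2 := sum_cos_eq_zero (n := n) (t := 2) (by norm_num) (by omega)
  have : ∀ p ∈ range n, Real.sin (p * Real.pi / n) ^ 4 =
      3 / 8 - 1 / 2 * Real.cos (2 * p * ((1 : ℕ) * Real.pi / n)) +
        1 / 8 * Real.cos (2 * p * ((2 : ℕ) * Real.pi / n)) := by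
    intro p _
    rw [show 2 * (p : ℝ) * ((2 : ℕ) * Real.pi / n) = 2 * (2 * (p * Real.pi / n)) by push_cast; ring,
      show 2 * (p : ℝ) * ((1 : ℕ) * Real.pi / n) = 2 * (p * Real.pi / n) by push_cast; ring,
      Real.cos_two_mul (2 * (p * Real.pi / n)), Real.cos_two_mul (p * Real.pi / n),
      show Real.sin (p * Real.pi / n) ^ 4 = (Real.sin (p * Real.pi / n) ^ 2) ^ 2 by ring,
      Real.sin_sq]
    ring
  rw [sum_congr rfl this, sum_add_distrib, sum_sub_distrib, ← mul_sum, ← mul_sum, h1, h2]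
  simp; ring

theorem sum_sin_succ_pow {n k : ℕ} (hn : 0 < n) (hk : k ≠ 0) :
    ∑ p ∈ range n, Real.sin (((p + 1 : ℕ) : ℝ) * Real.pi / n) ^ k =
      ∑ p ∈ range n, Real.sin (p * Real.pi / n) ^ k := by
  have h1 := sum_range_succ' (fun p : ℕ => Real.sin (p * Real.pi / n) ^ k) n
  have h2 := sum_range_succ (fun p : ℕ => Real.sin (p * Real.pi / n) ^ k) n
  have hn' : (n : ℝ) ≠ 0 := by exact_mod_cast hn.ne'
  rw [h1] at h2
  simpa [mul_div_assoc, mul_div_cancel₀, hn', hk, mul_div_cancel_left₀] using h2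

/-- A normalized vector that is close to a half sine wave on both sublattices has nearly the
sup-norm and the fourth moment of that wave. -/
theorem sine_profile_bounds {n : ℕ} {C D : ℝ} (hC : 0 ≤ C) (hn : 3 ≤ n) (hnC : 2000 * C ≤ n)
    (hD : 0 ≤ D) {x y : ℕ → ℝ} (hx0 : ∀ p < n, 0 ≤ x p) (hy0 : ∀ p < n, 0 ≤ y p)
    (hx : ∀ p < n, |x p - D * Real.sin (p * Real.pi / n)| ≤ D * (C / n))
    (hy : ∀ p < n, |y p - D * Real.sin (((p + 1 : ℕ) : ℝ) * Real.pi / n)| ≤ D * (C / n))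
    (hsum : ∑ p ∈ range n, x p ^ 2 + ∑ p ∈ range n, y p ^ 2 = 1) :
    (∀ p < n, x p ^ 2 * n ≤ 121 / 100) ∧ (∀ p < n, y p ^ 2 * n ≤ 121 / 100) ∧
      (∑ p ∈ range n, x p ^ 4 + ∑ p ∈ range n, y p ^ 4) * n ≤ 77 / 100 := by
  have hnpos : (0 : ℝ) < n := by exact_mod_cast (by omega : 0 < n)
  have hCn : 0 ≤ C / n := by positivity
  have hCn1 : C / n ≤ 1 / 2000 := by rw [div_le_iff₀ hnpos]; linarith
  have aux : ∀ z θ : ℝ, 0 ≤ z → 0 ≤ Real.sin θ → |z - D * Real.sin θ| ≤ D * (C / n) →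
      D ^ 2 * (Real.sin θ ^ 2 - 2 * (C / n)) ≤ z ^ 2 ∧ z ^ 2 ≤ D ^ 2 * (1 + C / n) ^ 2 ∧
        z ^ 4 ≤ D ^ 4 * (Real.sin θ ^ 4 + 15 * (C / n)) := by
    intro z θ hz hs h
    obtain ⟨h1, h2⟩ := abs_le.mp h
    have hs1 := Real.sin_le_one θ
    set s := Real.sin θ
    set e := C / n
    refine ⟨?_, ?_, ?_⟩
    · have h3 : 0 ≤ D * s := by positivity
      have h4 := mul_le_mul_of_nonneg_left (show D * s - D * e ≤ z by linarith) h3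
      have h5 : D ^ 2 * (s * e) ≤ D ^ 2 * (1 * e) := by gcongr
      nlinarith [sq_nonneg (z - D * s)]
    · rw [← mul_pow]
      apply pow_le_pow_left₀ hz
      have : D * s ≤ D * 1 := by gcongr
      linarith
    · have h3 : z ^ 4 ≤ (D * (s + e)) ^ 4 := pow_le_pow_left₀ hz (by linarith) 4
      refine h3.trans ?_
      rw [mul_pow]
      have h4 : (s + e) ^ 4 ≤ s ^ 4 + 15 * e := by
        have e1 : (s + e) ^ 4 = s ^ 4 + e * (4 * s ^ 3 + 6 * s ^ 2 * e + 4 * s * e ^ 2 + e ^ 3) := by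
          ring
        have e2 : s ^ 3 ≤ 1 := pow_le_one₀ hs hs1
        have e3 : s ^ 2 * e ≤ 1 * 1 := by gcongr; exacts [pow_le_one₀ hs hs1, by linarith]
        have e4 : s * e ^ 2 ≤ 1 * 1 := by gcongr; exact pow_le_one₀ hCn (by linarith)
        have e5 : e ^ 3 ≤ 1 := pow_le_one₀ hCn (by linarith)
        rw [e1]
        have := mul_le_mul_of_nonneg_left
          (show 4 * s ^ 3 + 6 * s ^ 2 * e + 4 * s * e ^ 2 + e ^ 3 ≤ 15 by linarith) hCn
        linarith
      gcongr
  have hs0 : ∀ p : ℕ, p ≤ n → 0 ≤ Real.sin (p * Real.pi / n) := by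
    intro p hp
    apply Real.sin_nonneg_of_nonneg_of_le_pi
    · have := Real.pi_pos; positivity
    · rw [div_le_iff₀ hnpos, mul_comm]
      exact mul_le_mul_of_nonneg_left (by exact_mod_cast hp) Real.pi_pos.le
  have ax := fun p (hp : p ∈ range n) => aux (x p) _ (hx0 p (mem_range.mp hp))
    (hs0 p (mem_range.mp hp).le) (hx p (mem_range.mp hp))
  have ay := fun p (hp : p ∈ range n) => aux (y p) _ (hy0 p (mem_range.mp hp))
    (hs0 (p + 1) (mem_range.mp hp)) (hy p (mem_range.mp hp))
  have lx := sum_le_sum fun p hp => (ax p hp).1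
  have ly := sum_le_sum fun p hp => (ay p hp).1
  have fx := sum_le_sum fun p hp => (ax p hp).2.2
  have fy := sum_le_sum fun p hp => (ay p hp).2.2
  rw [← mul_sum, sum_sub_distrib] at lx ly
  rw [← mul_sum, sum_add_distrib] at fx fy
  rw [sum_sin_succ_pow (by omega) two_ne_zero] at ly
  rw [sum_sin_succ_pow (by omega) four_ne_zero] at fy
  rw [sum_sin_sq hn, sum_const, card_range, nsmul_eq_mul] at lx ly
  rw [sum_sin_pow_four hn, sum_const, card_range, nsmul_eq_mul] at fx fy
  have e1 : (n : ℝ) * (2 * (C / n)) = 2 * C := by field_simp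
  have e2 : (n : ℝ) * (15 * (C / n)) = 15 * C := by field_simp
  rw [e1] at lx ly
  rw [e2] at fx fy
  -- The normalization fixes the amplitude: the squared sines sum to `n / 2` on each sublattice, so
  -- `D²` is nearly `1 / n`. The limiting values are `1` for the sup norm and `3 / 4` for the fourth
  -- moment, after multiplication by `n`.
  have hD2 : D ^ 2 * (n - 4 * C) ≤ 1 := by linarith
  have hD3 : D ^ 2 * n ≤ 500 / 499 := by
    have : D ^ 2 * (n * (499 / 500)) ≤ D ^ 2 * (n - 4 * C) := by gcongr; linarith
    linarith
  have hD0 := sq_nonneg D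
  have hsup : D ^ 2 * (1 + C / n) ^ 2 * n ≤ 121 / 100 := by
    have h1 : (1 + C / n) ^ 2 ≤ 11 / 10 := by nlinarith
    calc D ^ 2 * (1 + C / n) ^ 2 * n = (D ^ 2 * n) * (1 + C / n) ^ 2 := by ring
      _ ≤ 500 / 499 * (11 / 10) := by gcongr
      _ ≤ 121 / 100 := by norm_num
  refine ⟨fun p hp => (mul_le_mul_of_nonneg_right (ax p (mem_range.mpr hp)).2.1 hnpos.le).trans hsup,
    fun p hp => (mul_le_mul_of_nonneg_right (ay p (mem_range.mpr hp)).2.1 hnpos.le).trans hsup, ?_⟩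
  have h4 : ∑ p ∈ range n, x p ^ 4 + ∑ p ∈ range n, y p ^ 4 ≤
      D ^ 4 * (3 * n / 4 + 30 * C) := by linarith
  calc (∑ p ∈ range n, x p ^ 4 + ∑ p ∈ range n, y p ^ 4) * n
      ≤ D ^ 4 * (3 * n / 4 + 30 * C) * n := by gcongr
    _ ≤ D ^ 4 * (3 * n / 4 + 30 * (n / 2000)) * n := by gcongr; linarith
    _ = (D ^ 2 * n) ^ 2 * (765 / 1000) := by ring
    _ ≤ (500 / 499) ^ 2 * (765 / 1000) := by gcongr
    _ ≤ 77 / 100 := by norm_num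

end SineSums

/-- At the edge the dispersion is `k2 - k1 + κ α²` to second order; a comparison of derivatives on a
small interval loses only the factor `19 / 20`. -/
theorem exists_disp_sub_ge {k1 k2 : ℝ} (hk1 : 0 < k1) (hk12 : k1 < k2) :
    ∃ b > 0, b ≤ 3 / 10 ∧ ∀ α β, 0 ≤ α → α ≤ β → β ≤ b →
      19 / 20 * (k1 * k2 / (2 * (k2 - k1))) * (β ^ 2 - α ^ 2) ≤
        disp k1 k2 β - disp k1 k2 α := by
  have hk2 := hk1.trans hk12
  have h0 : 0 < k2 - k1 := by linarith
  have hd := contDiff_disp hk1 hk12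
  -- Together with `sin t ≥ 0.977 t` on `[0, 3 / 10]` this gives `0.977 / 1.02 > 19 / 20`.
  have ev : ∀ᶠ α in 𝓝 (0 : ℝ), disp k1 k2 α < 102 / 100 * (k2 - k1) := by
    apply (hd.continuous.tendsto 0).eventually (gt_mem_nhds _)
    rw [disp_zero hk12]; linarith
  obtain ⟨ε, hε, hball⟩ := Metric.eventually_nhds_iff.mp ev
  refine ⟨min (ε / 2) (3 / 10), by positivity, min_le_right _ _, fun α β hα hαβ hβ => ?_⟩
  set κ := k1 * k2 / (2 * (k2 - k1)) with hκ
  have hderiv : ∀ t, HasDerivAt (fun t => disp k1 k2 t - 19 / 20 * κ * t ^ 2)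
      (k1 * k2 * Real.sin t / disp k1 k2 t - 19 / 20 * κ * (2 * t)) t := by
    intro t
    have hpos := disp_arg_pos hk1 hk12 t
    have h1 : HasDerivAt (disp k1 k2) (k1 * k2 * Real.sin t / disp k1 k2 t) t := by
      have h2 : HasDerivAt (fun α => k1 ^ 2 + k2 ^ 2 - 2 * (k1 * k2) * Real.cos α)
          (2 * (k1 * k2) * Real.sin t) t := by
        have := ((Real.hasDerivAt_cos t).const_mul (2 * (k1 * k2))).const_sub (k1 ^ 2 + k2 ^ 2)
        exact this.congr_deriv (by ring)
      have h3 := h2.sqrt (ne_of_gt (lt_of_lt_of_le (by positivity) hpos))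
      refine HasDerivAt.congr_deriv h3 ?_
      rw [mul_assoc 2, mul_div_mul_left _ _ two_ne_zero]
      rfl
    have h4 : HasDerivAt (fun t => 19 / 20 * κ * t ^ 2) (19 / 20 * κ * (2 * t)) t := by
      simpa using (hasDerivAt_pow 2 t).const_mul (19 / 20 * κ)
    exact h1.sub h4
  have hmono : MonotoneOn (fun t => disp k1 k2 t - 19 / 20 * κ * t ^ 2)
      (Set.Icc 0 (min (ε / 2) (3 / 10))) := by
    apply monotoneOn_of_deriv_nonneg (convex_Icc _ _)
    · exact fun t _ => (hderiv t).continuousAt.continuousWithinAt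
    · exact fun t _ => (hderiv t).differentiableAt.differentiableWithinAt
    · intro t ht
      rw [interior_Icc] at ht
      rw [(hderiv t).deriv]
      have ht1 : t ≤ ε / 2 := ht.2.le.trans (min_le_left _ _)
      have ht2 : t ≤ 3 / 10 := ht.2.le.trans (min_le_right _ _)
      have hb : disp k1 k2 t < 102 / 100 * (k2 - k1) := by
        apply hball
        rw [Real.dist_eq, sub_zero, abs_of_pos ht.1]
        linarith
      have hs := Real.sin_gt_sub_cube ht.1
      have hs2 : 977 / 1000 * t ≤ Real.sin t := by
        have h1 : t ^ 3 ≤ t * (3 / 10) ^ 2 := by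
          have : t ^ 3 = t * t ^ 2 := by ring
          rw [this]
          have := ht.1.le
          gcongr
        have := ht.1
        linarith
      have hdp := disp_pos hk1 hk12 t
      rw [sub_nonneg, le_div_iff₀ hdp, hκ]
      have e : 19 / 20 * (k1 * k2 / (2 * (k2 - k1))) * (2 * t) * disp k1 k2 t =
          k1 * k2 * (19 / 20 * t * disp k1 k2 t / (k2 - k1)) := by
        field_simp
      rw [e]
      apply mul_le_mul_of_nonneg_left _ (mul_pos hk1 hk2).le
      rw [div_le_iff₀ h0]
      have h3 : 19 / 20 * t * disp k1 k2 t ≤ 19 / 20 * t * (102 / 100 * (k2 - k1)) := by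
        have := ht.1.le
        gcongr
      have h4 := mul_le_mul_of_nonneg_right hs2 h0.le
      have h5 : 0 ≤ t * (k2 - k1) := mul_nonneg ht.1.le h0.le
      nlinarith
  have := hmono ⟨hα, hαβ.trans hβ⟩ ⟨hα.trans hαβ, hβ⟩ hαβ
  simp only at this
  linarith

theorem sum_inv_sq_sub_one_le (J : ℕ) :
    ∑ j ∈ Finset.Icc 2 J, 1 / ((j : ℝ) ^ 2 - 1) ≤ 3 / 4 := by
  have key : ∀ m : ℕ, ∑ j ∈ Finset.Icc 2 (m + 1), 1 / ((j : ℝ) ^ 2 - 1) =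
      3 / 4 - 1 / 2 * (1 / ((m : ℝ) + 1) + 1 / ((m : ℝ) + 2)) := by
    intro m
    induction m with
    | zero => norm_num
    | succ m ih =>
      rw [Finset.sum_Icc_succ_top (by omega), ih]
      have h1 : ((m + 1 + 1 : ℕ) : ℝ) ^ 2 - 1 = (m + 1) * (m + 3) := by push_cast; ring
      rw [h1]
      push_cast
      have : (m : ℝ) + 1 ≠ 0 := by positivity
      have : (m : ℝ) + 2 ≠ 0 := by positivity
      have : (m : ℝ) + 3 ≠ 0 := by positivity
      have : (m : ℝ) + 1 + 1 ≠ 0 := by positivity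
      have : (m : ℝ) + 1 + 2 ≠ 0 := by positivity
      field_simp
      ring
  rcases J with _ | m
  · norm_num
  · rw [key]
    have : 0 ≤ 1 / 2 * (1 / ((m : ℝ) + 1) + 1 / ((m : ℝ) + 2)) := by positivity
    linarith

theorem sum_inv_sq_sub_one_sq_le (J : ℕ) :
    ∑ j ∈ Finset.Icc 2 J, (1 / ((j : ℝ) ^ 2 - 1)) ^ 2 ≤ 1 / 4 := by
  calc ∑ j ∈ Finset.Icc 2 J, (1 / ((j : ℝ) ^ 2 - 1)) ^ 2
      ≤ ∑ j ∈ Finset.Icc 2 J, 1 / 3 * (1 / ((j : ℝ) ^ 2 - 1)) := by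
        apply sum_le_sum
        intro j hj
        have h2 : (2 : ℝ) ≤ j := by exact_mod_cast (Finset.mem_Icc.mp hj).1
        have h3 : 3 ≤ (j : ℝ) ^ 2 - 1 := by nlinarith
        rw [sq]
        apply mul_le_mul_of_nonneg_right
        · exact one_div_le_one_div_of_le (by norm_num) h3
        · exact one_div_nonneg.mpr (by linarith)
    _ ≤ 1 / 4 := by
      rw [← mul_sum]
      linarith [sum_inv_sq_sub_one_le J]

theorem growth_pos {k1 k2 : ℝ} (hk1 : 0 < k1) (hk12 : k1 < k2) : 0 < growth k1 k2 := by
  have := hk1.trans hk12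
  have : 0 < k2 - k1 := by linarith
  unfold growth; positivity

/-- The relative errors of half a percent in the wave numbers cost three percent of `j² - 1`,
uniformly in `j ≥ 2`. -/
theorem sq_sub_sq_ge_of_spacing {n α β j : ℝ} (hα : 0 ≤ n * α) (hj : 2 ≤ j)
    (h1 : j * Real.pi ≤ 201 / 200 * n * β) (h2 : 199 / 200 * n * α ≤ Real.pi) :
    97 / 100 * Real.pi ^ 2 * (j ^ 2 - 1) ≤ n ^ 2 * (β ^ 2 - α ^ 2) := by
  have hpi := Real.pi_pos
  have h3 : (j * Real.pi) ^ 2 ≤ (201 / 200 * n * β) ^ 2 := pow_le_pow_left₀ (by positivity) h1 2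
  have h4 : (199 / 200 * n * α) ^ 2 ≤ Real.pi ^ 2 := pow_le_pow_left₀ (by linarith) h2 2
  rw [mul_pow] at h3
  have e3 : (201 / 200 * n * β) ^ 2 = 40401 / 40000 * (n ^ 2 * β ^ 2) := by ring
  have e4 : (199 / 200 * n * α) ^ 2 = 39601 / 40000 * (n ^ 2 * α ^ 2) := by ring
  rw [e3] at h3
  rw [e4] at h4
  have h8 : 4 * Real.pi ^ 2 ≤ j ^ 2 * Real.pi ^ 2 := by
    gcongr
    nlinarith
  have h9 : 0 ≤ n ^ 2 * β ^ 2 := by positivity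
  have h10 : 0 ≤ n ^ 2 * α ^ 2 := by positivity
  linarith

/-- The modes near the edge contribute at most `(f n² / 180)² / 4 = (f n² / 360)²` to the sum. The
others number at most `2 n`, have gaps at least `d`, and fit into the margin between `360` and `350`
for large `n`. -/
theorem spacing_bounds {n f d : ℝ} {n1 : ℕ} {Δ : ℕ → ℝ} (hn : 1 ≤ n) (hf : 0 < f) (hd : 0 < d)
    (h1 : 540 ≤ n * (f * d)) (h2 : 5000000 ≤ n * (f ^ 2 * d ^ 2)) (hcard : (n1 : ℝ) ≤ 2 * n)
    (key : ∀ j ∈ D1 n1, 180 * ((j : ℝ) ^ 2 - 1) / (f * n ^ 2) ≤ Δ j ∨ d ≤ Δ j) :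
    (∀ j ∈ D1 n1, 540 / (f * n ^ 2) ≤ Δ j) ∧
      ∑ j ∈ D1 n1, (1 / Δ j) ^ 2 ≤ (f * n ^ 2 / 350) ^ 2 := by
  have hn0 : 0 < n := by linarith
  have hfn : 0 < f * n ^ 2 := by positivity
  have hj3 : ∀ j ∈ D1 n1, 3 ≤ (j : ℝ) ^ 2 - 1 := by
    intro j hj
    have h2 : (2 : ℝ) ≤ j := by exact_mod_cast (Finset.mem_Icc.mp hj).1
    nlinarith
  constructor
  · intro j hj
    rcases key j hj with h | h
    · refine le_trans ?_ h
      apply div_le_div_of_nonneg_right _ hfn.le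
      linarith [hj3 j hj]
    · refine le_trans ?_ h
      rw [div_le_iff₀ hfn]
      have : n * (f * d) ≤ n ^ 2 * (f * d) := by
        gcongr
        exact le_self_pow₀ hn two_ne_zero
      linarith
  · have hterm : ∀ j ∈ D1 n1, (1 / Δ j) ^ 2 ≤
        (f * n ^ 2 / 180) ^ 2 * (1 / ((j : ℝ) ^ 2 - 1)) ^ 2 + (1 / d) ^ 2 := by
      intro j hj
      have h3 := hj3 j hj
      have a1 := sq_nonneg (1 / d)
      have a2 := mul_nonneg (sq_nonneg (f * n ^ 2 / 180)) (sq_nonneg (1 / ((j : ℝ) ^ 2 - 1)))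
      rcases key j hj with h | h
      · have h5 : 0 < 180 * ((j : ℝ) ^ 2 - 1) / (f * n ^ 2) := div_pos (by linarith) hfn
        have h4 : 1 / Δ j ≤ 1 / (180 * ((j : ℝ) ^ 2 - 1) / (f * n ^ 2)) :=
          one_div_le_one_div_of_le h5 h
        have h6 := pow_le_pow_left₀ (one_div_nonneg.mpr (h5.le.trans h)) h4 2
        refine h6.trans ?_
        have e : 1 / (180 * ((j : ℝ) ^ 2 - 1) / (f * n ^ 2)) =
            (f * n ^ 2 / 180) * (1 / ((j : ℝ) ^ 2 - 1)) := by
          generalize (j : ℝ) ^ 2 - 1 = x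
          rw [one_div_div, div_mul_div_comm, mul_one]
        rw [e, mul_pow]
        linarith
      · have h4 := one_div_le_one_div_of_le hd h
        have h6 := pow_le_pow_left₀ (one_div_nonneg.mpr (hd.le.trans h)) h4 2
        linarith
    have hsum := sum_le_sum hterm
    rw [sum_add_distrib, ← mul_sum, sum_const, nsmul_eq_mul] at hsum
    have hcard' : ((D1 n1).card : ℝ) ≤ 2 * n := by
      refine le_trans ?_ hcard
      unfold D1
      rw [Nat.card_Icc]
      exact_mod_cast (by omega : n1 + 1 - 2 ≤ n1)
    have q1 := mul_le_mul_of_nonneg_left (sum_inv_sq_sub_one_sq_le n1)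
      (sq_nonneg (f * n ^ 2 / 180))
    have q2 := mul_le_mul_of_nonneg_right hcard' (sq_nonneg (1 / d))
    have q3 : 2 * n * (1 / d) ^ 2 ≤ (f * n ^ 2) ^ 2 * (1 / 2500000) := by
      have h4 : n * (f ^ 2 * d ^ 2) * n ≤ n ^ 3 * (f ^ 2 * d ^ 2) * n := by
        gcongr
        exact le_self_pow₀ hn (by norm_num)
      have h5 : 5000000 * n ≤ n * (f ^ 2 * d ^ 2) * n := by gcongr
      rw [one_div, inv_pow, ← div_eq_mul_inv, div_le_iff₀ (by positivity)]
      have e : (f * n ^ 2) ^ 2 * (1 / 2500000) * d ^ 2 =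
          1 / 2500000 * (n ^ 3 * (f ^ 2 * d ^ 2) * n) := by ring
      rw [e]
      linarith
    have q4 : 0 ≤ (f * n ^ 2) ^ 2 := sq_nonneg _
    have e1 : (f * n ^ 2 / 180) ^ 2 = (f * n ^ 2) ^ 2 / 32400 := by ring
    have e2 : (f * n ^ 2 / 350) ^ 2 = (f * n ^ 2) ^ 2 / 122500 := by ring
    unfold D1 at *
    linarith

theorem exists_optical_spacing {k1 k2 k31 k32 : ℝ} (hk1 : 0 < k1) (hk12 : k1 < k2)
    (hk31' : k31 ≠ 2 * k2) (hk32' : k32 ≠ 2 * k2) :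
    ∃ N : ℕ, ∀ n, N ≤ n → ∀ (n1 n2 : ℕ) (Ω : ℕ → ℝ)
      (u : ℕ → Fin (2 * n) → ℝ), IsSpectrum n k1 k2 k31 k32 n1 n2 Ω u →
      (∀ j ∈ D1 n1, 540 / (growth k1 k2 * n ^ 2) ≤ Ω j ^ 2 - Ω 1 ^ 2) ∧
        ∑ j ∈ D1 n1, (1 / (Ω j ^ 2 - Ω 1 ^ 2)) ^ 2 ≤ (growth k1 k2 * n ^ 2 / 350) ^ 2 := by
  obtain ⟨a, ha, ha1, B, hB, N0, H⟩ := exists_optical_phases hk1 hk12 hk31' hk32'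
  obtain ⟨b, hb, hb3, hdisp⟩ := exists_disp_sub_ge hk1 hk12
  have hk2 := hk1.trans hk12
  have h0 : 0 < k2 - k1 := by linarith
  have hpi := Real.pi_gt_three
  have hpi4 := Real.pi_le_four
  set f := growth k1 k2 with hf
  have hfpos : 0 < f := growth_pos hk1 hk12
  -- This is the meaning of `f`: it is `20` divided by the quadratic coefficient of the dispersion
  -- relation at the edge.
  have hfκ : 20 / f = k1 * k2 / (2 * (k2 - k1)) := by
    rw [hf]; unfold growth; field_simp; norm_num
  set c := min a b with hc
  have hcpos : 0 < c := lt_min ha hb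
  have hca : c ≤ a := min_le_left _ _
  have hcb : c ≤ b := min_le_right _ _
  -- For large `n` the first wave number is below `c / 2`, so every mode beyond `c` is separated
  -- from it by at least this amount, independently of `n`.
  set d := disp k1 k2 c - disp k1 k2 (c / 2) with hd
  have hdpos : 0 < d := by
    rw [hd, sub_pos]
    apply disp_strictMonoOn hk1 hk12 <;> first | constructor <;> linarith | linarith
  obtain ⟨N1, hN1⟩ := exists_nat_gt (200 * B + 10 / c + 540 / (f * d) + 5000000 / (f ^ 2 * d ^ 2))
  refine ⟨max N0 N1 + 1, fun n hn n1 n2 Ω u hS => ?_⟩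
  obtain ⟨hn1, hW1a, hW1, hWj⟩ := H n (by omega) n1 n2 Ω u hS
  have hnN : 200 * B + 10 / c + 540 / (f * d) + 5000000 / (f ^ 2 * d ^ 2) < n :=
    hN1.trans_le (by exact_mod_cast (by omega : N1 ≤ n))
  have p1 : 0 < 10 / c := by positivity
  have p2 : 0 < 540 / (f * d) := by positivity
  have p3 : 0 < 5000000 / (f ^ 2 * d ^ 2) := by positivity
  have hnB : 200 * B ≤ n := by linarith
  have hn1' : (1 : ℝ) ≤ n := by exact_mod_cast (by omega : 1 ≤ n)
  have hnc : 10 ≤ n * c := by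
    have : 10 / c ≤ n := by linarith
    rwa [div_le_iff₀ hcpos] at this
  have hnfd : 540 ≤ n * (f * d) := by
    have : 540 / (f * d) ≤ n := by linarith
    rwa [div_le_iff₀ (by positivity)] at this
  have hnfd2 : 5000000 ≤ n * (f ^ 2 * d ^ 2) := by
    have : 5000000 / (f ^ 2 * d ^ 2) ≤ n := by linarith
    rwa [div_le_iff₀ (by positivity)] at this
  have hspec : ∀ j ∈ Finset.Icc 1 n1, _ := fun j hj =>
    waveNumber_spec hk1 hk12 (hS.optical j hj).1 (hS.optical j hj).2
  have h1mem : 1 ∈ Finset.Icc 1 n1 := Finset.mem_Icc.mpr ⟨le_rfl, hn1⟩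
  set α1 := waveNumber k1 k2 (Ω 1) with hα1
  obtain ⟨w1, w2, w3, -⟩ := hspec 1 h1mem
  have hα1n : (n - B) * α1 ≤ Real.pi := by
    have := (abs_le.mp hW1).2; linarith
  have hα1n' : 199 / 200 * n * α1 ≤ Real.pi := by
    refine le_trans ?_ hα1n
    gcongr
    linarith
  have hα1c : α1 ≤ c / 2 := by
    by_contra! hcon
    have : 199 / 200 * n * (c / 2) < 199 / 200 * n * α1 := by gcongr
    nlinarith
  have key : ∀ j ∈ D1 n1, 180 * ((j : ℝ) ^ 2 - 1) / (f * n ^ 2) ≤ Ω j ^ 2 - Ω 1 ^ 2 ∨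
      d ≤ Ω j ^ 2 - Ω 1 ^ 2 := by
    intro j hj
    unfold D1 at hj
    have hj2 := (Finset.mem_Icc.mp hj).1
    have hj1 : j ∈ Finset.Icc 1 n1 := by rw [Finset.mem_Icc] at hj ⊢; omega
    obtain ⟨i1, i2, i3, -⟩ := hspec j hj1
    set αj := waveNumber k1 k2 (Ω j)
    have hsub : Ω j ^ 2 - Ω 1 ^ 2 = disp k1 k2 αj - disp k1 k2 α1 := by rw [i3, w3]; ring
    rcases le_or_gt αj c with h | h
    · left
      have hj2' : (2 : ℝ) ≤ j := by exact_mod_cast hj2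
      have h1 := hWj j hj1 (h.trans hca)
      have h2 : j * Real.pi ≤ 201 / 200 * n * αj := by
        refine h1.trans ?_
        gcongr
        linarith
      have h5 := sq_sub_sq_ge_of_spacing (by positivity) hj2' h2 hα1n'
      have hle : α1 ≤ αj := by
        by_contra! hcon
        have : (n : ℝ) ^ 2 * (αj ^ 2 - α1 ^ 2) < 0 := by
          apply mul_neg_of_pos_of_neg (by positivity)
          have := pow_lt_pow_left₀ hcon i1.le two_ne_zero
          linarith
        have h8 : 0 ≤ 97 / 100 * Real.pi ^ 2 * ((j : ℝ) ^ 2 - 1) :=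
          mul_nonneg (by positivity) (by nlinarith only [hj2'])
        linarith
      have h9 := hdisp α1 αj w1.le hle (h.trans hcb)
      rw [hsub]
      refine le_trans ?_ h9
      rw [← hfκ, div_le_iff₀ (by positivity)]
      have e : 19 / 20 * (20 / f) * (αj ^ 2 - α1 ^ 2) * (f * n ^ 2) =
          19 * (n ^ 2 * (αj ^ 2 - α1 ^ 2)) := by field_simp
      rw [e]
      -- The constant `180` results from `19 * 0.97 * 9.8`, which is slightly larger.
      have hpi2 : 98 / 10 ≤ Real.pi ^ 2 := by nlinarith only [Real.pi_gt_d2]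
      have h10 : 98 / 10 * ((j : ℝ) ^ 2 - 1) ≤ Real.pi ^ 2 * ((j : ℝ) ^ 2 - 1) :=
        mul_le_mul_of_nonneg_right hpi2 (by nlinarith only [hj2'])
      have h11 : 4 ≤ (j : ℝ) ^ 2 := by nlinarith only [hj2']
      linarith
    · right
      rw [hsub, hd]
      have m1 := disp_strictMonoOn hk1 hk12 (show c ∈ Set.Icc 0 Real.pi from
        ⟨hcpos.le, by linarith⟩) ⟨i1.le, i2.le⟩ h
      have m2 := (disp_strictMonoOn hk1 hk12).monotoneOn ⟨w1.le, w2.le⟩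
        (show c / 2 ∈ Set.Icc 0 Real.pi from ⟨by linarith, by linarith⟩) hα1c
      linarith
  have hj3 : ∀ j ∈ D1 n1, 3 ≤ (j : ℝ) ^ 2 - 1 := by
    intro j hj
    have h2 : (2 : ℝ) ≤ j := by exact_mod_cast (Finset.mem_Icc.mp hj).1
    nlinarith
  refine spacing_bounds hn1' hfpos hdpos hnfd hnfd2 (n1 := n1) ?_ key
  have := hS.count
  exact_mod_cast (by omega : n1 ≤ 2 * n)

end DiatomicChain
end

/-! ### Shape of the first optical mode, and the collected spectral bounds. -/

noncomputable section
namespace DiatomicChain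
open Finset Filter Topology

/-- The amplitude coefficient of the optical modes near the band edge. -/
def edgeAmp (k1 k2 k31 α : ℝ) : ℝ :=
  k2 * (disp k1 k2 α + (k2 - k31)) - k1 * (k2 - k31) * Real.cos α

theorem IsChainSeq.mul_even_eq {n : ℕ} {k1 k2 k31 k32 α : ℝ} {q : ℕ → ℝ} (hk1 : 0 < k1)
    (hk12 : k1 < k2) (hq : IsChainSeq n k1 k2 k31 k32 (disp k1 k2 α) q) {p : ℕ} (hp : p ≤ n) :
    k1 * k2 * Real.sin α * ((-1) ^ p * q (2 * p)) =
      q 1 * (edgeAmp k1 k2 k31 α * Real.sin (p * α) +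
        k1 * (k2 - k31) * Real.sin α * Real.cos (p * α)) := by
  rcases p with _ | p
  · have := hq.left
    simp
    linear_combination k1 * Real.sin α * this
  · have h := hq.mul_eq hk1.ne' (hk1.trans hk12).ne' (c := Real.cos α)
      (by rw [disp_sq hk1 hk12]; ring) (s := fun p => Real.sin (p * α)) (by simp) (by
        intro p
        have e1 : ((p + 2 : ℕ) : ℝ) * α = ((p + 1 : ℕ) : ℝ) * α + α := by push_cast; ring
        have e2 : (p : ℝ) * α = ((p + 1 : ℕ) : ℝ) * α - α := by push_cast; ring
        rw [e1, e2, Real.sin_add, Real.sin_sub]; ring) p hp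
    have e2 : (p : ℝ) * α = ((p + 1 : ℕ) : ℝ) * α - α := by push_cast; ring
    simp only [e2, Real.sin_sub, Nat.cast_one, one_mul] at h
    rw [show 2 * (p + 1) = 2 * p + 2 by ring]
    unfold edgeAmp
    linear_combination h

theorem abs_sin_sub_sin_le (x y : ℝ) : |Real.sin x - Real.sin y| ≤ |x - y| := by
  have := Real.lipschitzWith_sin.dist_le_mul x y
  simpa [Real.dist_eq] using this

theorem disp_sub_le {k1 k2 α : ℝ} (hk1 : 0 < k1) (hk12 : k1 < k2) (h0 : 0 ≤ α) (h1 : α ≤ 1) :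
    disp k1 k2 α - (k2 - k1) ≤ k1 * k2 / (k2 - k1) * α := by
  have hd : 0 < k2 - k1 := by linarith
  have hkk : 0 < k1 * k2 := mul_pos hk1 (hk1.trans hk12)
  have h2 := disp_sq hk1 hk12 α
  have h3 := le_disp hk1 hk12 α
  have h4 := Real.one_sub_sq_div_two_le_cos (x := α)
  have h5 : α ^ 2 ≤ α := by nlinarith
  have h6 : disp k1 k2 α ^ 2 - (k2 - k1) ^ 2 ≤ k1 * k2 * α := by
    rw [h2]
    have := mul_le_mul_of_nonneg_left (show 1 - Real.cos α ≤ α / 2 by linarith) hkk.le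
    linarith
  rw [div_mul_eq_mul_div, le_div_iff₀ hd]
  nlinarith

/-- Because `α` differs from `π / n` by `O(n^(-2))`, the even sites are proportional to `sin (p π /
n)` up to a relative error `O(1 / n)`. The odd sites inherit this from the recurrence, whose
limiting factor `(k1 - k2) / ν` is `-1` at the edge. The rest is `sine_profile_bounds`. -/
theorem exists_first_mode_bounds {k1 k2 k31 k32 : ℝ} (hk1 : 0 < k1) (hk12 : k1 < k2)
    (hk31' : k31 ≠ 2 * k2) (hk32' : k32 ≠ 2 * k2) :
    ∃ N : ℕ, ∀ n, N ≤ n → ∀ (n1 n2 : ℕ) (Ω : ℕ → ℝ)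
      (u : ℕ → Fin (2 * n) → ℝ), IsSpectrum n k1 k2 k31 k32 n1 n2 Ω u →
      1 ≤ n1 ∧ (∀ i, unitState (u 1) i ^ 2 * n ≤ 121 / 100) ∧
        (∑ i, unitState (u 1) i ^ 4) * n ≤ 77 / 100 := by
  obtain ⟨a, ha, ha1, B, hB, N0, H⟩ := exists_optical_phases hk1 hk12 hk31' hk32'
  have hk2 := hk1.trans hk12
  have h0 : 0 < k2 - k1 := by linarith
  have hpi := Real.pi_gt_three
  have hpi4 := Real.pi_le_four
  set l0 := edgeAmp k1 k2 k31 0 with hl0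
  have hl0ne : l0 ≠ 0 := by
    have : l0 = (k2 - k1) * (2 * k2 - k31) := by
      rw [hl0]; unfold edgeAmp; rw [disp_zero hk12, Real.cos_zero]; ring
    rw [this]
    exact mul_ne_zero h0.ne' (sub_ne_zero.mpr hk31'.symm)
  have hl0pos : 0 < |l0| := abs_pos.mpr hl0ne
  have hcont : Continuous (edgeAmp k1 k2 k31) := by
    have := (contDiff_disp hk1 hk12).continuous
    unfold edgeAmp; fun_prop
  have ev : ∀ᶠ α in 𝓝 (0 : ℝ), |l0| / 2 < |edgeAmp k1 k2 k31 α| :=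
    (hcont.abs.tendsto 0).eventually (lt_mem_nhds (by rw [← hl0]; linarith))
  obtain ⟨ε, hε, hball⟩ := Metric.eventually_nhds_iff.mp ev
  set C1 := B + 2 * k1 * |k2 - k31| / |l0| with hC1
  have hC1nn : 0 ≤ C1 := by positivity
  set C2 := ((k1 + k2) * (8 * C1) + k1 * 4 + k1 * k2 / (k2 - k1) * 8) / (k2 - k1) with hC2
  have hC2nn : 0 ≤ C2 := by positivity
  set C := 8 * C1 + C2 with hC
  have hCnn : 0 ≤ C := by positivity
  obtain ⟨N1, hN1⟩ := exists_nat_gt (2 * B + 8 / ε + 2000 * C)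
  refine ⟨max N0 N1 + 3, fun n hn n1 n2 Ω u hS => ?_⟩
  obtain ⟨hn1, hW1a, hW1, -⟩ := H n (by omega) n1 n2 Ω u hS
  refine ⟨hn1, ?_⟩
  have hnN : 2 * B + 8 / ε + 2000 * C < n :=
    hN1.trans_le (by exact_mod_cast (by omega : N1 ≤ n))
  have p1 : 0 < 8 / ε := by positivity
  have hn0 : (0 : ℝ) < n := by exact_mod_cast (by omega : 0 < n)
  have h1mem : 1 ∈ Finset.Icc 1 n1 := Finset.mem_Icc.mpr ⟨le_rfl, hn1⟩
  obtain ⟨w1, w2, w3, -⟩ := waveNumber_spec hk1 hk12 (hS.optical 1 h1mem).1 (hS.optical 1 h1mem).2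
  obtain ⟨q, hq, hvq, hq1⟩ := hS.exists_chainSeq hk1.ne' hk2.ne' (hS.mem_of_mem_optical h1mem)
  rw [← w3] at hq
  generalize waveNumber k1 k2 (Ω 1) = α at *
  have hα8 : α ≤ 8 / n := by
    rw [le_div_iff₀ hn0]
    have h1 := (abs_le.mp hW1).2
    have h2 : n / 2 * α ≤ (n - B) * α := by gcongr; linarith
    linarith
  have hαε : α < ε := by
    refine hα8.trans_lt ?_
    rw [div_lt_iff₀ hn0, mul_comm]
    rw [← div_lt_iff₀ hε]
    linarith
  have hlam := hball (show dist α 0 < ε by rwa [Real.dist_eq, sub_zero, abs_of_pos w1])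
  set lam := edgeAmp k1 k2 k31 α with hlamdef
  have hlam0 : 0 < |lam| := by linarith
  have hlamne : lam ≠ 0 := abs_pos.mp hlam0
  have hsin : 0 < Real.sin α := Real.sin_pos_of_pos_of_lt_pi w1 w2
  -- Relative weight of the cosine part of the mode; it is `O(α)` because `lam` stays away from
  -- zero.
  set η := k1 * (k2 - k31) * Real.sin α / lam with hη
  set A := q 1 * lam / (k1 * k2 * Real.sin α) with hA
  set S : ℕ → ℝ := fun p => Real.sin (p * Real.pi / n) with hSdef
  set E : ℕ → ℝ := fun p => Real.sin (p * α) + η * Real.cos (p * α) with hE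
  have hηle : |η| ≤ 2 * k1 * |k2 - k31| / |l0| * α := by
    rw [hη, abs_div, abs_mul, abs_mul, abs_of_pos hk1, abs_of_pos hsin,
      div_mul_eq_mul_div, div_le_div_iff₀ hlam0 hl0pos]
    have h1 : Real.sin α ≤ α := Real.sin_le w1.le
    calc k1 * |k2 - k31| * Real.sin α * |l0| ≤ k1 * |k2 - k31| * α * (2 * |lam|) := by
          gcongr; linarith
      _ = 2 * k1 * |k2 - k31| * α * |lam| := by ring
  have hES : ∀ p ≤ n, |E p - S p| ≤ 8 * C1 / n := by
    intro p hp
    have hpn : (p : ℝ) ≤ n := by exact_mod_cast hp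
    have h1 : |Real.sin (p * α) - S p| ≤ B * α := by
      refine (abs_sin_sub_sin_le _ _).trans ?_
      have e : (p : ℝ) * α - p * Real.pi / n = p / n * (n * α - Real.pi) := by field_simp
      rw [e, abs_mul, abs_of_nonneg (by positivity)]
      calc p / n * |n * α - Real.pi| ≤ 1 * (B * α) := by
            gcongr
            rw [div_le_one hn0]; exact hpn
        _ = B * α := one_mul _
    have h2 : |η * Real.cos (p * α)| ≤ |η| := by
      rw [abs_mul]
      exact mul_le_of_le_one_right (abs_nonneg _) (Real.abs_cos_le_one _)
    have e : E p - S p = (Real.sin (p * α) - S p) + η * Real.cos (p * α) := by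
      simp only [hE]; ring
    rw [e]
    calc _ ≤ |Real.sin (p * α) - S p| + |η * Real.cos (p * α)| := abs_add_le _ _
      _ ≤ C1 * α := by rw [hC1, add_mul]; linarith
      _ ≤ C1 * (8 / n) := by gcongr
      _ = 8 * C1 / n := by ring
  have hqE : ∀ p ≤ n, (-1) ^ p * q (2 * p) = A * E p := by
    intro p hp
    have h1 := hq.mul_even_eq hk1 hk12 hp
    have h2 : k1 * k2 * Real.sin α ≠ 0 := by positivity
    apply mul_left_cancel₀ h2
    rw [h1, ← hlamdef]
    simp only [hA, hE, hη]
    field_simp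
  have hS0 : ∀ p : ℕ, p ≤ n → 0 ≤ S p := by
    intro p hp
    apply Real.sin_nonneg_of_nonneg_of_le_pi
    · positivity
    · rw [div_le_iff₀ hn0, mul_comm]
      exact mul_le_mul_of_nonneg_left (by exact_mod_cast hp) Real.pi_pos.le
  have hCn : 8 * C1 / n ≤ C / n := by gcongr; linarith
  have hbx : ∀ p < n, |(|q (2 * p + 1)|) - |A| * S p| ≤ |A| * (C / n) := by
    intro p hp
    set ν := disp k1 k2 α with hνdef
    have hν0 : 0 < ν := disp_pos hk1 hk12 α
    have h1 : (-1) ^ p * q (2 * p + 1) = A * ((k1 * E (p + 1) - k2 * E p) / ν) := by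
      have h2 := hq.odd p hp
      have h3 := hqE p hp.le
      have h4 := hqE (p + 1) hp
      rw [show 2 * (p + 1) = 2 * p + 2 by ring, pow_succ] at h4
      rw [← mul_div_assoc, eq_div_iff hν0.ne']
      linear_combination -(-1) ^ p * h2 - k2 * h3 + k1 * h4
    have h2 : |q (2 * p + 1)| = |A| * |(k1 * E (p + 1) - k2 * E p) / ν| := by
      rw [← abs_mul, ← h1, abs_mul, abs_pow, abs_neg, abs_one, one_pow, one_mul]
    -- Each term of the numerator is `O(1 / n)`: two profile errors, one shift by a site, and the
    -- deviation of `ν` from its edge value.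
    have e : (k1 * E (p + 1) - k2 * E p) / ν + S p = (k1 * (E (p + 1) - S (p + 1)) -
        k2 * (E p - S p) + k1 * (S (p + 1) - S p) + (ν - (k2 - k1)) * S p) / ν := by
      field_simp; ring
    have b1 := hES (p + 1) hp
    have b2 := hES p hp.le
    have b3 : |S (p + 1) - S p| ≤ 4 / n := by
      refine (abs_sin_sub_sin_le _ _).trans ?_
      have : ((p + 1 : ℕ) : ℝ) * Real.pi / n - p * Real.pi / n = Real.pi / n := by
        push_cast; ring
      rw [this, abs_of_pos (by positivity)]
      gcongr
    have b4 : |ν - (k2 - k1)| ≤ k1 * k2 / (k2 - k1) * (8 / n) := by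
      rw [abs_of_nonneg (sub_nonneg.mpr (le_disp hk1 hk12 α))]
      refine (disp_sub_le hk1 hk12 w1.le (hW1a.trans ha1)).trans ?_
      gcongr
    have b5 : |S p| ≤ 1 := Real.abs_sin_le_one _
    have h3 : |(k1 * E (p + 1) - k2 * E p) / ν + S p| ≤ C2 / n := by
      rw [e, abs_div, abs_of_pos hν0, div_le_iff₀ hν0]
      have h4 : |k1 * (E (p + 1) - S (p + 1)) - k2 * (E p - S p) + k1 * (S (p + 1) - S p) +
          (ν - (k2 - k1)) * S p| ≤ k1 * (8 * C1 / n) + k2 * (8 * C1 / n) + k1 * (4 / n) +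
            k1 * k2 / (k2 - k1) * (8 / n) * 1 := by
        refine (abs_add_le _ _).trans (add_le_add ((abs_add_le _ _).trans (add_le_add
          ((abs_sub _ _).trans (add_le_add ?_ ?_)) ?_)) ?_)
        · rw [abs_mul, abs_of_pos hk1]; gcongr
        · rw [abs_mul, abs_of_pos hk2]; gcongr
        · rw [abs_mul, abs_of_pos hk1]; gcongr
        · rw [abs_mul]; gcongr
      refine h4.trans ?_
      have h5 : k1 * (8 * C1 / n) + k2 * (8 * C1 / n) + k1 * (4 / n) +
            k1 * k2 / (k2 - k1) * (8 / n) * 1 = C2 / n * (k2 - k1) := by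
        rw [hC2]; field_simp
      rw [h5]
      gcongr
      exact le_disp hk1 hk12 α
    rw [h2, ← mul_sub, abs_mul, abs_abs]
    apply mul_le_mul_of_nonneg_left _ (abs_nonneg _)
    calc abs (abs ((k1 * E (p + 1) - k2 * E p) / ν) - S p)
        = abs (abs ((k1 * E (p + 1) - k2 * E p) / ν) - abs (-(S p))) := by
          rw [abs_neg (S p), abs_of_nonneg (hS0 p hp.le)]
      _ ≤ |(k1 * E (p + 1) - k2 * E p) / ν - -(S p)| := abs_abs_sub_abs_le _ _
      _ ≤ C2 / n := by rwa [sub_neg_eq_add]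
      _ ≤ C / n := by gcongr; linarith
  have hby : ∀ p < n, |(|q (2 * p + 2)|) - |A| * S (p + 1)| ≤ |A| * (C / n) := by
    intro p hp
    have h1 := hqE (p + 1) hp
    have h2 : |q (2 * p + 2)| = |A| * |E (p + 1)| := by
      rw [← abs_mul, ← h1, abs_mul, abs_pow, abs_neg, abs_one, one_pow, one_mul]; rfl
    rw [h2, ← mul_sub, abs_mul, abs_abs]
    apply mul_le_mul_of_nonneg_left _ (abs_nonneg _)
    calc abs (abs (E (p + 1)) - S (p + 1)) = abs (abs (E (p + 1)) - abs (S (p + 1))) := by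
          rw [abs_of_nonneg (hS0 (p + 1) hp)]
      _ ≤ |E (p + 1) - S (p + 1)| := abs_abs_sub_abs_le _ _
      _ ≤ C / n := (hES (p + 1) hp).trans hCn
  have hsum : ∑ p ∈ range n, |q (2 * p + 1)| ^ 2 + ∑ p ∈ range n, |q (2 * p + 2)| ^ 2 = 1 := by
    simp only [sq_abs]
    rw [← sum_unitState_sq (hS.ne_zero 1 (hS.mem_of_mem_optical h1mem))]
    simp only [hvq]
    rw [sum_fin_two_mul n (fun i => q (i + 1) ^ 2)]
  obtain ⟨r1, r2, r3⟩ := sine_profile_bounds hCnn (by omega) (by linarith) (abs_nonneg A)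
    (fun p _ => abs_nonneg _) (fun p _ => abs_nonneg _) hbx hby hsum
  constructor
  · intro i
    have hi := i.2
    rw [hvq]
    rcases Nat.even_or_odd' (i : ℕ) with ⟨p, hp | hp⟩
    · have := r1 p (by omega)
      rw [sq_abs] at this
      rwa [hp]
    · have := r2 p (by omega)
      rw [sq_abs] at this
      rw [hp]
      exact this
  · have e : ∑ i, unitState (u 1) i ^ 4 =
        ∑ p ∈ range n, |q (2 * p + 1)| ^ 4 + ∑ p ∈ range n, |q (2 * p + 2)| ^ 4 := by
      have h4 : ∀ x : ℝ, |x| ^ 4 = x ^ 4 := fun x => Even.pow_abs (by decide) x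
      simp only [h4, hvq]
      rw [sum_fin_two_mul n (fun i => q (i + 1) ^ 4)]
    rw [e]
    exact r3

/-- The properties of the linear spectrum used for the nonlinear estimates. -/
structure SpecBounds (n : ℕ) (k1 k2 d K : ℝ) (n1 n2 : ℕ) (Ω : ℕ → ℝ)
    (u : ℕ → Fin (2 * n) → ℝ) : Prop where
  one_le : 1 ≤ n1
  first_sup : ∀ i, |unitState (u 1) i| ≤ 11 / 10 / Real.sqrt n
  first_pow_four : ∑ i, unitState (u 1) i ^ 4 ≤ 77 / 100 / n
  spacing : ∀ j ∈ D1 n1, 540 / (growth k1 k2 * n ^ 2) ≤ Ω j ^ 2 - Ω 1 ^ 2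
  spacing_sum : ∑ j ∈ D1 n1, (1 / (Ω j ^ 2 - Ω 1 ^ 2)) ^ 2 ≤ (growth k1 k2 * n ^ 2 / 350) ^ 2
  optical_sup : ∀ j ∈ Finset.Icc 1 n1, ∀ i, |unitState (u j) i| ≤ 7 / Real.sqrt n
  acoustic_sup : ∀ j ∈ D2 n n2, ∀ i, |unitState (u j) i| ≤ 7 / Real.sqrt n
  gap_sum : ∀ j ∈ D3 n n1 n2, ∑ i, |unitState (u j) i| ≤ K
  gap_spacing : ∀ j ∈ D3 n n1 n2, d ≤ Ω 1 ^ 2 - Ω j ^ 2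

theorem exists_specBounds {k1 k2 k31 k32 : ℝ} (hk1 : 0 < k1) (hk12 : k1 < k2)
    (hk31 : 0 < k31) (hk32 : 0 < k32) (hk31' : k31 ≠ 2 * k2) (hk32' : k32 ≠ 2 * k2) :
    ∃ d > 0, ∃ K > 0, ∃ N : ℕ, ∀ n, N ≤ n → ∀ (n1 n2 : ℕ) (Ω : ℕ → ℝ)
      (u : ℕ → Fin (2 * n) → ℝ), IsSpectrum n k1 k2 k31 k32 n1 n2 Ω u →
      SpecBounds n k1 k2 d K n1 n2 Ω u := by
  have hk2 := hk1.trans hk12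
  obtain ⟨N1, H1⟩ := exists_first_mode_bounds hk1 hk12 hk31' hk32'
  obtain ⟨N2, H2⟩ := exists_optical_spacing hk1 hk12 hk31' hk32'
  obtain ⟨ε, hε, N3, H3⟩ := exists_gap_bound hk1 hk12 hk31 hk32 hk31' hk32'
  -- The minimum keeps the second base nonnegative, so that `D` is positive whatever the size of
  -- `ε`.
  set D := (k2 - k1) ^ 2 - (k2 - k1 - min ε (k2 - k1)) ^ 2 with hD
  have h0 : 0 < k2 - k1 := by linarith
  have hmin : 0 < min ε (k2 - k1) := lt_min hε h0
  have hDpos : 0 < D := by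
    have := min_le_right ε (k2 - k1)
    rw [hD]; nlinarith
  refine ⟨ε, hε, 4 + 4 * (k1 * k2) / D, by positivity, N1 + N2 + N3 + 16,
    fun n hn n1 n2 Ω u hS => ?_⟩
  obtain ⟨a1, a2, a3⟩ := H1 n (by omega) n1 n2 Ω u hS
  obtain ⟨b1, b2⟩ := H2 n (by omega) n1 n2 Ω u hS
  have hn0 : (0 : ℝ) < n := by exact_mod_cast (by omega : 0 < n)
  have hcount := hS.count
  have heig : ∀ j ∈ Finset.Icc 1 (2 * n), (chainMatrix n k1 k2 k31 k32).mulVec (unitState (u j)) =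
      (-((Ω j ^ 2 - (k1 + k2)) + (k1 + k2))) • unitState (u j) := by
    intro j hj
    rw [hS.unitState_eigen hj, sub_add_cancel]
  have hone : 1 ∈ Finset.Icc 1 n1 := Finset.mem_Icc.mpr ⟨le_rfl, a1⟩
  have hD2 : ∀ j ∈ D2 n n2, j ∈ Finset.Icc 1 (2 * n) := by
    intro j hj
    unfold D2 at hj
    rw [Finset.mem_Icc] at *
    omega
  have hD3 : ∀ j ∈ D3 n n1 n2, j ∈ Finset.Icc (n1 + 1) (n1 + 2) := by
    intro j hj
    unfold D3 at hj
    rw [Finset.mem_insert, Finset.mem_singleton] at hj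
    rw [Finset.mem_Icc]
    omega
  have hgap : ∀ j ∈ D3 n n1 n2, |Ω j ^ 2 - (k1 + k2)| ≤ k2 - k1 - ε := by
    intro j hj
    have hj' := hD3 j hj
    obtain ⟨g1, g2⟩ := hS.gap j hj'
    obtain ⟨q, hq, -, hq1⟩ := hS.exists_chainSeq hk1.ne' hk2.ne' (j := j) (by
      rw [Finset.mem_Icc] at *; omega)
    exact H3 n (by omega) _ (sq_lt_sq' (by linarith) (by linarith)) q hq hq1
  refine ⟨a1, ?_, ?_, b1, b2, ?_, ?_, ?_, ?_⟩
  · intro i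
    rw [le_div_iff₀ (Real.sqrt_pos.mpr hn0)]
    apply abs_le_of_sq_le_sq' _ (by norm_num) |>.2
    rw [mul_pow, sq_abs, Real.sq_sqrt hn0.le]
    linarith [a2 i]
  · rw [le_div_iff₀ hn0]; exact a3
  · intro j hj i
    obtain ⟨o1, o2⟩ := hS.optical j hj
    have hj' := hS.mem_of_mem_optical hj
    exact abs_le_of_band (by omega) hk1 hk2 (pow_le_pow_left₀ h0.le (by linarith) 2)
      (pow_le_pow_left₀ (by linarith) (by linarith) 2) (heig j hj')
      (sum_unitState_sq (hS.ne_zero j hj')) i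
  · intro j hj i
    have hj' := hD2 j hj
    have o1 := hS.acoustic j hj
    have o2 := pow_pos (hS.pos j hj') 2
    refine abs_le_of_band (by omega) hk1 hk2 ?_ ?_ (heig j hj')
      (sum_unitState_sq (hS.ne_zero j hj')) i
    · rw [← neg_sq (Ω j ^ 2 - (k1 + k2))]
      exact pow_le_pow_left₀ h0.le (by linarith) 2
    · exact sq_le_sq' (by linarith) (by linarith)
  · intro j hj
    have hj' : j ∈ Finset.Icc 1 (2 * n) := by
      have := hD3 j hj
      rw [Finset.mem_Icc] at *; omega
    refine sum_abs_le_of_gap (by omega) hk1 hk2 hDpos ?_ (heig j hj')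
      (sum_unitState_sq (hS.ne_zero j hj'))
    have h1 := hgap j hj
    have h2 : |Ω j ^ 2 - (k1 + k2)| ≤ k2 - k1 - min ε (k2 - k1) := by
      linarith [min_le_left ε (k2 - k1)]
    have h3 := pow_le_pow_left₀ (abs_nonneg _) h2 2
    rw [sq_abs] at h3
    rw [hD]; linarith
  · intro j hj
    have h1 := (abs_le.mp (hgap j hj)).2
    have h2 := (hS.optical 1 hone).1
    linarith

end DiatomicChain
end

/-! ### Cosine coefficients and estimates of triple products. -/

noncomputable section
namespace DiatomicChain
open Finset MeasureTheory

/-- Half of the `k`-th Fourier cosine coefficient: for `g = ∑ a_k (e^{ikτ} + e^{-ikτ})` it is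
`a_k`. -/
def cosCoef (k : ℕ) (g : ℝ → ℝ) : ℝ :=
  (2 * Real.pi)⁻¹ * ∫ τ in (0 : ℝ)..(2 * Real.pi), g τ * Real.cos (k * τ)

theorem integral_cos_int_mul (m : ℤ) :
    ∫ τ in (0 : ℝ)..(2 * Real.pi), Real.cos (m * τ) = if m = 0 then 2 * Real.pi else 0 := by
  split_ifs with h
  · simp [h]
  · have hm : (m : ℝ) ≠ 0 := by exact_mod_cast h
    rw [intervalIntegral.integral_comp_mul_left (fun x => Real.cos x) hm, integral_cos]
    have : Real.sin (m * (2 * Real.pi)) = 0 := by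
      have := Real.sin_int_mul_pi (2 * m)
      push_cast at this
      rw [← this]; ring_nf
    simp [this]

theorem integral_two_cos_mul_cos {l k : ℕ} (hk : 1 ≤ k) :
    ∫ τ in (0 : ℝ)..(2 * Real.pi), 2 * Real.cos (((l : ℝ) + 1) * τ) * Real.cos (k * τ) =
      if l + 1 = k then 2 * Real.pi else 0 := by
  have e : ∀ τ : ℝ, 2 * Real.cos (((l : ℝ) + 1) * τ) * Real.cos (k * τ) =
      Real.cos (((l + 1 - k : ℤ) : ℝ) * τ) + Real.cos (((l + 1 + k : ℤ) : ℝ) * τ) := by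
    intro τ
    rw [Real.two_mul_cos_mul_cos]
    push_cast
    ring_nf
  simp only [e]
  rw [intervalIntegral.integral_add, integral_cos_int_mul, integral_cos_int_mul,
    if_neg (show ¬ ((l + 1 + k : ℤ) = 0) by omega), add_zero]
  · congr 1
    exact propext (by omega)
  all_goals exact Continuous.intervalIntegrable (by fun_prop) _ _

/-- The inequality `2 |a b| ≤ a² + b²` together with the mean `1 / 2` of a squared cosine gains a
factor two over the pointwise bound. This gain enters the numerical constants of the induction. -/
theorem integral_abs_two_cos_mul_cos_le (l k : ℕ) (hk : 1 ≤ k) :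
    ∫ τ in (0 : ℝ)..(2 * Real.pi), |2 * Real.cos (((l : ℝ) + 1) * τ)| * |Real.cos (k * τ)| ≤
      2 * Real.pi := by
  have hpi := Real.pi_pos
  have h1 : ∀ (m : ℕ), 1 ≤ m → ∫ τ in (0 : ℝ)..(2 * Real.pi), Real.cos (m * τ) ^ 2 = Real.pi := by
    intro m hm
    obtain ⟨m, rfl⟩ := Nat.exists_eq_add_of_le' hm
    have := integral_two_cos_mul_cos (l := m) (k := m + 1) (by omega)
    rw [if_pos rfl] at this
    have e : ∀ τ : ℝ, 2 * Real.cos (((m : ℝ) + 1) * τ) * Real.cos ((m + 1 : ℕ) * τ) =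
        2 * Real.cos ((m + 1 : ℕ) * τ) ^ 2 := by
      intro τ; push_cast; ring
    simp only [e] at this
    rw [intervalIntegral.integral_const_mul] at this
    linarith
  have h2 : ∫ τ in (0 : ℝ)..(2 * Real.pi),
      |2 * Real.cos (((l : ℝ) + 1) * τ)| * |Real.cos (k * τ)| ≤
      ∫ τ in (0 : ℝ)..(2 * Real.pi), (Real.cos ((l + 1 : ℕ) * τ) ^ 2 + Real.cos (k * τ) ^ 2) := by
    apply intervalIntegral.integral_mono_on (by linarith)
    · exact Continuous.intervalIntegrable (by fun_prop) _ _
    · exact Continuous.intervalIntegrable (by fun_prop) _ _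
    · intro τ _
      rw [abs_mul, abs_two]
      push_cast
      have := two_mul_le_add_sq |Real.cos (((l : ℝ) + 1) * τ)| |Real.cos (k * τ)|
      rwa [sq_abs, sq_abs] at this
  refine h2.trans (le_of_eq ?_)
  rw [intervalIntegral.integral_add, h1 _ (by omega), h1 _ hk]
  · ring
  all_goals exact Continuous.intervalIntegrable (by fun_prop) _ _

theorem abs_coef_cos_le (a : ℝ) (l : ℕ) (τ : ℝ) :
    |a * (2 * Real.cos (((l : ℝ) + 1) * τ))| ≤ 2 * |a| := by
  rw [abs_mul, abs_mul, abs_two]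
  have := mul_le_mul_of_nonneg_left (Real.abs_cos_le_one (((l : ℝ) + 1) * τ))
    (mul_nonneg zero_le_two (abs_nonneg a))
  linarith

theorem hasSum_integral_of_bound {F : ℕ → ℝ → ℝ} {f : ℝ → ℝ} {b : ℕ → ℝ}
    (hF : ∀ l, Continuous (F l)) (hb : ∀ l τ, |F l τ| ≤ b l) (hsum : Summable b)
    (hf : ∀ τ, HasSum (fun l => F l τ) (f τ)) (x y : ℝ) :
    HasSum (fun l => ∫ τ in x..y, F l τ) (∫ τ in x..y, f τ) := by
  apply intervalIntegral.hasSum_integral_of_dominated_convergence (fun l _ => b l)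
  · exact fun l => (hF l).aestronglyMeasurable
  · exact fun l => ae_of_all _ fun τ _ => hb l τ
  · exact ae_of_all _ fun τ _ => hsum
  · exact intervalIntegrable_const
  · exact ae_of_all _ fun τ _ => hf τ

theorem cosCoef_eq_of_hasSum {a : ℕ → ℝ} (ha : Summable fun l => |a l|) {g : ℝ → ℝ}
    (hg : ∀ τ, HasSum (fun l : ℕ => a l * (2 * Real.cos (((l : ℝ) + 1) * τ))) (g τ)) {k : ℕ}
    (hk : 1 ≤ k) : cosCoef k g = a (k - 1) := by
  have hpi := Real.pi_pos
  have h := hasSum_integral_of_bound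
    (F := fun (l : ℕ) τ => a l * (2 * Real.cos (((l : ℝ) + 1) * τ)) * Real.cos (k * τ))
    (b := fun l => 2 * |a l|) (fun l => by fun_prop) (fun l τ => by
      rw [abs_mul]
      exact (mul_le_of_le_one_right (abs_nonneg _) (Real.abs_cos_le_one _)).trans
        (abs_coef_cos_le _ l τ)) (ha.mul_left 2) (fun τ => (hg τ).mul_right _) 0 (2 * Real.pi)
  have e : ∀ l : ℕ, ∫ τ in (0 : ℝ)..(2 * Real.pi),
      a l * (2 * Real.cos (((l : ℝ) + 1) * τ)) * Real.cos (k * τ) =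
        if l = k - 1 then 2 * Real.pi * a (k - 1) else 0 := by
    intro l
    simp only [mul_assoc (a l)]
    rw [intervalIntegral.integral_const_mul, integral_two_cos_mul_cos hk]
    by_cases hl : l + 1 = k
    · rw [if_pos hl, if_pos (by omega), ← hl, Nat.add_sub_cancel, mul_comm]
    · rw [if_neg hl, if_neg (by omega), mul_zero]
  simp only [e] at h
  have h2 := h.unique (hasSum_ite_eq (k - 1) (2 * Real.pi * a (k - 1)))
  unfold cosCoef
  rw [h2]
  field_simp

theorem abs_cosCoef_le {g ξ : ℝ → ℝ} {k : ℕ} {C X : ℝ} (hg : Continuous g) (hξ : Continuous ξ)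
    (hC : 0 ≤ C) (hle : ∀ τ, |g τ| ≤ C * ξ τ)
    (hX : ∫ τ in (0 : ℝ)..(2 * Real.pi), ξ τ * |Real.cos (k * τ)| ≤ 2 * Real.pi * X) :
    |cosCoef k g| ≤ C * X := by
  have hpi := Real.pi_pos
  have h1 : |∫ τ in (0 : ℝ)..(2 * Real.pi), g τ * Real.cos (k * τ)| ≤
      ∫ τ in (0 : ℝ)..(2 * Real.pi), |g τ * Real.cos (k * τ)| :=
    intervalIntegral.abs_integral_le_integral_abs (by linarith)
  have h2 : ∫ τ in (0 : ℝ)..(2 * Real.pi), |g τ * Real.cos (k * τ)| ≤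
      ∫ τ in (0 : ℝ)..(2 * Real.pi), C * (ξ τ * |Real.cos (k * τ)|) := by
    apply intervalIntegral.integral_mono_on (by linarith)
    · exact Continuous.intervalIntegrable (by fun_prop) _ _
    · exact Continuous.intervalIntegrable (by fun_prop) _ _
    · intro τ _
      rw [abs_mul, ← mul_assoc]
      exact mul_le_mul_of_nonneg_right (hle τ) (abs_nonneg _)
  rw [intervalIntegral.integral_const_mul] at h2
  have h3 := mul_le_mul_of_nonneg_left hX hC
  unfold cosCoef
  rw [abs_mul, abs_of_pos (by positivity), inv_mul_le_iff₀ (by positivity)]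
  linarith

theorem integral_one_mul_abs_cos_le (k : ℕ) :
    ∫ τ in (0 : ℝ)..(2 * Real.pi), 1 * |Real.cos (k * τ)| ≤ 2 * Real.pi * 1 := by
  have hpi := Real.pi_pos
  have : ∫ τ in (0 : ℝ)..(2 * Real.pi), 1 * |Real.cos (k * τ)| ≤
      ∫ τ in (0 : ℝ)..(2 * Real.pi), (1 : ℝ) := by
    apply intervalIntegral.integral_mono_on (by linarith)
    · exact Continuous.intervalIntegrable (by fun_prop) _ _
    · exact Continuous.intervalIntegrable (by fun_prop) _ _
    · intro τ _
      rw [one_mul]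
      exact Real.abs_cos_le_one _
  simpa using this

/-- Bounds for a vector-valued trigonometric series: half of the sup-norm is at most `S`, and the
series has an envelope of the Euclidean norm with all half cosine moments at most `X`. -/
structure HarmBound {N : ℕ} (f : ℝ → Fin N → ℝ) (S X : ℝ) : Prop where
  cont : ∀ i, Continuous fun τ => f τ i
  sup : ∀ τ i, |f τ i| ≤ 2 * S
  S_nonneg : 0 ≤ S
  X_nonneg : 0 ≤ X
  env : ∃ ξ : ℝ → ℝ, Continuous ξ ∧ (∀ τ, 0 ≤ ξ τ) ∧ (∀ τ, ξ τ ≤ 2 * X) ∧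
    (∀ τ, ∑ i, f τ i ^ 2 ≤ ξ τ ^ 2) ∧ ∀ k : ℕ, 1 ≤ k →
      ∫ τ in (0 : ℝ)..(2 * Real.pi), ξ τ * |Real.cos (k * τ)| ≤ 2 * Real.pi * X

section Triple
variable {N : ℕ} {f1 f2 f3 : ℝ → Fin N → ℝ} {S1 S2 S3 X1 X2 X3 : ℝ}

theorem sum_abs_mul_abs_le (v w : Fin N → ℝ) {a b : ℝ} (ha : 0 ≤ a) (hb : 0 ≤ b)
    (hv : ∑ i, v i ^ 2 ≤ a ^ 2) (hw : ∑ i, w i ^ 2 ≤ b ^ 2) : ∑ i, |v i| * |w i| ≤ a * b := by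
  have h := Finset.sum_mul_sq_le_sq_mul_sq Finset.univ (fun i => |v i|) (fun i => |w i|)
  simp only [sq_abs] at h
  apply abs_le_of_sq_le_sq' _ (mul_nonneg ha hb) |>.2
  rw [mul_pow]
  refine h.trans ?_
  gcongr

theorem continuous_sum_mul_triple (h1 : HarmBound f1 S1 X1) (h2 : HarmBound f2 S2 X2)
    (h3 : HarmBound f3 S3 X3) (h : Fin N → ℝ) :
    Continuous fun τ => ∑ i, h i * (f1 τ i * (f2 τ i * f3 τ i)) := by
  have c1 := h1.cont
  have c2 := h2.cont
  have c3 := h3.cont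
  fun_prop

/-- Two factors are taken in sup norm, the third is paired with `h` by Cauchy-Schwarz. Only the
Euclidean norm of `h` enters, as the duality argument in `IsSpectrum.sum_sq_cubicCoef_le` requires.
-/
theorem abs_cosCoef_triple_le_norm (h1 : HarmBound f1 S1 X1) (h2 : HarmBound f2 S2 X2)
    (h3 : HarmBound f3 S3 X3) {h : Fin N → ℝ} {H : ℝ} (hH : 0 ≤ H) (hh : ∑ i, h i ^ 2 ≤ H ^ 2)
    {k : ℕ} (hk : 1 ≤ k) :
    |cosCoef k fun τ => ∑ i, h i * (f1 τ i * (f2 τ i * f3 τ i))| ≤ 4 * H * (S1 * S2 * X3) := by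
  obtain ⟨ξ, c, p0, -, p2, p3⟩ := h3.env
  have s1 := h1.S_nonneg
  have s2 := h2.S_nonneg
  have := abs_cosCoef_le (continuous_sum_mul_triple h1 h2 h3 h) c
    (C := 4 * H * (S1 * S2)) (by positivity) (fun τ => ?_) (p3 k hk)
  · linarith
  · calc |∑ i, h i * (f1 τ i * (f2 τ i * f3 τ i))|
        ≤ ∑ i, 4 * (S1 * S2) * (|h i| * |f3 τ i|) := by
          refine (abs_sum_le_sum_abs _ _).trans (sum_le_sum fun i _ => ?_)
          rw [abs_mul, abs_mul, abs_mul]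
          have a1 := h1.sup τ i
          have a2 := h2.sup τ i
          calc |h i| * (|f1 τ i| * (|f2 τ i| * |f3 τ i|))
              ≤ |h i| * ((2 * S1) * ((2 * S2) * |f3 τ i|)) := by gcongr
            _ = 4 * (S1 * S2) * (|h i| * |f3 τ i|) := by ring
      _ = 4 * (S1 * S2) * ∑ i, |h i| * |f3 τ i| := by rw [mul_sum]
      _ ≤ 4 * (S1 * S2) * (H * ξ τ) := by
          gcongr
          exact sum_abs_mul_abs_le _ _ hH (p0 τ) hh (p2 τ)
      _ = 4 * H * (S1 * S2) * ξ τ := by ring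

/-- Used with the first mode as `h`: its own sup norm replaces that of one factor, and the two
remaining factors are paired by Cauchy-Schwarz. -/
theorem abs_cosCoef_triple_le_sup (h1 : HarmBound f1 S1 X1) (h2 : HarmBound f2 S2 X2)
    (h3 : HarmBound f3 S3 X3) {h : Fin N → ℝ} {H : ℝ} (hH : 0 ≤ H) (hh : ∀ i, |h i| ≤ H)
    {k : ℕ} (hk : 1 ≤ k) :
    |cosCoef k fun τ => ∑ i, h i * (f1 τ i * (f2 τ i * f3 τ i))| ≤ 4 * H * (S1 * X2 * X3) := by
  obtain ⟨ξ, c, p0, -, p2, p3⟩ := h3.env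
  obtain ⟨ξ', -, p0', p1', p2', -⟩ := h2.env
  have s1 := h1.S_nonneg
  have x2 := h2.X_nonneg
  have := abs_cosCoef_le (continuous_sum_mul_triple h1 h2 h3 h) c
    (C := 4 * H * (S1 * X2)) (by positivity) (fun τ => ?_) (p3 k hk)
  · linarith
  · calc |∑ i, h i * (f1 τ i * (f2 τ i * f3 τ i))|
        ≤ ∑ i, 2 * H * S1 * (|f2 τ i| * |f3 τ i|) := by
          refine (abs_sum_le_sum_abs _ _).trans (sum_le_sum fun i _ => ?_)
          rw [abs_mul, abs_mul, abs_mul]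
          have a1 := h1.sup τ i
          calc |h i| * (|f1 τ i| * (|f2 τ i| * |f3 τ i|))
              ≤ H * ((2 * S1) * (|f2 τ i| * |f3 τ i|)) := by gcongr; exact hh i
            _ = 2 * H * S1 * (|f2 τ i| * |f3 τ i|) := by ring
      _ = 2 * H * S1 * ∑ i, |f2 τ i| * |f3 τ i| := by rw [mul_sum]
      _ ≤ 2 * H * S1 * ((2 * X2) * ξ τ) := by
          gcongr
          refine (sum_abs_mul_abs_le _ _ (p0' τ) (p0 τ) (p2' τ) (p2 τ)).trans ?_
          exact mul_le_mul_of_nonneg_right (p1' τ) (p0 τ)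
      _ = 4 * H * (S1 * X2) * ξ τ := by ring

/-- Used for the isolated modes: localization of `h` leaves all three factors in sup norm, each of
size `n^(-1/2)`. -/
theorem abs_cosCoef_triple_le_sum (h1 : HarmBound f1 S1 X1) (h2 : HarmBound f2 S2 X2)
    (h3 : HarmBound f3 S3 X3) {h : Fin N → ℝ} {H : ℝ} (hh : ∑ i, |h i| ≤ H) (k : ℕ) :
    |cosCoef k fun τ => ∑ i, h i * (f1 τ i * (f2 τ i * f3 τ i))| ≤ 8 * H * (S1 * S2 * S3) := by
  have s1 := h1.S_nonneg
  have s2 := h2.S_nonneg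
  have s3 := h3.S_nonneg
  have hH : 0 ≤ H := (sum_nonneg fun i _ => abs_nonneg (h i)).trans hh
  have := abs_cosCoef_le (continuous_sum_mul_triple h1 h2 h3 h) (continuous_const (y := (1 : ℝ)))
    (C := 8 * H * (S1 * S2 * S3)) (k := k) (by positivity) (fun τ => ?_)
    (integral_one_mul_abs_cos_le k)
  · linarith
  · calc |∑ i, h i * (f1 τ i * (f2 τ i * f3 τ i))|
        ≤ ∑ i, 8 * (S1 * S2 * S3) * |h i| := by
          refine (abs_sum_le_sum_abs _ _).trans (sum_le_sum fun i _ => ?_)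
          rw [abs_mul, abs_mul, abs_mul]
          have a1 := h1.sup τ i
          have a2 := h2.sup τ i
          have a3 := h3.sup τ i
          calc |h i| * (|f1 τ i| * (|f2 τ i| * |f3 τ i|))
              ≤ |h i| * ((2 * S1) * ((2 * S2) * (2 * S3))) := by gcongr
            _ = 8 * (S1 * S2 * S3) * |h i| := by ring
      _ = 8 * (S1 * S2 * S3) * ∑ i, |h i| := by rw [mul_sum]
      _ ≤ 8 * (S1 * S2 * S3) * H := by gcongr
      _ = 8 * H * (S1 * S2 * S3) * 1 := by ring

end Triple

section Envelope

/-- The envelope `∑ |a_l| |2 cos ((l + 1) τ)|` of a trigonometric series. -/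
def envelope (a : ℕ → ℝ) (τ : ℝ) : ℝ := ∑' l : ℕ, |a l| * |2 * Real.cos (((l : ℝ) + 1) * τ)|

variable {a : ℕ → ℝ}

theorem envelope_term_le (a : ℕ → ℝ) (l : ℕ) (τ : ℝ) :
    |a l| * |2 * Real.cos (((l : ℝ) + 1) * τ)| ≤ 2 * |a l| := by
  rw [← abs_mul]; exact abs_coef_cos_le _ l τ

theorem summable_envelope (ha : Summable fun l => |a l|) (τ : ℝ) :
    Summable fun l : ℕ => |a l| * |2 * Real.cos (((l : ℝ) + 1) * τ)| :=
  Summable.of_nonneg_of_le (fun _ => by positivity) (fun l => envelope_term_le a l τ)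
    (ha.mul_left 2)

theorem envelope_nonneg (τ : ℝ) : 0 ≤ envelope a τ := tsum_nonneg fun _ => by positivity

theorem envelope_le (ha : Summable fun l => |a l|) (τ : ℝ) : envelope a τ ≤ 2 * ∑' l, |a l| := by
  rw [← tsum_mul_left]
  exact (summable_envelope ha τ).tsum_le_tsum (fun l => envelope_term_le a l τ) (ha.mul_left 2)

theorem continuous_envelope (ha : Summable fun l => |a l|) : Continuous (envelope a) := by
  apply continuous_tsum (u := fun l => 2 * |a l|)
  · intro l; fun_prop
  · exact ha.mul_left 2
  · intro l τ
    rw [Real.norm_eq_abs, abs_of_nonneg (by positivity)]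
    exact envelope_term_le a l τ

theorem abs_le_envelope (ha : Summable fun l => |a l|) {g : ℝ → ℝ}
    (hg : ∀ τ, HasSum (fun l : ℕ => a l * (2 * Real.cos (((l : ℝ) + 1) * τ))) (g τ)) (τ : ℝ) :
    |g τ| ≤ envelope a τ := by
  rw [← (hg τ).tsum_eq]
  have h := summable_envelope ha τ
  simp only [← abs_mul] at h
  have := norm_tsum_le_tsum_norm (f := fun l : ℕ => a l * (2 * Real.cos (((l : ℝ) + 1) * τ))) h
  simpa only [envelope, Real.norm_eq_abs, abs_mul] using this

theorem integral_envelope_le (ha : Summable fun l => |a l|) {k : ℕ} (hk : 1 ≤ k) :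
    ∫ τ in (0 : ℝ)..(2 * Real.pi), envelope a τ * |Real.cos (k * τ)| ≤
      2 * Real.pi * ∑' l, |a l| := by
  have h := hasSum_integral_of_bound
    (F := fun (l : ℕ) τ => |a l| * |2 * Real.cos (((l : ℝ) + 1) * τ)| * |Real.cos (k * τ)|)
    (b := fun l => 2 * |a l|) (fun l => by fun_prop) (fun l τ => by
      rw [abs_of_nonneg (by positivity)]
      exact (mul_le_of_le_one_right (by positivity) (Real.abs_cos_le_one _)).trans
        (envelope_term_le a l τ)) (ha.mul_left 2)
      (fun τ => (summable_envelope ha τ).hasSum.mul_right _) 0 (2 * Real.pi)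
  rw [← tsum_mul_left]
  refine hasSum_le (fun l => ?_) h (ha.mul_left _).hasSum
  simp only [mul_assoc |a l|]
  rw [intervalIntegral.integral_const_mul, mul_comm]
  exact mul_le_mul_of_nonneg_right (integral_abs_two_cos_mul_cos_le l k hk) (abs_nonneg _)

end Envelope

/-- The envelope is the sum of the modal envelopes; it dominates the Euclidean norm by Parseval and
`∑ a² ≤ (∑ a)²` for nonnegative terms. -/
theorem IsSpectrum.harmBound {n : ℕ} {k1 k2 k31 k32 : ℝ} {n1 n2 : ℕ} {Ω : ℕ → ℝ}
    {u : ℕ → Fin (2 * n) → ℝ} (hS : IsSpectrum n k1 k2 k31 k32 n1 n2 Ω u)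
    {f : ℝ → Fin (2 * n) → ℝ} {a : ℕ → ℕ → ℝ} {μ : ℕ → ℝ} (hf : ∀ i, Continuous fun τ => f τ i)
    (ha : ∀ j ∈ Finset.Icc 1 (2 * n), Summable fun l => |a j l|)
    (hg : ∀ j ∈ Finset.Icc 1 (2 * n), ∀ τ,
      HasSum (fun l : ℕ => a j l * (2 * Real.cos (((l : ℝ) + 1) * τ)))
        (∑ p, unitState (u j) p * f τ p))
    (hμ : ∀ j ∈ Finset.Icc 1 (2 * n), ∀ i, |unitState (u j) i| ≤ μ j)
    (hμ0 : ∀ j ∈ Finset.Icc 1 (2 * n), 0 ≤ μ j) :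
    HarmBound f (∑ j ∈ Finset.Icc 1 (2 * n), μ j * ∑' l, |a j l|)
      (∑ j ∈ Finset.Icc 1 (2 * n), ∑' l, |a j l|) := by
  have t0 : ∀ j, 0 ≤ ∑' l, |a j l| := fun j => tsum_nonneg fun _ => abs_nonneg _
  have henv := fun j hj τ => abs_le_envelope (ha j hj) (hg j hj) τ
  refine ⟨hf, ?_, sum_nonneg fun j hj => mul_nonneg (hμ0 j hj) (t0 j),
    sum_nonneg fun j _ => t0 j, fun τ => ∑ j ∈ Finset.Icc 1 (2 * n), envelope (a j) τ, ?_, ?_, ?_,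
    ?_, ?_⟩
  · intro τ i
    rw [hS.expand (f τ) i, mul_sum]
    refine (abs_sum_le_sum_abs _ _).trans (sum_le_sum fun j hj => ?_)
    rw [abs_mul]
    calc |∑ p, unitState (u j) p * f τ p| * |unitState (u j) i|
        ≤ (2 * ∑' l, |a j l|) * μ j := by
          have := t0 j
          gcongr
          · exact (henv j hj τ).trans (envelope_le (ha j hj) τ)
          · exact hμ j hj i
      _ = 2 * (μ j * ∑' l, |a j l|) := by ring
  · exact continuous_finsetSum _ fun j hj => continuous_envelope (ha j hj)
  · exact fun τ => sum_nonneg fun j _ => envelope_nonneg τ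
  · intro τ
    rw [mul_sum]
    exact sum_le_sum fun j hj => envelope_le (ha j hj) τ
  · intro τ
    rw [← hS.parseval]
    refine le_trans (sum_le_sum fun j hj => ?_)
      (Finset.sum_sq_le_sq_sum_of_nonneg fun j _ => envelope_nonneg τ)
    rw [← sq_abs]
    exact pow_le_pow_left₀ (abs_nonneg _) (henv j hj τ) 2
  · intro k hk
    simp only [sum_mul]
    rw [intervalIntegral.integral_finsetSum, mul_sum]
    · exact sum_le_sum fun j hj => integral_envelope_le (ha j hj) hk
    · intro j hj
      have := continuous_envelope (ha j hj)
      exact Continuous.intervalIntegrable (by fun_prop) _ _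

end DiatomicChain
end

/-! ### From the formal expansion to scalar equations for the even orders. -/

noncomputable section
namespace DiatomicChain
open Finset MeasureTheory

theorem cosCoef_const_mul (k : ℕ) (x : ℝ) (g : ℝ → ℝ) :
    cosCoef k (fun τ => x * g τ) = x * cosCoef k g := by
  unfold cosCoef
  simp only [mul_assoc]
  rw [intervalIntegral.integral_const_mul]
  ring

theorem cosCoef_add (k : ℕ) {g g' : ℝ → ℝ} (hg : Continuous g) (hg' : Continuous g') :
    cosCoef k (fun τ => g τ + g' τ) = cosCoef k g + cosCoef k g' := by
  unfold cosCoef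
  simp only [add_mul]
  rw [intervalIntegral.integral_add, mul_add]
  all_goals exact Continuous.intervalIntegrable (by fun_prop) _ _

theorem cosCoef_sum {ι : Type*} (k : ℕ) (s : Finset ι) {g : ι → ℝ → ℝ}
    (hg : ∀ i ∈ s, Continuous (g i)) :
    cosCoef k (fun τ => ∑ i ∈ s, g i τ) = ∑ i ∈ s, cosCoef k (g i) := by
  unfold cosCoef
  simp only [sum_mul]
  rw [intervalIntegral.integral_finsetSum, mul_sum]
  intro i hi
  have := hg i hi
  exact Continuous.intervalIntegrable (by fun_prop) _ _

theorem cosCoef_sum_mul {ι : Type*} (k : ℕ) (s : Finset ι) (x : ι → ℝ) {g : ι → ℝ → ℝ}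
    (hg : ∀ i ∈ s, Continuous (g i)) :
    cosCoef k (fun τ => ∑ i ∈ s, x i * g i τ) = ∑ i ∈ s, x i * cosCoef k (g i) := by
  rw [cosCoef_sum k s (g := fun i τ => x i * g i τ)]
  · exact sum_congr rfl fun i _ => cosCoef_const_mul k _ _
  · intro i hi
    have := hg i hi
    fun_prop

theorem cosCoef_iteratedDeriv_two {g : ℝ → ℝ} (hg : ContDiff ℝ 2 g)
    (hper : ∀ τ, g (τ + 2 * Real.pi) = g τ) (k : ℕ) :
    cosCoef k (iteratedDeriv 2 g) = -(k : ℝ) ^ 2 * cosCoef k g := by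
  have hg1 : ContDiff ℝ 1 (deriv g) := ((contDiff_succ_iff_deriv (n := 1)).mp hg).2.2
  have d0 : ∀ x, HasDerivAt g (deriv g x) x := fun x =>
    (hg.differentiable (by norm_num) x).hasDerivAt
  have d1 : ∀ x, HasDerivAt (deriv g) (deriv (deriv g) x) x := fun x =>
    (hg1.differentiable (by norm_num) x).hasDerivAt
  have c1 : Continuous (deriv g) := hg1.continuous
  have c2 : Continuous (deriv (deriv g)) := hg1.continuous_deriv le_rfl
  have hc : ∀ x : ℝ, HasDerivAt (fun τ => Real.cos (k * τ)) (-(k * Real.sin (k * x))) x := by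
    intro x
    have := (Real.hasDerivAt_cos (k * x)).comp x ((hasDerivAt_id x).const_mul (k : ℝ))
    simpa [Function.comp_def, mul_comm] using this
  have hs : ∀ x : ℝ, HasDerivAt (fun τ => Real.sin (k * τ)) (k * Real.cos (k * x)) x := by
    intro x
    have := (Real.hasDerivAt_sin (k * x)).comp x ((hasDerivAt_id x).const_mul (k : ℝ))
    simpa [Function.comp_def, mul_comm] using this
  have p1 : deriv g (2 * Real.pi) = deriv g 0 := by
    have h := deriv_comp_add_const g (2 * Real.pi) 0
    rw [zero_add] at h
    rw [← h]
    congr 1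
    exact funext hper
  have e1 : Real.cos (k * (2 * Real.pi)) = 1 := by
    have := Real.cos_nat_mul_two_pi k
    exact this
  have e2 : Real.sin (k * (2 * Real.pi)) = 0 := by
    have := Real.sin_nat_mul_pi (2 * k)
    push_cast at this
    rw [← this]; ring_nf
  have i1 := intervalIntegral.integral_deriv_mul_eq_sub (a := 0) (b := 2 * Real.pi)
    (fun x _ => d1 x) (fun x _ => hc x) (c2.intervalIntegrable _ _)
    (Continuous.intervalIntegrable (by fun_prop) _ _)
  have i2 := intervalIntegral.integral_deriv_mul_eq_sub (a := 0) (b := 2 * Real.pi)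
    (fun x _ => d0 x) (fun x _ => hs x) (c1.intervalIntegrable _ _)
    (Continuous.intervalIntegrable (by fun_prop) _ _)
  have cg := hg.continuous
  rw [intervalIntegral.integral_add (Continuous.intervalIntegrable (by fun_prop) _ _)
    (Continuous.intervalIntegrable (by fun_prop) _ _)] at i1 i2
  have j1 : ∫ x in (0 : ℝ)..(2 * Real.pi), deriv g x * -(k * Real.sin (k * x)) =
      -k * ∫ x in (0 : ℝ)..(2 * Real.pi), deriv g x * Real.sin (k * x) := by
    rw [← intervalIntegral.integral_const_mul]
    congr 1; ext x; ring
  have j2 : ∫ x in (0 : ℝ)..(2 * Real.pi), g x * (k * Real.cos (k * x)) =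
      k * ∫ x in (0 : ℝ)..(2 * Real.pi), g x * Real.cos (k * x) := by
    rw [← intervalIntegral.integral_const_mul]
    congr 1; ext x; ring
  rw [j1, p1, e1, mul_zero, Real.cos_zero, sub_self] at i1
  rw [j2, e2, mul_zero, mul_zero, Real.sin_zero, mul_zero, sub_self] at i2
  have hit : iteratedDeriv 2 g = deriv (deriv g) := by
    rw [iteratedDeriv_succ, iteratedDeriv_one]
  unfold cosCoef
  rw [hit]
  linear_combination (2 * Real.pi)⁻¹ * i1 + (2 * Real.pi)⁻¹ * k * i2

/-- Two indices with an even sum have the same parity. -/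
theorem sum_antidiagonal_two_mul (p : ℕ) {f : ℕ × ℕ → ℝ}
    (hf : ∀ x : ℕ × ℕ, x.1 % 2 = 1 → x.2 % 2 = 1 → f x = 0) :
    ∑ x ∈ antidiagonal (2 * p), f x = ∑ x ∈ antidiagonal p, f (2 * x.1, 2 * x.2) := by
  symm
  apply Finset.sum_of_injOn (fun x : ℕ × ℕ => (2 * x.1, 2 * x.2))
  · intro x _ y _ h
    simp only [Prod.mk.injEq] at h
    ext <;> omega
  · intro x hx
    rw [mem_coe, HasAntidiagonal.mem_antidiagonal] at hx ⊢
    simp only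
    omega
  · intro x hx hx'
    rw [HasAntidiagonal.mem_antidiagonal] at hx
    apply hf
    all_goals
      by_contra h
      apply hx'
      refine ⟨(x.1 / 2, x.2 / 2), ?_, ?_⟩
      · rw [mem_coe, HasAntidiagonal.mem_antidiagonal]; simp only; omega
      · ext <;> simp only <;> omega
  · intro x _; rfl

theorem sum_antidiagonal_eq_ends {p : ℕ} (hp : p ≠ 0) (f : ℕ × ℕ → ℝ) :
    ∑ x ∈ antidiagonal p, f x = f (0, p) + f (p, 0) +
      ∑ x ∈ (antidiagonal p).filter (fun x => x.1 ≠ 0 ∧ x.2 ≠ 0), f x := by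
  rw [← sum_filter_add_sum_filter_not _ (fun x : ℕ × ℕ => x.1 ≠ 0 ∧ x.2 ≠ 0), add_comm]
  congr 1
  rw [← sum_pair (f := f) (a := (0, p)) (b := (p, 0)) (by simp [hp])]
  refine sum_congr ?_ fun _ _ => rfl
  ext ⟨a, b⟩
  simp only [mem_filter, HasAntidiagonal.mem_antidiagonal, mem_insert, mem_singleton,
    Prod.mk.injEq]
  omega

theorem coeff_sq_mk (w : ℕ → ℝ) (m : ℕ) :
    PowerSeries.coeff m ((PowerSeries.mk w) ^ 2) = ∑ x ∈ antidiagonal m, w x.1 * w x.2 := by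
  rw [sq, PowerSeries.coeff_mul]
  simp

theorem coeff_cube_mk (B : ℕ → ℝ) (m : ℕ) :
    PowerSeries.coeff m ((PowerSeries.mk B) ^ 3) =
      ∑ x ∈ antidiagonal m, ∑ y ∈ antidiagonal x.2, B x.1 * (B y.1 * B y.2) := by
  rw [pow_succ', PowerSeries.coeff_mul]
  simp only [coeff_sq_mk, PowerSeries.coeff_mk, mul_sum]

section Expansion
variable {n : ℕ} {k1 k2 k31 k32 : ℝ} {n1 n2 : ℕ} {Ω : ℕ → ℝ} {u : ℕ → Fin (2 * n) → ℝ}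
  {w : ℕ → ℝ} {Q : ℕ → ℝ → Fin (2 * n) → ℝ} {c : ℕ → ℕ → ℕ → ℝ}

theorem IsSpectrum.sum_unitState_mul_sum (hS : IsSpectrum n k1 k2 k31 k32 n1 n2 Ω u) {l : ℕ}
    (hl : l ∈ Icc 1 (2 * n)) (x : ℕ → ℝ) :
    ∑ i, unitState (u l) i * ∑ j ∈ Icc 1 (2 * n), x j * unitState (u j) i = x l := by
  simp only [mul_sum]
  rw [sum_comm]
  have : ∀ j ∈ Icc 1 (2 * n), ∑ i, unitState (u l) i * (x j * unitState (u j) i) =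
      if l = j then x j else 0 := by
    intro j hj
    have := hS.orthonormal hl hj
    calc ∑ i, unitState (u l) i * (x j * unitState (u j) i)
        = x j * ∑ i, unitState (u l) i * unitState (u j) i := by
          rw [mul_sum]; exact sum_congr rfl fun i _ => by ring
      _ = _ := by rw [this]; split_ifs <;> simp
  rw [sum_congr rfl this, sum_ite_eq, if_pos hl]

theorem IsSpectrum.sum_unitState_mul_mulVec (hS : IsSpectrum n k1 k2 k31 k32 n1 n2 Ω u) {j : ℕ}
    (hj : j ∈ Icc 1 (2 * n)) (v : Fin (2 * n) → ℝ) :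
    ∑ i, unitState (u j) i * ∑ p, chainMatrix n k1 k2 k31 k32 i p * v p =
      -Ω j ^ 2 * ∑ i, unitState (u j) i * v i := by
  have h := dotProduct_chainMatrix_mulVec (k1 := k1) (k2 := k2) (k31 := k31) (k32 := k32)
    (unitState (u j)) v
  rw [hS.unitState_eigen hj, smul_dotProduct, smul_eq_mul] at h
  exact h

/-- The `r`-th order part of `cosCoef k ⟨h, q³⟩`, for `q = ∑ ε ^ m q_m`. -/
def cubicCoef {N : ℕ} (q : ℕ → ℝ → Fin N → ℝ) (h : Fin N → ℝ) (r k : ℕ) : ℝ :=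
  ∑ x ∈ antidiagonal r, ∑ y ∈ antidiagonal x.2,
    cosCoef k (fun τ => ∑ i, h i * (q x.1 τ i * (q y.1 τ i * q y.2 τ i)))

namespace IsExpansion

theorem hasSum_mode (hE : IsExpansion n k1 k2 k31 k32 Ω u w Q c)
    (hS : IsSpectrum n k1 k2 k31 k32 n1 n2 Ω u) (m : ℕ) {j : ℕ} (hj : j ∈ Icc 1 (2 * n))
    (τ : ℝ) : HasSum (fun l : ℕ => c m (l + 1) j * (2 * Real.cos (((l : ℝ) + 1) * τ)))
      (∑ i, unitState (u j) i * Q m τ i) := by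
  have h := hasSum_sum (s := univ) fun i _ => (hE.form m τ i).mul_left (unitState (u j) i)
  rw [show (fun l : ℕ => c m (l + 1) j * (2 * Real.cos (((l : ℝ) + 1) * τ))) = _ from
    funext fun l => ?_]
  · exact h
  have := hS.sum_unitState_mul_sum hj
    (fun j' => c m (l + 1) j' * (2 * Real.cos (((l : ℝ) + 1) * τ)))
  rw [← this]
  refine sum_congr rfl fun i _ => ?_
  congr 1
  exact sum_congr rfl fun j' _ => by ring

/-- At time `0` all cosines equal `1`, and unconditional convergence of a real series is absolute
convergence. -/
theorem summable (hE : IsExpansion n k1 k2 k31 k32 Ω u w Q c)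
    (hS : IsSpectrum n k1 k2 k31 k32 n1 n2 Ω u) (m : ℕ) {j : ℕ} (hj : j ∈ Icc 1 (2 * n)) :
    Summable fun l => |c m (l + 1) j| := by
  have h := (hE.hasSum_mode hS m hj 0).summable.abs
  simp only [mul_zero, Real.cos_zero, mul_one] at h
  refine (h.mul_right (1 / 2)).congr fun l => ?_
  rw [abs_mul, abs_two]; ring

theorem cosCoef_mode (hE : IsExpansion n k1 k2 k31 k32 Ω u w Q c)
    (hS : IsSpectrum n k1 k2 k31 k32 n1 n2 Ω u) (m : ℕ) {j : ℕ} (hj : j ∈ Icc 1 (2 * n))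
    {k : ℕ} (hk : 1 ≤ k) :
    ∑ i, unitState (u j) i * cosCoef k (fun τ => Q m τ i) = c m k j := by
  rw [← cosCoef_sum_mul k univ (unitState (u j)) fun i _ => (hE.smooth m i).continuous,
    cosCoef_eq_of_hasSum (a := fun l => c m (l + 1) j) (hE.summable hS m hj)
      (hE.hasSum_mode hS m hj) hk, Nat.sub_add_cancel hk]

theorem periodic (hE : IsExpansion n k1 k2 k31 k32 Ω u w Q c) (m : ℕ) (i : Fin (2 * n)) (τ : ℝ) :
    Q m (τ + 2 * Real.pi) i = Q m τ i := by
  refine (hE.form m (τ + 2 * Real.pi) i).unique ?_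
  convert hE.form m τ i using 2 with l
  refine sum_congr rfl fun j _ => ?_
  congr 2
  have := Real.cos_add_nat_mul_two_pi (((l : ℝ) + 1) * τ) (l + 1)
  rw [← this]
  push_cast
  ring_nf

theorem coeff_zero (hE : IsExpansion n k1 k2 k31 k32 Ω u w Q c)
    (hS : IsSpectrum n k1 k2 k31 k32 n1 n2 Ω u) {j : ℕ} (hj : j ∈ Icc 1 (2 * n)) {k : ℕ}
    (hk : 1 ≤ k) : c 0 k j = if k = 1 ∧ j = 1 then 1 else 0 := by
  have h1 : 1 ∈ Icc 1 (2 * n) := by simp only [mem_Icc] at hj ⊢; omega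
  rw [← hE.cosCoef_mode hS 0 hj hk]
  have e : ∀ i, cosCoef k (fun τ => Q 0 τ i) = unitState (u 1) i * if k = 1 then 1 else 0 := by
    intro i
    simp only [hE.Q_zero]
    rw [cosCoef_const_mul]
    congr 1
    have := cosCoef_eq_of_hasSum (a := fun l => if l = 0 then 1 else 0)
      (g := fun τ => 2 * Real.cos τ) (summable_of_ne_finset_zero (s := {0}) (by
        intro b hb; simp at hb; simp [hb])) (fun τ => ?_) hk
    · rw [this]
      refine if_congr (by omega) rfl rfl
    · convert hasSum_ite_eq 0 (2 * Real.cos τ) using 2 with l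
      split_ifs with h
      · subst h; simp
      · simp
  simp only [e, ← mul_assoc]
  rw [← sum_mul, hS.orthonormal hj h1]
  by_cases a : k = 1 <;> by_cases b : j = 1 <;> simp [a, b]

theorem equation_coeff (hE : IsExpansion n k1 k2 k31 k32 Ω u w Q c) (m : ℕ) (τ : ℝ)
    (i : Fin (2 * n)) :
    ∑ x ∈ antidiagonal m, (∑ y ∈ antidiagonal x.1, w y.1 * w y.2) *
        iteratedDeriv 2 (fun s => Q x.2 s i) τ =
      (∑ p, chainMatrix n k1 k2 k31 k32 i p * Q m τ p) +
        if 2 ≤ m then ∑ x ∈ antidiagonal (m - 2), ∑ y ∈ antidiagonal x.2,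
          Q x.1 τ i * (Q y.1 τ i * Q y.2 τ i) else 0 := by
  have h := congrArg (PowerSeries.coeff (m + 1)) (hE.equation τ i)
  rw [mul_left_comm, PowerSeries.coeff_succ_X_mul, PowerSeries.coeff_mul, map_add, map_sum] at h
  simp only [PowerSeries.coeff_C_mul, PowerSeries.coeff_succ_X_mul, PowerSeries.coeff_mk,
    coeff_sq_mk] at h
  rw [h, mul_pow, PowerSeries.coeff_X_pow_mul', coeff_cube_mk]
  congr 1
  refine if_congr (by omega) ?_ rfl
  rw [show m + 1 - 3 = m - 2 by omega]

/-- The equation is projected on the mode `j` and on the harmonic `k`: symmetry of the chain matrix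
turns it into `-Ω_j²`, and two integrations by parts over a period turn the second derivative into
`-k²`. -/
theorem mode_equation (hE : IsExpansion n k1 k2 k31 k32 Ω u w Q c)
    (hS : IsSpectrum n k1 k2 k31 k32 n1 n2 Ω u) (m : ℕ) {j : ℕ} (hj : j ∈ Icc 1 (2 * n))
    {k : ℕ} (hk : 1 ≤ k) :
    (k : ℝ) ^ 2 * ∑ x ∈ antidiagonal m, (∑ y ∈ antidiagonal x.1, w y.1 * w y.2) * c x.2 k j =
      Ω j ^ 2 * c m k j - if 2 ≤ m then cubicCoef Q (unitState (u j)) (m - 2) k else 0 := by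
  have hc : ∀ m i, Continuous fun τ => Q m τ i := fun m i => (hE.smooth m i).continuous
  have hc2 : ∀ m i, Continuous (iteratedDeriv 2 fun τ => Q m τ i) := fun m i =>
    (hE.smooth m i).continuous_iteratedDeriv 2 le_rfl
  have hW : ∀ i, cosCoef k (fun τ => ∑ x ∈ antidiagonal m,
      (∑ y ∈ antidiagonal x.1, w y.1 * w y.2) * iteratedDeriv 2 (fun s => Q x.2 s i) τ) =
      ∑ x ∈ antidiagonal m, (∑ y ∈ antidiagonal x.1, w y.1 * w y.2) *
        (-(k : ℝ) ^ 2 * cosCoef k (fun τ => Q x.2 τ i)) := by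
    intro i
    rw [cosCoef_sum_mul k _ (fun x : ℕ × ℕ => ∑ y ∈ antidiagonal x.1, w y.1 * w y.2)
      (g := fun x => iteratedDeriv 2 (fun s => Q x.2 s i)) (fun x _ => hc2 x.2 i)]
    refine sum_congr rfl fun x _ => ?_
    rw [cosCoef_iteratedDeriv_two (hE.smooth _ i) (hE.periodic _ i)]
  have h1 : cosCoef k (fun τ => ∑ i, unitState (u j) i * ∑ x ∈ antidiagonal m,
      (∑ y ∈ antidiagonal x.1, w y.1 * w y.2) * iteratedDeriv 2 (fun s => Q x.2 s i) τ) =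
      -(k : ℝ) ^ 2 * ∑ x ∈ antidiagonal m,
        (∑ y ∈ antidiagonal x.1, w y.1 * w y.2) * c x.2 k j := by
    rw [cosCoef_sum_mul]
    · simp only [hW]
      rw [mul_sum]
      simp only [mul_sum (antidiagonal m)]
      rw [sum_comm]
      refine sum_congr rfl fun x _ => ?_
      rw [← hE.cosCoef_mode hS x.2 hj hk, mul_sum, mul_sum]
      exact sum_congr rfl fun i _ => by ring
    · intro i _
      exact continuous_finsetSum _ fun x _ => continuous_const.mul (hc2 x.2 i)
  have cT : ∀ x : ℕ × ℕ, ∀ y : ℕ × ℕ, Continuous fun τ =>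
      ∑ i, unitState (u j) i * (Q x.1 τ i * (Q y.1 τ i * Q y.2 τ i)) := by
    intro x y; fun_prop
  have h2 : (fun τ => ∑ i, unitState (u j) i * ∑ x ∈ antidiagonal m,
      (∑ y ∈ antidiagonal x.1, w y.1 * w y.2) * iteratedDeriv 2 (fun s => Q x.2 s i) τ) =
      fun τ => -Ω j ^ 2 * (∑ i, unitState (u j) i * Q m τ i) +
        ∑ x ∈ antidiagonal (m - 2), ∑ y ∈ antidiagonal x.2, (if 2 ≤ m then 1 else 0) *
          ∑ i, unitState (u j) i * (Q x.1 τ i * (Q y.1 τ i * Q y.2 τ i)) := by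
    ext τ
    simp only [hE.equation_coeff m τ, mul_add, sum_add_distrib]
    rw [hS.sum_unitState_mul_mulVec hj]
    congr 1
    split_ifs
    · simp only [mul_sum, one_mul]
      rw [sum_comm]
      refine sum_congr rfl fun x _ => ?_
      rw [sum_comm]
    · simp
  have h3 := h1
  rw [h2, cosCoef_add k (g := fun τ => -Ω j ^ 2 * ∑ i, unitState (u j) i * Q m τ i)
    (g' := fun τ => ∑ x ∈ antidiagonal (m - 2), ∑ y ∈ antidiagonal x.2, (if 2 ≤ m then 1 else 0) *
      ∑ i, unitState (u j) i * (Q x.1 τ i * (Q y.1 τ i * Q y.2 τ i))) (by fun_prop)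
    (by fun_prop), cosCoef_const_mul,
    cosCoef_sum_mul k univ _ fun i _ => hc m i, hE.cosCoef_mode hS m hj hk,
    cosCoef_sum k _ fun x _ => by fun_prop] at h3
  have h4 : ∑ x ∈ antidiagonal (m - 2), cosCoef k (fun τ => ∑ y ∈ antidiagonal x.2,
      (if 2 ≤ m then 1 else 0) *
        ∑ i, unitState (u j) i * (Q x.1 τ i * (Q y.1 τ i * Q y.2 τ i))) =
      if 2 ≤ m then cubicCoef Q (unitState (u j)) (m - 2) k else 0 := by
    have : ∀ x ∈ antidiagonal (m - 2), cosCoef k (fun τ => ∑ y ∈ antidiagonal x.2,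
      (if 2 ≤ m then 1 else 0) *
        ∑ i, unitState (u j) i * (Q x.1 τ i * (Q y.1 τ i * Q y.2 τ i))) =
      (if 2 ≤ m then 1 else 0) * ∑ y ∈ antidiagonal x.2, cosCoef k (fun τ =>
        ∑ i, unitState (u j) i * (Q x.1 τ i * (Q y.1 τ i * Q y.2 τ i))) := by
      intro x _
      rw [cosCoef_sum_mul k _ _ fun y _ => cT x y, mul_sum]
    rw [sum_congr rfl this, ← mul_sum]
    split_ifs
    · rw [one_mul, cubicCoef]
    · simp
  rw [h4] at h3
  linarith

end IsExpansion

/-- For the mode `j` and the harmonic `k`, the linear operator is resonant only if `j = k = 1`. -/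
theorem IsSpectrum.nonresonant (hS : IsSpectrum n k1 k2 k31 k32 n1 n2 Ω u) (hk1 : 0 < k1)
    (hk12 : k1 < k2) (hn1 : 1 ≤ n1) {j : ℕ} (hj : j ∈ Icc 1 (2 * n)) {k : ℕ} (hk : 2 ≤ k) :
    k2 * (k : ℝ) ^ 2 ≤ (k : ℝ) ^ 2 * Ω 1 ^ 2 - Ω j ^ 2 := by
  have h1 := (hS.optical 1 (by simp [hn1])).1
  have hk' : (2 : ℝ) ≤ k := by exact_mod_cast hk
  have hc := hS.count
  have hj' : Ω j ^ 2 < 2 * k1 + 2 * k2 := by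
    simp only [mem_Icc] at hj
    rcases le_or_gt j n1 with h | h
    · exact (hS.optical j (by simp only [mem_Icc]; omega)).2
    · rcases le_or_gt j (n1 + 2) with h' | h'
      · have := (hS.gap j (by simp only [mem_Icc]; omega)).2
        linarith
      · have := hS.acoustic j (by simp only [mem_Icc]; omega)
        linarith
  have hk4 : (4 : ℝ) ≤ (k : ℝ) ^ 2 := by nlinarith
  have h2 := mul_le_mul_of_nonneg_left h1.le (sq_nonneg (k : ℝ))
  -- All frequencies satisfy `Ω_j² < 4 k2 ≤ k2 k²`, while `k² Ω_1²` exceeds `2 k2 k²`.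
  have h3 := mul_le_mul_of_nonneg_left hk4 (hk1.trans hk12).le
  linarith

/-- If the lower odd orders vanish, an odd order receives no forcing: a cubic term of odd total
order contains an odd factor. The resonant equation then gives a vanishing frequency correction,
nonresonance kills the other coefficients, and the normalization kills the last one. -/
theorem IsExpansion.odd_eq_zero (hE : IsExpansion n k1 k2 k31 k32 Ω u w Q c)
    (hS : IsSpectrum n k1 k2 k31 k32 n1 n2 Ω u) (hk1 : 0 < k1) (hk12 : k1 < k2) (hn1 : 1 ≤ n1)
    (m : ℕ) (hm : m % 2 = 1) : w m = 0 ∧ ∀ τ i, Q m τ i = 0 := by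
  induction m using Nat.strong_induction_on with
  | _ m ih =>
  have hcnt := hS.count
  have h1mem : 1 ∈ Icc 1 (2 * n) := by simp only [mem_Icc]; omega
  have hpos := hS.pos 1 h1mem
  have hcubic : ∀ (h : Fin (2 * n) → ℝ) (k : ℕ), (if 2 ≤ m then cubicCoef Q h (m - 2) k else (0 : ℝ)) = 0 := by
    intro h k
    split_ifs with hm2
    · unfold cubicCoef
      refine sum_eq_zero fun x hx => sum_eq_zero fun y hy => ?_
      rw [HasAntidiagonal.mem_antidiagonal] at hx hy
      have : ∀ τ i, Q x.1 τ i * (Q y.1 τ i * Q y.2 τ i) = 0 := by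
        intro τ i
        rcases Nat.mod_two_eq_zero_or_one x.1 with a | a
        · rcases Nat.mod_two_eq_zero_or_one y.1 with b | b
          · rw [(ih y.2 (by omega) (by omega)).2]; ring
          · rw [(ih y.1 (by omega) (by omega)).2]; ring
        · rw [(ih x.1 (by omega) (by omega)).2]; ring
      simp [this, cosCoef]
    · rfl
  have hWlt : ∀ a < m, a % 2 = 1 → ∑ y ∈ antidiagonal a, w y.1 * w y.2 = 0 := by
    intro a ha ha'
    refine sum_eq_zero fun y hy => ?_
    rw [HasAntidiagonal.mem_antidiagonal] at hy
    rcases Nat.mod_two_eq_zero_or_one y.1 with b | b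
    · rw [(ih y.2 (by omega) (by omega)).1, mul_zero]
    · rw [(ih y.1 (by omega) (by omega)).1, zero_mul]
  have hclt : ∀ b < m, b % 2 = 1 → ∀ j ∈ Icc 1 (2 * n), ∀ k : ℕ, 1 ≤ k → c b k j = 0 := by
    intro b hb hb' j hj k hk
    rw [← hE.cosCoef_mode hS b hj hk]
    simp [(ih b hb hb').2, cosCoef]
  have hWm : ∑ y ∈ antidiagonal m, w y.1 * w y.2 = 2 * (Ω 1 * w m) := by
    rw [sum_antidiagonal_eq_ends (by omega), sum_eq_zero, ← hE.w_zero]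
    · ring
    · intro y hy
      rw [mem_filter, HasAntidiagonal.mem_antidiagonal] at hy
      rcases Nat.mod_two_eq_zero_or_one y.1 with b | b
      · rw [(ih y.2 (by omega) (by omega)).1, mul_zero]
      · rw [(ih y.1 (by omega) (by omega)).1, zero_mul]
  have hmain : ∀ j ∈ Icc 1 (2 * n), ∀ k : ℕ, 1 ≤ k → (k : ℝ) ^ 2 * (Ω 1 ^ 2 * c m k j +
      2 * (Ω 1 * w m) * c 0 k j) = Ω j ^ 2 * c m k j := by
    intro j hj k hk
    have := hE.mode_equation hS m hj hk
    rw [hcubic, sub_zero] at this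
    rw [← this, sum_antidiagonal_eq_ends (by omega), hWm, HasAntidiagonal.antidiagonal_zero,
      sum_singleton, hE.w_zero, sum_eq_zero (s := filter _ _)]
    · ring
    · intro y hy
      rw [mem_filter, HasAntidiagonal.mem_antidiagonal] at hy
      rcases Nat.mod_two_eq_zero_or_one y.1 with b | b
      · rw [hclt y.2 (by omega) (by omega) j hj k hk, mul_zero]
      · rw [hWlt y.1 (by omega) b, zero_mul]
  have hw : w m = 0 := by
    have := hmain 1 h1mem 1 le_rfl
    rw [hE.normalized m (by omega), hE.c_zero] at this
    simpa [hpos.ne'] using this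
  refine ⟨hw, fun τ i => ?_⟩
  have hc0 : ∀ j ∈ Icc 1 (2 * n), ∀ k : ℕ, 1 ≤ k → c m k j = 0 := by
    intro j hj k hk
    have h := hmain j hj k hk
    rw [hw] at h
    rcases hk.eq_or_lt with rfl | hk2
    · by_cases hj1 : j = 1
      · subst hj1; exact hE.normalized m (by omega)
      · have : Ω 1 ^ 2 - Ω j ^ 2 ≠ 0 := fun h0 => hj1 (hS.sq_injOn hj h1mem (by linarith))
        apply mul_left_cancel₀ this
        rw [Nat.cast_one] at h
        linarith
    · have := hS.nonresonant hk1 hk12 hn1 hj hk2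
      have hne : (k : ℝ) ^ 2 * Ω 1 ^ 2 - Ω j ^ 2 ≠ 0 := by
        have : 0 < k2 * (k : ℝ) ^ 2 := by
          have := hk1.trans hk12
          positivity
        linarith
      apply mul_left_cancel₀ hne
      linarith
  refine (hE.form m τ i).unique ?_
  convert hasSum_zero with l
  refine sum_eq_zero fun j hj => ?_
  rw [hc0 j hj _ (by omega)]
  ring

/-- The relations between the even-order coefficients of an expansion: `ω p`, `q p`, `γ p` are the
terms of order `2 p`. -/
structure IsReduced (n : ℕ) (Ω : ℕ → ℝ) (u : ℕ → Fin (2 * n) → ℝ) (ω : ℕ → ℝ)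
    (q : ℕ → ℝ → Fin (2 * n) → ℝ) (γ : ℕ → ℕ → ℕ → ℝ) : Prop where
  cont : ∀ p i, Continuous fun τ => q p τ i
  summable : ∀ p, ∀ j ∈ Icc 1 (2 * n), Summable fun l => |γ p (l + 1) j|
  hasSum : ∀ p, ∀ j ∈ Icc 1 (2 * n), ∀ τ,
    HasSum (fun l : ℕ => γ p (l + 1) j * (2 * Real.cos (((l : ℝ) + 1) * τ)))
      (∑ i, unitState (u j) i * q p τ i)
  freq_zero : ω 0 = Ω 1
  zero : ∀ j ∈ Icc 1 (2 * n), ∀ k, 1 ≤ k → γ 0 k j = if k = 1 ∧ j = 1 then 1 else 0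
  normalized : ∀ p, 1 ≤ p → γ p 1 1 = 0
  mode : ∀ p, ∀ j ∈ Icc 1 (2 * n), ∀ k : ℕ, 1 ≤ k →
    (k : ℝ) ^ 2 * ∑ x ∈ antidiagonal (p + 1),
        (∑ y ∈ antidiagonal x.1, ω y.1 * ω y.2) * γ x.2 k j =
      Ω j ^ 2 * γ (p + 1) k j - cubicCoef q (unitState (u j)) p k

theorem IsExpansion.isReduced (hE : IsExpansion n k1 k2 k31 k32 Ω u w Q c)
    (hS : IsSpectrum n k1 k2 k31 k32 n1 n2 Ω u) (hk1 : 0 < k1) (hk12 : k1 < k2) (hn1 : 1 ≤ n1) :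
    IsReduced n Ω u (fun p => w (2 * p)) (fun p => Q (2 * p)) (fun p => c (2 * p)) where
  cont p i := (hE.smooth _ i).continuous
  summable p j hj := hE.summable hS _ hj
  hasSum p j hj := hE.hasSum_mode hS _ hj
  freq_zero := hE.w_zero
  zero j hj k hk := hE.coeff_zero hS hj hk
  normalized p hp := hE.normalized _ (by omega)
  mode p j hj k hk := by
    have ho := hE.odd_eq_zero hS hk1 hk12 hn1
    have h := hE.mode_equation hS (2 * (p + 1)) hj hk
    have hW : ∀ a, ∑ y ∈ antidiagonal (2 * a), w y.1 * w y.2 =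
        ∑ y ∈ antidiagonal a, w (2 * y.1) * w (2 * y.2) := fun a =>
      sum_antidiagonal_two_mul a (f := fun y => w y.1 * w y.2)
        fun y hy _ => by rw [(ho _ hy).1, zero_mul]
    have hC : cubicCoef Q (unitState (u j)) (2 * p) k =
        cubicCoef (fun p => Q (2 * p)) (unitState (u j)) p k := by
      have z : ∀ x y : ℕ × ℕ, x.1 % 2 = 1 ∨ y.1 % 2 = 1 →
          cosCoef k (fun τ => ∑ i, unitState (u j) i *
            (Q x.1 τ i * (Q y.1 τ i * Q y.2 τ i))) = 0 := by
        rintro x y (hx | hy)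
        · simp [(ho _ hx).2, cosCoef]
        · simp [(ho _ hy).2, cosCoef]
      unfold cubicCoef
      rw [sum_antidiagonal_two_mul p fun x hx _ => sum_eq_zero fun y _ => z x y (Or.inl hx)]
      refine sum_congr rfl fun x _ => ?_
      rw [sum_antidiagonal_two_mul x.2 (f := fun y => cosCoef k (fun τ =>
        ∑ i, unitState (u j) i * (Q (2 * x.1) τ i * (Q y.1 τ i * Q y.2 τ i))))
        fun y hy _ => z (2 * x.1, 0) y (Or.inr hy)]
    rw [if_pos (by omega), show 2 * (p + 1) - 2 = 2 * p by omega, hC, sum_antidiagonal_two_mul] at h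
    · simpa only [hW] using h
    · intro x _ hx
      rw [← hE.cosCoef_mode hS _ hj hk]
      simp [(ho _ hx).2, cosCoef]

end Expansion
end DiatomicChain
end

/-! ### The majorizing sequence, its convolutions, and duality for the cubic term. -/

noncomputable section
namespace DiatomicChain
open Finset MeasureTheory

/-- The majorizing sequence `F ^ a / (a² + 2)`, with the constant term removed. -/
def weight (F : ℝ) (a : ℕ) : ℝ := if a = 0 then 0 else F ^ a / ((a : ℝ) ^ 2 + 2)

section Weight
variable {F : ℝ}

theorem weight_zero : weight F 0 = 0 := if_pos rfl

theorem weight_of_pos {a : ℕ} (ha : 1 ≤ a) : weight F a = F ^ a / ((a : ℝ) ^ 2 + 2) :=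
  if_neg (by omega)

theorem weight_nonneg (hF : 0 ≤ F) (a : ℕ) : 0 ≤ weight F a := by
  unfold weight; split_ifs <;> positivity

theorem weight_pos (hF : 0 < F) {a : ℕ} (ha : 1 ≤ a) : 0 < weight F a := by
  rw [weight_of_pos ha]; positivity

theorem sum_weight_one_le (M : ℕ) : ∑ a ∈ range (M + 1), weight 1 a ≤ 1 := by
  have h : ∀ M : ℕ, ∑ a ∈ range (M + 2), weight 1 a ≤ 1 - 1 / ((M : ℝ) + 3 / 2) := by
    intro M
    induction M with
    | zero => norm_num [sum_range_succ, weight]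
    | succ M ih =>
      rw [sum_range_succ, weight_of_pos (by omega), one_pow]
      have : 1 / (((M + 2 : ℕ) : ℝ) ^ 2 + 2) ≤
          1 / ((M : ℝ) + 3 / 2) - 1 / (((M + 1 : ℕ) : ℝ) + 3 / 2) := by
        push_cast
        rw [div_sub_div _ _ (by positivity) (by positivity),
          div_le_div_iff₀ (by positivity) (by positivity)]
        nlinarith
      linarith
  rcases M with _ | M
  · simp [weight_zero]
  · have : 0 < 1 / ((M : ℝ) + 3 / 2) := by positivity
    linarith [h M]

/-- Rests on `(a + b)² + 2 ≤ 2 (a² + 2) + 2 (b² + 2)`, which lets one of the two denominators be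
summed separately. -/
theorem weight_mul_weight_le (hF : 0 ≤ F) {a b m : ℕ} (h : a + b = m) :
    weight F a * weight F b ≤ weight F m * (2 * (weight 1 a + weight 1 b)) := by
  rcases Nat.eq_zero_or_pos a with rfl | ha
  · rw [weight_zero, zero_mul]
    have := weight_nonneg hF m
    have := weight_nonneg zero_le_one b
    have := weight_nonneg zero_le_one 0
    positivity
  rcases Nat.eq_zero_or_pos b with rfl | hb
  · rw [weight_zero, mul_zero]
    have := weight_nonneg hF m
    have := weight_nonneg zero_le_one a
    have := weight_nonneg zero_le_one 0
    positivity
  rw [weight_of_pos ha, weight_of_pos hb, weight_of_pos ha, weight_of_pos hb,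
    weight_of_pos (by omega), ← h, one_pow, one_pow]
  have e : F ^ a / ((a : ℝ) ^ 2 + 2) * (F ^ b / ((b : ℝ) ^ 2 + 2)) =
      F ^ (a + b) * (1 / (((a : ℝ) ^ 2 + 2) * ((b : ℝ) ^ 2 + 2))) := by
    rw [pow_add]; field_simp
  rw [e, div_mul_eq_mul_div, mul_div_assoc]
  apply mul_le_mul_of_nonneg_left _ (pow_nonneg hF _)
  push_cast
  rw [div_add_div _ _ (by positivity) (by positivity), ← mul_div_assoc, div_div,
    div_le_div_iff₀ (by positivity) (by positivity)]
  have : ((a : ℝ) + b) ^ 2 + 2 ≤ 2 * (1 * ((b : ℝ) ^ 2 + 2) + ((a : ℝ) ^ 2 + 2) * 1) := by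
    nlinarith [sq_nonneg ((a : ℝ) - b)]
  rw [one_mul, mul_comm (((a : ℝ) ^ 2 + 2) * ((b : ℝ) ^ 2 + 2))]
  exact mul_le_mul_of_nonneg_right this (by positivity)

theorem sum_weight_mul_weight_le (hF : 0 ≤ F) (m : ℕ) :
    ∑ x ∈ antidiagonal m, weight F x.1 * weight F x.2 ≤ 4 * weight F m := by
  have h1 : ∑ x ∈ antidiagonal m, weight 1 x.1 ≤ 1 := by
    rw [Finset.Nat.sum_antidiagonal_eq_sum_range_succ_mk]
    exact sum_weight_one_le m
  have h2 : ∑ x ∈ antidiagonal m, weight 1 x.2 ≤ 1 := by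
    have := Finset.Nat.sum_antidiagonal_swap (n := m) (f := fun x : ℕ × ℕ => weight 1 x.1)
    simp only [Prod.fst_swap] at this
    rw [this]
    exact h1
  calc ∑ x ∈ antidiagonal m, weight F x.1 * weight F x.2
      ≤ ∑ x ∈ antidiagonal m, weight F m * (2 * (weight 1 x.1 + weight 1 x.2)) :=
        sum_le_sum fun x hx =>
          weight_mul_weight_le hF (HasAntidiagonal.mem_antidiagonal.mp hx)
    _ = weight F m * (2 * (∑ x ∈ antidiagonal m, weight 1 x.1 +
          ∑ x ∈ antidiagonal m, weight 1 x.2)) := by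
        rw [← mul_sum, ← mul_sum, sum_add_distrib]
    _ ≤ weight F m * (2 * (1 + 1)) := by
        have := weight_nonneg hF m
        gcongr
    _ = 4 * weight F m := by ring

/-- Equivalent to `(m - 1)² ≥ 0` for `m ≥ 1`. The cubic term of order `m` drives the coefficients of
order `m + 1`, so this is where the factor `1 / F` is gained. -/
theorem weight_le_succ (hF : 0 < F) (m : ℕ) : weight F m ≤ 2 * (weight F (m + 1) / F) := by
  rcases Nat.eq_zero_or_pos m with rfl | hm
  · rw [weight_zero]
    have := weight_pos hF (a := 0 + 1) le_rfl
    positivity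
  · have : (1 : ℝ) ≤ m := by exact_mod_cast hm
    rw [weight_of_pos hm, weight_of_pos (by omega), pow_succ F]
    have e : F ^ m * F / (((m + 1 : ℕ) : ℝ) ^ 2 + 2) / F =
        F ^ m / (((m + 1 : ℕ) : ℝ) ^ 2 + 2) := by field_simp
    rw [e, ← mul_div_assoc, div_le_div_iff₀ (by positivity) (by positivity)]
    push_cast
    rw [mul_comm 2, mul_assoc]
    apply mul_le_mul_of_nonneg_left _ (by positivity)
    nlinarith [sq_nonneg ((m : ℝ) - 1)]

/-- A convolution cube of a sequence dominated by `weight`. -/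
theorem sum_triple_le (hF : 0 < F) {A β Z : ℝ} (hA : 0 ≤ A) (hβ : 0 ≤ β) {m : ℕ}
    (h0 : m = 0 → 3 * A ^ 3 ≤ Z)
    (h1 : 2 * (3 * A ^ 2 * β + 12 * A * β ^ 2 + 16 * β ^ 3) ≤ Z) {t : ℕ → ℝ} (ht0 : t 0 = A)
    (ht : ∀ a, 1 ≤ a → t a = β * weight F a) :
    ∑ x ∈ antidiagonal m, ∑ y ∈ antidiagonal x.2, t x.1 * (t y.1 * t y.2) ≤
      Z * (weight F (m + 1) / F) := by
  have wn := weight_nonneg hF.le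
  have e : PowerSeries.mk t = PowerSeries.C A + PowerSeries.C β * PowerSeries.mk (weight F) := by
    ext a
    rw [map_add, PowerSeries.coeff_C_mul, PowerSeries.coeff_mk, PowerSeries.coeff_mk,
      PowerSeries.coeff_C]
    rcases Nat.eq_zero_or_pos a with rfl | ha
    · simp [ht0, weight_zero]
    · rw [ht a ha, if_neg (by omega), zero_add]
  have e2 : (PowerSeries.mk t) ^ 3 = PowerSeries.C (A ^ 3) +
      PowerSeries.C (3 * A ^ 2 * β) * PowerSeries.mk (weight F) +
      PowerSeries.C (3 * A * β ^ 2) * (PowerSeries.mk (weight F)) ^ 2 +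
      PowerSeries.C (β ^ 3) * (PowerSeries.mk (weight F)) ^ 3 := by
    -- The binomial cube: its last three terms have coefficients at most `3 A² β`, `12 A β²` and `16
    -- β³` times `weight F m`.
    rw [e]
    simp only [map_mul, map_pow, map_ofNat]
    ring
  have c2 : PowerSeries.coeff m ((PowerSeries.mk (weight F)) ^ 2) ≤ 4 * weight F m := by
    rw [coeff_sq_mk]; exact sum_weight_mul_weight_le hF.le m
  have c3 : PowerSeries.coeff m ((PowerSeries.mk (weight F)) ^ 3) ≤ 16 * weight F m := by
    rw [coeff_cube_mk]
    calc ∑ x ∈ antidiagonal m, ∑ y ∈ antidiagonal x.2,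
          weight F x.1 * (weight F y.1 * weight F y.2)
        ≤ ∑ x ∈ antidiagonal m, weight F x.1 * (4 * weight F x.2) := by
          refine sum_le_sum fun x _ => ?_
          rw [← mul_sum]
          exact mul_le_mul_of_nonneg_left (sum_weight_mul_weight_le hF.le _) (wn _)
      _ = 4 * ∑ x ∈ antidiagonal m, weight F x.1 * weight F x.2 := by
          rw [mul_sum]; exact sum_congr rfl fun x _ => by ring
      _ ≤ 4 * (4 * weight F m) := by
          have := sum_weight_mul_weight_le hF.le m
          linarith
      _ = 16 * weight F m := by ring
  rw [← coeff_cube_mk, e2]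
  simp only [map_add, PowerSeries.coeff_C_mul, PowerSeries.coeff_mk, PowerSeries.coeff_C]
  rcases Nat.eq_zero_or_pos m with rfl | hm
  · rw [weight_zero, mul_zero] at c2 c3
    rw [weight_zero, if_pos rfl, weight_of_pos (by omega)]
    have b2 := mul_le_mul_of_nonneg_left c2 (show 0 ≤ 3 * A * β ^ 2 by positivity)
    have b3 := mul_le_mul_of_nonneg_left c3 (show 0 ≤ β ^ 3 by positivity)
    have : F ^ (0 + 1) / (((0 + 1 : ℕ) : ℝ) ^ 2 + 2) / F = 1 / 3 := by
      norm_num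
      field_simp
    rw [this]
    linarith [h0 rfl]
  · rw [if_neg (by omega), zero_add]
    have b2 := mul_le_mul_of_nonneg_left c2 (show 0 ≤ 3 * A * β ^ 2 by positivity)
    have b3 := mul_le_mul_of_nonneg_left c3 (show 0 ≤ β ^ 3 by positivity)
    have hw := weight_le_succ hF m
    have hp : 0 ≤ weight F (m + 1) / F := div_nonneg (wn _) hF.le
    have b4 := mul_le_mul_of_nonneg_left hw
      (show 0 ≤ 3 * A ^ 2 * β + 12 * A * β ^ 2 + 16 * β ^ 3 by positivity)
    have b5 := mul_le_mul_of_nonneg_right h1 hp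
    linarith

/-- The triple estimates treat one factor differently from the other two. The geometric mean over
the three roles is a product of one-factor quantities, to which the convolution bound applies. -/
theorem le_mul_of_le_perms {B y a1 a2 a3 b1 b2 b3 t1 t2 t3 : ℝ} (hB : 0 ≤ B) (hy : 0 ≤ y)
    (ha1 : 0 ≤ a1) (ha2 : 0 ≤ a2) (ha3 : 0 ≤ a3) (hb1 : 0 ≤ b1) (hb2 : 0 ≤ b2) (hb3 : 0 ≤ b3)
    (ht1 : 0 ≤ t1) (ht2 : 0 ≤ t2) (ht3 : 0 ≤ t3)
    (h1 : y ≤ B * (a2 * a3 * b1)) (h2 : y ≤ B * (a3 * a1 * b2)) (h3 : y ≤ B * (a1 * a2 * b3))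
    (g1 : a1 ^ 2 * b1 ≤ t1 ^ 3) (g2 : a2 ^ 2 * b2 ≤ t2 ^ 3) (g3 : a3 ^ 2 * b3 ≤ t3 ^ 3) :
    y ≤ B * (t1 * (t2 * t3)) := by
  refine le_of_pow_le_pow_left₀ three_ne_zero (by positivity) ?_
  calc y ^ 3 = y * (y * y) := by ring
    _ ≤ (B * (a2 * a3 * b1)) * ((B * (a3 * a1 * b2)) * (B * (a1 * a2 * b3))) := by gcongr
    _ = B ^ 3 * ((a1 ^ 2 * b1) * ((a2 ^ 2 * b2) * (a3 ^ 2 * b3))) := by ring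
    _ ≤ B ^ 3 * (t1 ^ 3 * (t2 ^ 3 * t3 ^ 3)) := by gcongr
    _ = (B * (t1 * (t2 * t3))) ^ 3 := by ring

end Weight

section Cubic
variable {N : ℕ} {q : ℕ → ℝ → Fin N → ℝ}

theorem abs_cubicCoef_le {h : Fin N → ℝ} {r k : ℕ} {t : ℕ → ℝ} {B : ℝ}
    (H : ∀ a ≤ r, ∀ b ≤ r, ∀ c ≤ r, |cosCoef k fun τ => ∑ i, h i * (q a τ i * (q b τ i * q c τ i))| ≤
      B * (t a * (t b * t c))) :
    |cubicCoef q h r k| ≤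
      B * ∑ x ∈ antidiagonal r, ∑ y ∈ antidiagonal x.2, t x.1 * (t y.1 * t y.2) := by
  unfold cubicCoef
  simp only [mul_sum]
  refine (abs_sum_le_sum_abs _ _).trans (sum_le_sum fun x hx => ?_)
  refine (abs_sum_le_sum_abs _ _).trans (sum_le_sum fun y hy => ?_)
  rw [HasAntidiagonal.mem_antidiagonal] at hx hy
  exact H _ (by omega) _ (by omega) _ (by omega)

theorem cubicCoef_sum_mul {ι : Type*} (hq : ∀ a i, Continuous fun τ => q a τ i) (s : Finset ι)
    (x : ι → ℝ) (h : ι → Fin N → ℝ) (r k : ℕ) :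
    cubicCoef q (fun i => ∑ j ∈ s, x j * h j i) r k = ∑ j ∈ s, x j * cubicCoef q (h j) r k := by
  unfold cubicCoef
  simp only [mul_sum]
  rw [sum_comm]
  refine sum_congr rfl fun y _ => ?_
  rw [sum_comm]
  refine sum_congr rfl fun z _ => ?_
  rw [← cosCoef_sum_mul k s x fun j _ => by fun_prop]
  congr 1
  ext τ
  simp only [sum_mul, mul_sum]
  rw [sum_comm]
  exact sum_congr rfl fun j _ => sum_congr rfl fun i _ => by ring

/-- Duality: the functional is tested on the vector whose modal coefficients are its own values,
which bounds all of them together in `ℓ²`. -/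
theorem IsSpectrum.sum_sq_cubicCoef_le {n : ℕ} {k1 k2 k31 k32 : ℝ} {n1 n2 : ℕ} {Ω : ℕ → ℝ}
    {u : ℕ → Fin (2 * n) → ℝ} (hS : IsSpectrum n k1 k2 k31 k32 n1 n2 Ω u)
    {q : ℕ → ℝ → Fin (2 * n) → ℝ} (hq : ∀ a i, Continuous fun τ => q a τ i) {r k : ℕ} {B : ℝ}
    (hB : ∀ (h : Fin (2 * n) → ℝ) (H : ℝ), 0 ≤ H → ∑ i, h i ^ 2 ≤ H ^ 2 →
      |cubicCoef q h r k| ≤ B * H) :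
    ∑ j ∈ Icc 1 (2 * n), cubicCoef q (unitState (u j)) r k ^ 2 ≤ B ^ 2 := by
  set x : ℕ → ℝ := fun j => cubicCoef q (unitState (u j)) r k
  set V := ∑ j ∈ Icc 1 (2 * n), x j ^ 2 with hV
  have hV0 : 0 ≤ V := sum_nonneg fun j _ => sq_nonneg _
  have e1 : ∑ i, (∑ j ∈ Icc 1 (2 * n), x j * unitState (u j) i) ^ 2 = V := by
    rw [← hS.parseval]
    refine sum_congr rfl fun j hj => ?_
    rw [hS.sum_unitState_mul_sum hj]
  have e2 : cubicCoef q (fun i => ∑ j ∈ Icc 1 (2 * n), x j * unitState (u j) i) r k = V := by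
    rw [cubicCoef_sum_mul hq]
    exact sum_congr rfl fun j _ => by simp only [x]; ring
  have h := hB (fun i => ∑ j ∈ Icc 1 (2 * n), x j * unitState (u j) i) (√V) (Real.sqrt_nonneg _)
    (by rw [e1, Real.sq_sqrt hV0])
  rw [e2, abs_of_nonneg hV0] at h
  rcases hV0.eq_or_lt with h0 | h0
  · rw [← h0]; positivity
  · have hs : 0 < √V := Real.sqrt_pos.mpr h0
    have h3 : √V ≤ B := by
      have : √V * √V ≤ B * √V := by rw [Real.mul_self_sqrt hV0]; exact h
      exact le_of_mul_le_mul_right this hs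
    calc V = √V ^ 2 := (Real.sq_sqrt hV0).symm
      _ ≤ B ^ 2 := pow_le_pow_left₀ hs.le h3 2

end Cubic

end DiatomicChain
end

/-! ### From coefficient bounds at one order to sup and envelope bounds. -/

noncomputable section
namespace DiatomicChain
open Finset MeasureTheory

section Order
variable {n : ℕ} {k1 k2 k31 k32 d K : ℝ} {n1 n2 : ℕ} {Ω : ℕ → ℝ} {u : ℕ → Fin (2 * n) → ℝ}
  {ω : ℕ → ℝ} {q : ℕ → ℝ → Fin (2 * n) → ℝ} {γ : ℕ → ℕ → ℕ → ℝ} {F c2 K' : ℝ}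

/-- The bounds on the terms of order `2 p`, for all harmonics `k`. -/
structure OrderBounds (n n1 n2 : ℕ) (F c2 K' : ℝ) (ω : ℕ → ℝ) (γ : ℕ → ℕ → ℕ → ℝ) (p : ℕ) :
    Prop where
  freq : |ω p| < c2 * weight F p / n ^ 2
  first : ∑ j ∈ D1 n1, |γ p 1 j| < weight F p / 16
  optical : ∀ k : ℕ, 2 ≤ k → ∑ j ∈ Icc 1 n1, |γ p k j| < K' * weight F p / n / k ^ 2
  acoustic : ∀ k : ℕ, 1 ≤ k → ∑ j ∈ D2 n n2, |γ p k j| < K' * weight F p / n / k ^ 2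
  gap : ∀ k : ℕ, 1 ≤ k → ∑ j ∈ D3 n n1 n2, |γ p k j| < K' * weight F p / (n ^ 2 * √n) / k ^ 2

theorem IsSpectrum.sum_Icc (hS : IsSpectrum n k1 k2 k31 k32 n1 n2 Ω u) (g : ℕ → ℝ) :
    ∑ j ∈ Icc 1 (2 * n), g j =
      ∑ j ∈ Icc 1 n1, g j + ∑ j ∈ D2 n n2, g j + ∑ j ∈ D3 n n1 n2, g j := by
  have hc := hS.count
  have h1 : Icc 1 (2 * n) = (Icc 1 n1 ∪ D2 n n2) ∪ D3 n n1 n2 := by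
    ext j
    simp only [D2, D3, mem_union, mem_Icc, mem_insert, mem_singleton]
    omega
  rw [h1, sum_union, sum_union]
  · rw [disjoint_left]
    intro j
    simp only [D2, mem_Icc]
    omega
  · rw [disjoint_left]
    intro j
    simp only [D2, D3, mem_union, mem_Icc, mem_insert, mem_singleton]
    omega

theorem sum_Icc_eq_add_D1 (h : 1 ≤ n1) (g : ℕ → ℝ) :
    ∑ j ∈ Icc 1 n1, g j = g 1 + ∑ j ∈ D1 n1, g j := by
  have : Icc 1 n1 = insert 1 (D1 n1) := by
    ext j
    simp only [D1, mem_insert, mem_Icc]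
    omega
  rw [this, sum_insert (by simp [D1])]

theorem tsum_inv_sq_le : Summable (fun l : ℕ => 1 / ((l : ℝ) + 2) ^ 2) ∧
    ∑' l : ℕ, 1 / ((l : ℝ) + 2) ^ 2 ≤ 1 := by
  have h : ∀ M : ℕ, ∑ l ∈ range M, 1 / ((l : ℝ) + 2) ^ 2 ≤ 1 - 1 / ((M : ℝ) + 1) := by
    intro M
    induction M with
    | zero => simp
    | succ M ih =>
      rw [sum_range_succ]
      have : 1 / ((M : ℝ) + 2) ^ 2 ≤ 1 / ((M : ℝ) + 1) - 1 / (((M + 1 : ℕ) : ℝ) + 1) := by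
        push_cast
        rw [div_sub_div _ _ (by positivity) (by positivity),
          div_le_div_iff₀ (by positivity) (by positivity)]
        nlinarith [(Nat.cast_nonneg M : (0 : ℝ) ≤ M)]
      linarith
  have h' : ∀ M : ℕ, ∑ l ∈ range M, 1 / ((l : ℝ) + 2) ^ 2 ≤ 1 := fun M =>
    (h M).trans (by have : 0 ≤ 1 / ((M : ℝ) + 1) := by positivity
                    linarith)
  have hs := summable_of_sum_range_le (fun l : ℕ => by positivity) h'
  exact ⟨hs, hs.tsum_le_of_sum_range_le h'⟩

theorem sum_tsum_le {J : Finset ℕ} {a : ℕ → ℕ → ℝ} {A M : ℝ}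
    (ha : ∀ j ∈ J, Summable fun l => |a (l + 1) j|) (h1 : ∑ j ∈ J, |a 1 j| ≤ A)
    (h2 : ∀ k : ℕ, 2 ≤ k → ∑ j ∈ J, |a k j| ≤ M / k ^ 2) :
    ∑ j ∈ J, ∑' l : ℕ, |a (l + 1) j| ≤ A + M := by
  have hs := summable_sum ha
  rw [← Summable.tsum_finsetSum ha, hs.tsum_eq_zero_add]
  obtain ⟨hs2, hs3⟩ := tsum_inv_sq_le
  have hM : 0 ≤ M := by
    have := (sum_nonneg fun j _ => abs_nonneg (a 2 j)).trans (h2 2 le_rfl)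
    have h4 : (0 : ℝ) < ((2 : ℕ) : ℝ) ^ 2 := by norm_num
    exact (div_nonneg_iff.mp this).elim (fun h => h.1) fun h => absurd h.2 (not_le.mpr h4)
  have h3 : ∑' l : ℕ, ∑ j ∈ J, |a (l + 1 + 1) j| ≤ ∑' l : ℕ, M * (1 / ((l : ℝ) + 2) ^ 2) := by
    refine ((summable_nat_add_iff 1).mpr hs).tsum_le_tsum (fun l => ?_) (hs2.mul_left M)
    have := h2 (l + 1 + 1) (by omega)
    push_cast at this
    rw [mul_one_div, show (l : ℝ) + 2 = l + 1 + 1 by ring]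
    exact this
  rw [tsum_mul_left] at h3
  have h4 := mul_le_mul_of_nonneg_left hs3 hM
  have h5 : ∑ j ∈ J, |a (0 + 1) j| ≤ A := h1
  linarith

/-- A bound for the sup norm of the `j`-th unit state. -/
def modeSup (n n1 n2 : ℕ) (j : ℕ) : ℝ :=
  if j = 1 then 11 / 10 / √n else if j ∈ D3 n n1 n2 then 1 else 7 / √n

theorem modeSup_nonneg (n n1 n2 j : ℕ) : 0 ≤ modeSup n n1 n2 j := by
  unfold modeSup; split_ifs <;> positivity

theorem IsSpectrum.mem_cases (hS : IsSpectrum n k1 k2 k31 k32 n1 n2 Ω u) {j : ℕ}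
    (hj : j ∈ Icc 1 (2 * n)) : j ∈ Icc 1 n1 ∨ j ∈ D2 n n2 ∨ j ∈ D3 n n1 n2 := by
  have hc := hS.count
  simp only [D2, D3, mem_Icc, mem_insert, mem_singleton] at hj ⊢
  omega

theorem SpecBounds.abs_unitState_le (hB : SpecBounds n k1 k2 d K n1 n2 Ω u)
    (hS : IsSpectrum n k1 k2 k31 k32 n1 n2 Ω u) {j : ℕ} (hj : j ∈ Icc 1 (2 * n))
    (i : Fin (2 * n)) : |unitState (u j) i| ≤ modeSup n n1 n2 j := by
  unfold modeSup
  split_ifs with h1 h3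
  · subst h1; exact hB.first_sup i
  · have h := sum_unitState_sq (hS.ne_zero j hj)
    have h2 := single_le_sum (f := fun i => unitState (u j) i ^ 2) (fun i _ => sq_nonneg _)
      (mem_univ i)
    rw [h] at h2
    exact abs_le_one_iff_mul_self_le_one.mpr (by simpa [sq] using h2)
  · rcases hS.mem_cases hj with h | h | h
    · exact hB.optical_sup j h i
    · exact hB.acoustic_sup j h i
    · exact absurd h h3

theorem SpecBounds.harmBound_aux (hB : SpecBounds n k1 k2 d K n1 n2 Ω u)
    (hS : IsSpectrum n k1 k2 k31 k32 n1 n2 Ω u) (hR : IsReduced n Ω u ω q γ) (a : ℕ) :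
    HarmBound (q a) (∑ j ∈ Icc 1 (2 * n), modeSup n n1 n2 j * ∑' l, |γ a (l + 1) j|)
      (∑ j ∈ Icc 1 (2 * n), ∑' l, |γ a (l + 1) j|) :=
  hS.harmBound (hR.cont a) (a := fun j l => γ a (l + 1) j) (hR.summable a) (hR.hasSum a)
    (fun _ hj => hB.abs_unitState_le hS hj) fun _ _ => modeSup_nonneg _ _ _ _

theorem SpecBounds.harmBound_zero (hB : SpecBounds n k1 k2 d K n1 n2 Ω u)
    (hS : IsSpectrum n k1 k2 k31 k32 n1 n2 Ω u) (hR : IsReduced n Ω u ω q γ) :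
    HarmBound (q 0) (11 / 10 / √n) 1 := by
  have h := hB.harmBound_aux hS hR 0
  have h1 : 1 ∈ Icc 1 (2 * n) := by
    have := hS.count
    simp only [mem_Icc]; omega
  have ht : ∀ j ∈ Icc 1 (2 * n), ∑' l, |γ 0 (l + 1) j| = if j = 1 then 1 else 0 := by
    intro j hj
    rw [tsum_eq_single 0 fun l hl => ?_]
    · rw [hR.zero j hj _ (by omega)]
      by_cases h : j = 1 <;> simp [h]
    · rw [hR.zero j hj _ (by omega), if_neg (by omega), abs_zero]
  convert h using 1
  · rw [sum_congr rfl fun j hj => by rw [ht j hj]]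
    simp only [mul_ite, mul_one, mul_zero]
    rw [sum_ite_eq' _ 1, if_pos h1, modeSup, if_pos rfl]
  · rw [sum_congr rfl ht, sum_ite_eq' _ 1, if_pos h1]

/-- Everything except the first harmonic of the optical band is of lower order in `n`. The five
lower-order contributions to `X` are at most `weight F a / 1200` each, and `1 / 16 + 5 / 1200 = 1 /
15`; the sup bound gains the factor `7` of the extended modes. -/
theorem SpecBounds.harmBound (hB : SpecBounds n k1 k2 d K n1 n2 Ω u)
    (hS : IsSpectrum n k1 k2 k31 k32 n1 n2 Ω u) (hR : IsReduced n Ω u ω q γ) (hF : 0 < F)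
    (hK' : 0 < K') (hn : 1200 * K' ≤ n) {a : ℕ} (ha : 1 ≤ a)
    (hO : OrderBounds n n1 n2 F c2 K' ω γ a) :
    ∃ S X : ℝ, HarmBound (q a) S X ∧ √n * S ≤ 7 / 15 * weight F a ∧ X ≤ weight F a / 15 := by
  refine ⟨_, _, hB.harmBound_aux hS hR a, ?_⟩
  have hc := hS.count
  have hn1 : (1 : ℝ) ≤ n := by
    have := hB.one_le
    exact_mod_cast show 1 ≤ n by omega
  have hs : 0 < √(n : ℝ) := Real.sqrt_pos.mpr (by linarith)
  have hw := weight_pos hF ha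
  have hκ : K' * weight F a / n ≤ weight F a / 1200 := by
    rw [div_le_div_iff₀ (by linarith) (by norm_num)]
    nlinarith [mul_le_mul_of_nonneg_right hn hw.le]
  have hκ' : √n * (K' * weight F a / (n ^ 2 * √n)) ≤ K' * weight F a / n := by
    have : √n * (K' * weight F a / (n ^ 2 * √n)) = K' * weight F a / n ^ 2 := by field_simp
    rw [this]
    exact div_le_div_of_nonneg_left (by positivity) (by positivity) (by nlinarith)
  have hs1 : 1 ≤ √(n : ℝ) := by rw [Real.one_le_sqrt]; exact hn1
  have hT : ∀ j, 0 ≤ ∑' l, |γ a (l + 1) j| := fun j => tsum_nonneg fun _ => abs_nonneg _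
  have m1 : ∀ j ∈ Icc 1 n1, j ∈ Icc 1 (2 * n) := by
    intro j; simp only [mem_Icc]; omega
  have m2 : ∀ j ∈ D2 n n2, j ∈ Icc 1 (2 * n) := by
    intro j; simp only [D2, mem_Icc]; omega
  have m3 : ∀ j ∈ D3 n n1 n2, j ∈ Icc 1 (2 * n) := by
    intro j; simp only [D3, mem_Icc, mem_insert, mem_singleton]; omega
  have t1 : ∑ j ∈ Icc 1 n1, ∑' l, |γ a (l + 1) j| ≤
      weight F a / 16 + K' * weight F a / n := by
    refine sum_tsum_le (fun j hj => hR.summable a j (m1 j hj)) ?_ fun k hk => (hO.optical k hk).le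
    rw [sum_Icc_eq_add_D1 hB.one_le, hR.normalized a ha, abs_zero, zero_add]
    exact hO.first.le
  have t2 : ∑ j ∈ D2 n n2, ∑' l, |γ a (l + 1) j| ≤
      K' * weight F a / n + K' * weight F a / n :=
    sum_tsum_le (fun j hj => hR.summable a j (m2 j hj))
      (by simpa using (hO.acoustic 1 le_rfl).le) fun k hk => (hO.acoustic k (by omega)).le
  have t3 : ∑ j ∈ D3 n n1 n2, ∑' l, |γ a (l + 1) j| ≤
      K' * weight F a / (n ^ 2 * √n) + K' * weight F a / (n ^ 2 * √n) :=
    sum_tsum_le (fun j hj => hR.summable a j (m3 j hj))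
      (by simpa using (hO.gap 1 le_rfl).le) fun k hk => (hO.gap k (by omega)).le
  have hμ : ∀ j, j ∉ D3 n n1 n2 → modeSup n n1 n2 j ≤ 7 / √n := by
    intro j hj
    unfold modeSup
    split_ifs
    · gcongr; norm_num
    · exact le_rfl
  have hμ3 : ∀ j ∈ D3 n n1 n2, modeSup n n1 n2 j ≤ 1 := by
    intro j hj
    have : j ≠ 1 := by
      have := hB.one_le
      simp only [D3, mem_insert, mem_singleton] at hj
      omega
    rw [modeSup, if_neg this, if_pos hj]
  constructor
  · rw [hS.sum_Icc, mul_add, mul_add]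
    have b : ∀ J : Finset ℕ, (∀ j ∈ J, j ∉ D3 n n1 n2) →
        √n * ∑ j ∈ J, modeSup n n1 n2 j * ∑' l, |γ a (l + 1) j| ≤
          7 * ∑ j ∈ J, ∑' l, |γ a (l + 1) j| := by
      intro J hJ
      rw [mul_sum, mul_sum]
      refine sum_le_sum fun j hj => ?_
      calc √n * (modeSup n n1 n2 j * ∑' l, |γ a (l + 1) j|)
          ≤ √n * (7 / √n * ∑' l, |γ a (l + 1) j|) := by
            have := hT j
            gcongr
            exact hμ j (hJ j hj)
        _ = 7 * ∑' l, |γ a (l + 1) j| := by field_simp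
    have b1 := b (Icc 1 n1) (by
      intro j; simp only [D3, mem_Icc, mem_insert, mem_singleton]; omega)
    have b2 := b (D2 n n2) (by
      intro j; simp only [D2, D3, mem_Icc, mem_insert, mem_singleton]; omega)
    have b3 : ∑ j ∈ D3 n n1 n2, modeSup n n1 n2 j * ∑' l, |γ a (l + 1) j| ≤
        ∑ j ∈ D3 n n1 n2, ∑' l, |γ a (l + 1) j| :=
      sum_le_sum fun j hj => mul_le_of_le_one_left (hT j) (hμ3 j hj)
    have b3' := mul_le_mul_of_nonneg_left (b3.trans t3) hs.le
    linarith
  · rw [hS.sum_Icc]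
    have : K' * weight F a / (n ^ 2 * √n) ≤ √n * (K' * weight F a / (n ^ 2 * √n)) :=
      le_mul_of_one_le_left (by positivity) hs1
    linarith

end Order
end DiatomicChain
end

/-! ### The three numerical estimates of the cubic term. -/

noncomputable section
namespace DiatomicChain
open Finset MeasureTheory

section CubicBounds
variable {N : ℕ} {q : ℕ → ℝ → Fin N → ℝ}

theorem cosCoef_triple_rotate (k : ℕ) (h : Fin N → ℝ) (f1 f2 f3 : ℝ → Fin N → ℝ) :
    cosCoef k (fun τ => ∑ i, h i * (f1 τ i * (f2 τ i * f3 τ i))) =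
      cosCoef k (fun τ => ∑ i, h i * (f2 τ i * (f3 τ i * f1 τ i))) := by
  congr 1
  ext τ
  exact sum_congr rfl fun i _ => by ring

/-- Bounds of the first terms of a series `q = ∑ ε ^ a q_a`, in the variable `s = √n`. -/
structure HarmSeq (q : ℕ → ℝ → Fin N → ℝ) (F s : ℝ) (r : ℕ) (S X : ℕ → ℝ) : Prop where
  F_pos : 0 < F
  s_pos : 0 < s
  bound : ∀ a ≤ r, HarmBound (q a) (S a) (X a)
  S_zero : s * S 0 = 11 / 10
  X_zero : X 0 = 1
  S_le : ∀ a ≤ r, 1 ≤ a → s * S a ≤ 7 / 15 * weight F a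
  X_le : ∀ a ≤ r, 1 ≤ a → X a ≤ weight F a / 15

variable {F s : ℝ} {r : ℕ} {S X : ℕ → ℝ}

/-- The geometric mean of the bounds in `HarmSeq`. -/
def meanBound (F A β : ℝ) (a : ℕ) : ℝ := if a = 0 then A else β * weight F a

theorem meanBound_nonneg {A β : ℝ} (hF : 0 < F) (hA : 0 ≤ A) (hβ : 0 ≤ β) (a : ℕ) :
    0 ≤ meanBound F A β a := by
  have := weight_nonneg hF.le a
  unfold meanBound; split_ifs <;> positivity

theorem sum_meanBound_le {A β Z : ℝ} (hF : 0 < F) (hA : 0 ≤ A) (hβ : 0 ≤ β)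
    {m : ℕ} (h0 : m = 0 → 3 * A ^ 3 ≤ Z) (h1 : 2 * (3 * A ^ 2 * β + 12 * A * β ^ 2 + 16 * β ^ 3) ≤ Z) :
    ∑ x ∈ antidiagonal m, ∑ y ∈ antidiagonal x.2,
      meanBound F A β x.1 * (meanBound F A β y.1 * meanBound F A β y.2) ≤
      Z * (weight F (m + 1) / F) :=
  sum_triple_le hF hA hβ h0 h1 (by simp [meanBound])
    (fun a ha => by rw [meanBound, if_neg (by omega)])

namespace HarmSeq

theorem S_nonneg (hq : HarmSeq q F s r S X) {a : ℕ} (ha : a ≤ r) : 0 ≤ s * S a :=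
  mul_nonneg hq.s_pos.le (hq.bound a ha).S_nonneg

/-- Here `37 / 150` is a rational upper bound for the cube root of `(7 / 15)² / 15`, and order zero
gives `1.21 ≤ 1.1³`. -/
theorem sq_mul_le (hq : HarmSeq q F s r S X) {a : ℕ} (ha : a ≤ r) :
    (s * S a) ^ 2 * X a ≤ meanBound F (11 / 10) (37 / 150) a ^ 3 := by
  have hS := hq.S_nonneg ha
  have hX := (hq.bound a ha).X_nonneg
  rcases Nat.eq_zero_or_pos a with rfl | h
  · rw [hq.S_zero, hq.X_zero, meanBound, if_pos rfl]; norm_num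
  · have hw := weight_nonneg hq.F_pos.le a
    rw [meanBound, if_neg (by omega)]
    calc (s * S a) ^ 2 * X a ≤ (7 / 15 * weight F a) ^ 2 * (weight F a / 15) := by
          have := hq.S_le a ha h
          have := hq.X_le a ha h
          gcongr
      _ = 49 / 3375 * weight F a ^ 3 := by ring
      _ ≤ (37 / 150) ^ 3 * weight F a ^ 3 := by gcongr; norm_num
      _ = (37 / 150 * weight F a) ^ 3 := by ring

theorem mul_sq_le (hq : HarmSeq q F s r S X) {a : ℕ} (ha : a ≤ r) :
    X a ^ 2 * (s * S a) ≤ meanBound F (26 / 25) (16 / 125) a ^ 3 := by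
  have hS := hq.S_nonneg ha
  have hX := (hq.bound a ha).X_nonneg
  rcases Nat.eq_zero_or_pos a with rfl | h
  · rw [hq.S_zero, hq.X_zero, meanBound, if_pos rfl]; norm_num
  · have hw := weight_nonneg hq.F_pos.le a
    rw [meanBound, if_neg (by omega)]
    calc X a ^ 2 * (s * S a) ≤ (weight F a / 15) ^ 2 * (7 / 15 * weight F a) := by
          have := hq.S_le a ha h
          have := hq.X_le a ha h
          gcongr
      _ = 7 / 3375 * weight F a ^ 3 := by ring
      _ ≤ (16 / 125) ^ 3 * weight F a ^ 3 := by gcongr; norm_num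
      _ = (16 / 125 * weight F a) ^ 3 := by ring

theorem S_le_meanBound (hq : HarmSeq q F s r S X) {a : ℕ} (ha : a ≤ r) :
    s * S a ≤ meanBound F (11 / 10) (7 / 15) a := by
  rcases Nat.eq_zero_or_pos a with rfl | h
  · rw [hq.S_zero, meanBound, if_pos rfl]
  · rw [meanBound, if_neg (by omega)]
    exact hq.S_le a ha h

/-- Cyclic rotation of the factors gives three versions of the triple estimate, merged by
`le_mul_of_le_perms`. The convolution constant is `4`, since `3 * 1.1³ < 4`, and `4 * 4 = 16`. -/
theorem abs_cubicCoef_le_norm (hq : HarmSeq q F s r S X) {h : Fin N → ℝ} {H : ℝ} (hH : 0 ≤ H)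
    (hh : ∑ i, h i ^ 2 ≤ H ^ 2) {k : ℕ} (hk : 1 ≤ k) :
    |cubicCoef q h r k| ≤ 16 / s ^ 2 * (weight F (r + 1) / F) * H := by
  have hs := hq.s_pos
  have h1 := abs_cubicCoef_le (q := q) (h := h) (r := r) (k := k)
    (t := meanBound F (11 / 10) (37 / 150)) (B := 4 * H / s ^ 2) (fun a ha b hb c hc => ?_)
  · refine h1.trans ((mul_le_mul_of_nonneg_left (sum_meanBound_le (Z := 4) hq.F_pos (by norm_num)
      (by norm_num) (fun _ => by norm_num) (by norm_num)) (by positivity)).trans (le_of_eq ?_))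
    ring
  · have e : ∀ x y z : ℝ, 4 * H * (x * y * z) = 4 * H / s ^ 2 * ((s * x) * (s * y) * z) := by
      intro x y z; field_simp
    have y3 := abs_cosCoef_triple_le_norm (hq.bound a ha) (hq.bound b hb) (hq.bound c hc) hH hh hk
    have y1 := abs_cosCoef_triple_le_norm (hq.bound b hb) (hq.bound c hc) (hq.bound a ha) hH hh hk
    have y2 := abs_cosCoef_triple_le_norm (hq.bound c hc) (hq.bound a ha) (hq.bound b hb) hH hh hk
    rw [cosCoef_triple_rotate] at y2
    rw [← cosCoef_triple_rotate] at y1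
    rw [e] at y1 y2 y3
    have m0 := meanBound_nonneg (A := 11 / 10) (β := 37 / 150) hq.F_pos (by norm_num) (by norm_num)
    exact le_mul_of_le_perms (by positivity) (abs_nonneg _) (hq.S_nonneg ha) (hq.S_nonneg hb)
      (hq.S_nonneg hc) (hq.bound a ha).X_nonneg (hq.bound b hb).X_nonneg (hq.bound c hc).X_nonneg
      (m0 a) (m0 b) (m0 c) y1 y2 y3 (hq.sq_mul_le ha) (hq.sq_mul_le hb) (hq.sq_mul_le hc)

/-- The constant `139 / 20` must stay below `7`, the value dictated by the constant in (i). At `r =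
0` the convolution bound is too weak for this, hence the restriction; that case uses the exact
fourth moment instead. -/
theorem abs_cubicCoef_le_sup (hq : HarmSeq q F s r S X) {h : Fin N → ℝ}
    (hh : ∀ i, |h i| ≤ 11 / 10 / s) (hr : 1 ≤ r) {k : ℕ} (hk : 1 ≤ k) :
    |cubicCoef q h r k| ≤ 139 / 20 / s ^ 2 * (weight F (r + 1) / F) := by
  have hs := hq.s_pos
  have h1 := abs_cubicCoef_le (q := q) (h := h) (r := r) (k := k)
    (t := meanBound F (26 / 25) (16 / 125)) (B := 22 / 5 / s ^ 2) (fun a ha b hb c hc => ?_)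
  · have h2 := sum_meanBound_le (A := 26 / 25) (β := 16 / 125) (Z := 139 / 88) hq.F_pos (by norm_num)
      (by norm_num) (m := r) (fun h => by omega) (by norm_num)
    · refine h1.trans ((mul_le_mul_of_nonneg_left h2 (by positivity)).trans (le_of_eq ?_))
      ring
  · have e : ∀ x y z : ℝ, 4 * (11 / 10 / s) * (x * y * z) =
        22 / 5 / s ^ 2 * (y * z * (s * x)) := by
      intro x y z; field_simp; ring
    have hH : 0 ≤ 11 / 10 / s := by positivity
    have y1 := abs_cosCoef_triple_le_sup (hq.bound a ha) (hq.bound b hb) (hq.bound c hc) hH hh hk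
    have y2 := abs_cosCoef_triple_le_sup (hq.bound b hb) (hq.bound c hc) (hq.bound a ha) hH hh hk
    have y3 := abs_cosCoef_triple_le_sup (hq.bound c hc) (hq.bound a ha) (hq.bound b hb) hH hh hk
    rw [cosCoef_triple_rotate] at y3
    rw [← cosCoef_triple_rotate] at y2
    rw [e] at y1 y2 y3
    have m0 := meanBound_nonneg (A := 26 / 25) (β := 16 / 125) hq.F_pos (by norm_num) (by norm_num)
    exact le_mul_of_le_perms (by positivity) (abs_nonneg _) (hq.bound a ha).X_nonneg
      (hq.bound b hb).X_nonneg (hq.bound c hc).X_nonneg (hq.S_nonneg ha) (hq.S_nonneg hb)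
      (hq.S_nonneg hc) (m0 a) (m0 b) (m0 c) y1 y2 y3 (hq.mul_sq_le ha) (hq.mul_sq_le hb)
      (hq.mul_sq_le hc)

theorem abs_cubicCoef_le_sum (hq : HarmSeq q F s r S X) {h : Fin N → ℝ} {H : ℝ}
    (hh : ∑ i, |h i| ≤ H) (k : ℕ) :
    |cubicCoef q h r k| ≤ 104 * H / s ^ 3 * (weight F (r + 1) / F) := by
  have hs := hq.s_pos
  have hH : 0 ≤ H := (sum_nonneg fun i _ => abs_nonneg (h i)).trans hh
  have h1 := abs_cubicCoef_le (q := q) (h := h) (r := r) (k := k)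
    (t := meanBound F (11 / 10) (7 / 15)) (B := 8 * H / s ^ 3) (fun a ha b hb c hc => ?_)
  · refine h1.trans ((mul_le_mul_of_nonneg_left (sum_meanBound_le (Z := 13) hq.F_pos (by norm_num)
      (by norm_num) (fun _ => by norm_num) (by norm_num)) (by positivity)).trans (le_of_eq ?_))
    ring
  · refine (abs_cosCoef_triple_le_sum (hq.bound a ha) (hq.bound b hb) (hq.bound c hc) hh k).trans ?_
    have e : 8 * H * (S a * S b * S c) =
        8 * H / s ^ 3 * ((s * S a) * ((s * S b) * (s * S c))) := by field_simp
    rw [e]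
    have m0 := meanBound_nonneg (A := 11 / 10) (β := 7 / 15) hq.F_pos (by norm_num) (by norm_num)
    have := hq.S_nonneg ha
    have := hq.S_nonneg hb
    have := hq.S_nonneg hc
    have := m0 a
    have := m0 b
    gcongr
    · exact hq.S_le_meanBound ha
    · exact hq.S_le_meanBound hb
    · exact hq.S_le_meanBound hc

end HarmSeq
end CubicBounds
end DiatomicChain
end

/-! ### One step of the recursion in the order. -/

noncomputable section
namespace DiatomicChain
open Finset MeasureTheory

theorem cosCoef_two_cos (l : ℕ) {k : ℕ} (hk : 1 ≤ k) :
    cosCoef k (fun τ => 2 * Real.cos (((l : ℝ) + 1) * τ)) = if l + 1 = k then 1 else 0 := by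
  have := Real.pi_pos
  rw [cosCoef, integral_two_cos_mul_cos hk]
  split_ifs
  · field_simp
  · simp

theorem cosCoef_one_cos_cube : cosCoef 1 (fun τ => (2 * Real.cos τ) ^ 3) = 3 := by
  have e : (fun τ : ℝ => (2 * Real.cos τ) ^ 3) = fun τ =>
      3 * (2 * Real.cos (((0 : ℕ) + 1) * τ)) + 2 * Real.cos (((2 : ℕ) + 1) * τ) := by
    ext τ
    norm_num
    rw [Real.cos_three_mul]
    ring
  rw [e, cosCoef_add 1 (by fun_prop) (by fun_prop), cosCoef_const_mul, cosCoef_two_cos 0 le_rfl,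
    cosCoef_two_cos 2 le_rfl]
  norm_num

section Step
variable {n : ℕ} {k1 k2 k31 k32 d K : ℝ} {n1 n2 : ℕ} {Ω : ℕ → ℝ} {u : ℕ → Fin (2 * n) → ℝ}
  {ω : ℕ → ℝ} {q : ℕ → ℝ → Fin (2 * n) → ℝ} {γ : ℕ → ℕ → ℕ → ℝ} {F c2 K' : ℝ}

theorem IsReduced.q_zero (hR : IsReduced n Ω u ω q γ) (hS : IsSpectrum n k1 k2 k31 k32 n1 n2 Ω u)
    (τ : ℝ) (i : Fin (2 * n)) : q 0 τ i = unitState (u 1) i * (2 * Real.cos τ) := by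
  have h1 : 1 ∈ Icc 1 (2 * n) := by
    have := hS.count
    simp only [mem_Icc]; omega
  have h : ∀ j ∈ Icc 1 (2 * n), (∑ p, unitState (u j) p * q 0 τ p) * unitState (u j) i =
      if j = 1 then unitState (u 1) i * (2 * Real.cos τ) else 0 := by
    intro j hj
    rw [← (hR.hasSum 0 j hj τ).tsum_eq, tsum_eq_single 0 fun l hl => ?_]
    · rw [hR.zero j hj _ (by omega)]
      by_cases hj1 : j = 1
      · subst hj1; simp [mul_comm]
      · simp [hj1]
    · rw [hR.zero j hj _ (by omega), if_neg (by omega), zero_mul]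
  rw [hS.expand (q 0 τ) i, sum_congr rfl h, sum_ite_eq' _ 1, if_pos h1]

theorem IsReduced.cubicCoef_zero (hR : IsReduced n Ω u ω q γ)
    (hS : IsSpectrum n k1 k2 k31 k32 n1 n2 Ω u) :
    cubicCoef q (unitState (u 1)) 0 1 = 3 * ∑ i, unitState (u 1) i ^ 4 := by
  simp only [cubicCoef, HasAntidiagonal.antidiagonal_zero, sum_singleton, hR.q_zero hS]
  have e : (fun τ : ℝ => ∑ i, unitState (u 1) i * (unitState (u 1) i * (2 * Real.cos τ) *
      (unitState (u 1) i * (2 * Real.cos τ) * (unitState (u 1) i * (2 * Real.cos τ))))) =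
      fun τ => (∑ i, unitState (u 1) i ^ 4) * (2 * Real.cos τ) ^ 3 := by
    ext τ
    rw [sum_mul]
    exact sum_congr rfl fun i _ => by ring
  rw [e, cosCoef_const_mul, cosCoef_one_cos_cube, mul_comm]

theorem HarmSeq.mono {N : ℕ} {q : ℕ → ℝ → Fin N → ℝ} {F s : ℝ} {r r' : ℕ} {S X : ℕ → ℝ}
    (hq : HarmSeq q F s r S X) (h : r' ≤ r) : HarmSeq q F s r' S X where
  F_pos := hq.F_pos
  s_pos := hq.s_pos
  bound a ha := hq.bound a (ha.trans h)
  S_zero := hq.S_zero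
  X_zero := hq.X_zero
  S_le a ha := hq.S_le a (ha.trans h)
  X_le a ha := hq.X_le a (ha.trans h)

theorem SpecBounds.exists_harmSeq (hB : SpecBounds n k1 k2 d K n1 n2 Ω u)
    (hS : IsSpectrum n k1 k2 k31 k32 n1 n2 Ω u) (hR : IsReduced n Ω u ω q γ) (hF : 0 < F)
    (hK' : 0 < K') (hn : 1200 * K' ≤ n) {r : ℕ}
    (hO : ∀ a, 1 ≤ a → a ≤ r → OrderBounds n n1 n2 F c2 K' ω γ a) :
    ∃ S X : ℕ → ℝ, HarmSeq q F √n r S X := by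
  have hs : 0 < √(n : ℝ) := by
    have := hS.count
    have : (0 : ℝ) < n := by exact_mod_cast show 0 < n by omega
    positivity
  have : ∀ a, ∃ S X : ℝ, (a ≤ r → HarmBound (q a) S X) ∧ (a = 0 → √n * S = 11 / 10) ∧
      (a = 0 → X = 1) ∧ (a ≤ r → 1 ≤ a → √n * S ≤ 7 / 15 * weight F a) ∧
      (a ≤ r → 1 ≤ a → X ≤ weight F a / 15) := by
    intro a
    rcases Nat.eq_zero_or_pos a with rfl | ha
    · refine ⟨_, _, fun _ => hB.harmBound_zero hS hR, fun _ => by field_simp, fun _ => rfl,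
        fun _ h => by omega, fun _ h => by omega⟩
    · by_cases har : a ≤ r
      · obtain ⟨S, X, h1, h2, h3⟩ := hB.harmBound hS hR hF hK' hn ha (hO a ha har)
        exact ⟨S, X, fun _ => h1, fun h => by omega, fun h => by omega, fun _ _ => h2,
          fun _ _ => h3⟩
      · exact ⟨0, 0, fun h => absurd h har, fun h => by omega, fun h => by omega,
          fun h => absurd h har, fun h => absurd h har⟩
  choose S X h1 h2 h3 h4 h5 using this
  exact ⟨S, X, hF, hs, h1, h2 0 rfl, h3 0 rfl, h4, h5⟩

/-- The coefficients of `ω²`. -/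
def freqSq (ω : ℕ → ℝ) (a : ℕ) : ℝ := ∑ y ∈ antidiagonal a, ω y.1 * ω y.2

/-- The resonant equation: the normalization leaves only the term with the order-zero coefficient,
and the two multiples of `γ (p + 1) 1 1` vanish. -/
theorem IsReduced.freqSq_succ (hR : IsReduced n Ω u ω q γ)
    (hS : IsSpectrum n k1 k2 k31 k32 n1 n2 Ω u) (p : ℕ) :
    freqSq ω (p + 1) = -cubicCoef q (unitState (u 1)) p 1 := by
  have h1 : 1 ∈ Icc 1 (2 * n) := by
    have := hS.count
    simp only [mem_Icc]; omega
  have h := hR.mode p 1 h1 1 le_rfl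
  rw [hR.normalized _ (by omega), sum_eq_single (p + 1, 0)] at h
  · rw [hR.zero 1 h1 1 le_rfl] at h
    simp only [and_self, if_true, mul_one, Nat.cast_one, one_pow, one_mul, mul_zero] at h
    rw [freqSq, h]; ring
  · intro x hx hx'
    have : 1 ≤ x.2 := by
      by_contra h0
      apply hx'
      rw [HasAntidiagonal.mem_antidiagonal] at hx
      ext <;> simp only <;> omega
    rw [hR.normalized _ this, mul_zero]
  · intro h; simp at h

theorem IsReduced.mode_eq (hR : IsReduced n Ω u ω q γ) (p : ℕ) {j : ℕ} (hj : j ∈ Icc 1 (2 * n))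
    {k : ℕ} (hk : 1 ≤ k) (h0 : γ 0 k j = 0) :
    ((k : ℝ) ^ 2 * Ω 1 ^ 2 - Ω j ^ 2) * γ (p + 1) k j =
      -cubicCoef q (unitState (u j)) p k -
        (k : ℝ) ^ 2 * ∑ x ∈ (antidiagonal (p + 1)).filter (fun x => x.1 ≠ 0 ∧ x.2 ≠ 0),
          freqSq ω x.1 * γ x.2 k j := by
  have h := hR.mode p j hj k hk
  rw [sum_antidiagonal_eq_ends (by omega)] at h
  simp only [h0, mul_zero, HasAntidiagonal.antidiagonal_zero, sum_singleton, hR.freq_zero] at h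
  simp only [freqSq]
  linear_combination h

theorem IsReduced.abs_freqSq_le (hR : IsReduced n Ω u ω q γ)
    (hS : IsSpectrum n k1 k2 k31 k32 n1 n2 Ω u) (hB : SpecBounds n k1 k2 d K n1 n2 Ω u)
    {r : ℕ} {S X : ℕ → ℝ} (hq : HarmSeq q F √n r S X) {a : ℕ} (ha : 1 ≤ a) (har : a ≤ r + 1) :
    |freqSq ω a| ≤ 139 / 20 / n * (weight F a / F) := by
  obtain ⟨a, rfl⟩ := Nat.exists_eq_add_of_le' ha
  have hF := hq.F_pos
  have hn : (0 : ℝ) < n := Real.sqrt_pos.mp hq.s_pos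
  have hs2 : √(n : ℝ) ^ 2 = n := Real.sq_sqrt hn.le
  rw [hR.freqSq_succ hS, abs_neg]
  rcases Nat.eq_zero_or_pos a with rfl | h
  · rw [hR.cubicCoef_zero hS, abs_of_nonneg (by positivity), weight_of_pos (by omega)]
    have e : F ^ (0 + 1) / (((0 + 1 : ℕ) : ℝ) ^ 2 + 2) / F = 1 / 3 := by
      norm_num
      field_simp
    rw [e]
    have := hB.first_pow_four
    calc 3 * ∑ i, unitState (u 1) i ^ 4 ≤ 3 * (77 / 100 / n) := by gcongr
      _ = 231 / 100 / n := by ring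
      _ ≤ 139 / 60 / n := div_le_div_of_nonneg_right (by norm_num) hn.le
      _ = 139 / 20 / n * (1 / 3) := by ring
  · have := (hq.mono (r' := a) (by omega)).abs_cubicCoef_le_sup hB.first_sup h (k := 1) le_rfl
    rwa [hs2] at this

/-- Sum over the interior of an antidiagonal of products of bounded sequences. -/
theorem sum_filter_mul_le {V M : ℝ} (hF : 0 < F) (hV : 0 ≤ V) (hM : 0 ≤ M) {m : ℕ} {x y : ℕ → ℝ}
    (hy0 : ∀ a, 0 ≤ y a)
    (hx : ∀ a, 1 ≤ a → a < m → x a ≤ V * weight F a)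
    (hy : ∀ a, 1 ≤ a → a < m → y a ≤ M * weight F a) :
    ∑ z ∈ (antidiagonal m).filter (fun z => z.1 ≠ 0 ∧ z.2 ≠ 0), x z.1 * y z.2 ≤
      4 * (V * M) * weight F m := by
  have wn := weight_nonneg hF.le
  calc ∑ z ∈ (antidiagonal m).filter (fun z => z.1 ≠ 0 ∧ z.2 ≠ 0), x z.1 * y z.2
      ≤ ∑ z ∈ (antidiagonal m).filter (fun z => z.1 ≠ 0 ∧ z.2 ≠ 0),
          V * M * (weight F z.1 * weight F z.2) := by
        refine sum_le_sum fun z hz => ?_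
        rw [mem_filter, HasAntidiagonal.mem_antidiagonal] at hz
        calc x z.1 * y z.2 ≤ (V * weight F z.1) * (M * weight F z.2) :=
              mul_le_mul (hx _ (by omega) (by omega)) (hy _ (by omega) (by omega)) (hy0 _)
                (mul_nonneg hV (wn _))
          _ = _ := by ring
    _ ≤ ∑ z ∈ antidiagonal m, V * M * (weight F z.1 * weight F z.2) :=
        sum_le_sum_of_subset_of_nonneg (filter_subset _ _) fun z _ _ => by
          have := wn z.1
          have := wn z.2
          positivity
    _ ≤ V * M * (4 * weight F m) := by
        rw [← mul_sum]
        exact mul_le_mul_of_nonneg_left (sum_weight_mul_weight_le hF.le m) (by positivity)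
    _ = 4 * (V * M) * weight F m := by ring

/-- The estimate for uniformly nonresonant families. The terms with frequency corrections carry a
factor `k²`, but so does the divisor, and the inductive bound supplies the decay `1 / k²`. -/
theorem IsReduced.sum_abs_le (hR : IsReduced n Ω u ω q γ) {r : ℕ} {V M g : ℝ} (hF : 0 < F)
    (hn : (0 : ℝ) < n) (hM : 0 ≤ M)
    (hW : ∀ a, 1 ≤ a → a ≤ r + 1 → |freqSq ω a| ≤ 139 / 20 / n * (weight F a / F)) {J : Finset ℕ}
    (hJ : ∀ j ∈ J, j ∈ Icc 1 (2 * n)) {k : ℕ} (hk : 1 ≤ k) (h0 : ∀ j ∈ J, γ 0 k j = 0)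
    (hg : 0 < g) (hD : ∀ j ∈ J, g * (k : ℝ) ^ 2 ≤ |(k : ℝ) ^ 2 * Ω 1 ^ 2 - Ω j ^ 2|)
    (hM' : ∀ b, 1 ≤ b → b ≤ r → ∑ j ∈ J, |γ b k j| ≤ M * weight F b / k ^ 2)
    (hV : ∑ j ∈ J, |cubicCoef q (unitState (u j)) r k| ≤ V * (weight F (r + 1) / F)) :
    ∑ j ∈ J, |γ (r + 1) k j| ≤ (V + 28 * M / n) * (weight F (r + 1) / F) / (g * k ^ 2) := by
  have hk0 : (0 : ℝ) < (k : ℝ) ^ 2 := by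
    have : (0 : ℝ) < k := by exact_mod_cast hk
    positivity
  rw [le_div_iff₀ (by positivity)]
  have h1 : (∑ j ∈ J, |γ (r + 1) k j|) * (g * (k : ℝ) ^ 2) ≤
      ∑ j ∈ J, (|cubicCoef q (unitState (u j)) r k| + (k : ℝ) ^ 2 *
        ∑ x ∈ (antidiagonal (r + 1)).filter (fun x => x.1 ≠ 0 ∧ x.2 ≠ 0),
          |freqSq ω x.1| * |γ x.2 k j|) := by
    rw [sum_mul]
    refine sum_le_sum fun j hj => ?_
    have e := congrArg abs (hR.mode_eq r (hJ j hj) hk (h0 j hj))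
    rw [abs_mul] at e
    calc |γ (r + 1) k j| * (g * (k : ℝ) ^ 2)
        ≤ |γ (r + 1) k j| * |(k : ℝ) ^ 2 * Ω 1 ^ 2 - Ω j ^ 2| :=
          mul_le_mul_of_nonneg_left (hD j hj) (abs_nonneg _)
      _ = |-cubicCoef q (unitState (u j)) r k - (k : ℝ) ^ 2 *
          ∑ x ∈ (antidiagonal (r + 1)).filter (fun x => x.1 ≠ 0 ∧ x.2 ≠ 0),
            freqSq ω x.1 * γ x.2 k j| := by rw [← e, mul_comm]
      _ ≤ _ := by
          refine (abs_sub _ _).trans ?_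
          rw [abs_neg, abs_mul, abs_of_pos hk0]
          gcongr
          refine (abs_sum_le_sum_abs _ _).trans (le_of_eq ?_)
          exact sum_congr rfl fun x _ => abs_mul _ _
  have h2 : ∑ j ∈ J, (k : ℝ) ^ 2 *
        ∑ x ∈ (antidiagonal (r + 1)).filter (fun x => x.1 ≠ 0 ∧ x.2 ≠ 0),
          |freqSq ω x.1| * |γ x.2 k j| =
      (k : ℝ) ^ 2 * ∑ x ∈ (antidiagonal (r + 1)).filter (fun x => x.1 ≠ 0 ∧ x.2 ≠ 0),
          |freqSq ω x.1| * ∑ j ∈ J, |γ x.2 k j| := by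
    rw [← mul_sum, sum_comm]
    congr 1
    exact sum_congr rfl fun x _ => by rw [mul_sum]
  have h3 := sum_filter_mul_le (F := F) (V := 7 / n / F) (M := M / k ^ 2) (m := r + 1)
    (x := fun a => |freqSq ω a|) (y := fun b => ∑ j ∈ J, |γ b k j|) hF (by positivity)
    (by positivity) (fun a => sum_nonneg fun j _ => abs_nonneg _)
    (fun a ha har => (hW a ha (by omega)).trans (by
      have := weight_nonneg hF.le a
      calc 139 / 20 / n * (weight F a / F) = 139 / 20 * (weight F a / (n * F)) := by ring
        _ ≤ 7 * (weight F a / (n * F)) := by gcongr; norm_num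
        _ = 7 / n / F * weight F a := by ring))
    (fun a ha har => (hM' a ha (by omega)).trans (le_of_eq (by ring)))
  rw [sum_add_distrib, h2] at h1
  have h4 := mul_le_mul_of_nonneg_left h3 hk0.le
  have e : (k : ℝ) ^ 2 * (4 * (7 / n / F * (M / k ^ 2)) * weight F (r + 1)) =
      28 * M / n * (weight F (r + 1) / F) := by field_simp; ring
  rw [e] at h4
  linarith

end Step
end DiatomicChain
end

/-! ### The induction on the order. -/

noncomputable section
namespace DiatomicChain
open Finset MeasureTheory

section Induction
variable {n : ℕ} {k1 k2 k31 k32 d K : ℝ} {n1 n2 : ℕ} {Ω : ℕ → ℝ} {u : ℕ → Fin (2 * n) → ℝ}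
  {ω : ℕ → ℝ} {q : ℕ → ℝ → Fin (2 * n) → ℝ} {γ : ℕ → ℕ → ℕ → ℝ} {f c2 K' g : ℝ}

/-- The largeness of `n` required by the induction. -/
structure IsLarge (n : ℕ) (f c2 K K' g : ℝ) : Prop where
  modes : 1200 * K' ≤ n
  freq : 80 * c2 ^ 2 * f < (n : ℝ) ^ 2
  band : 32 / √n + 28 * K' / n < K' * f * g
  gap : 208 * K + 28 * K' / n < K' * f * g

/-- Taking the square root of the series for `ω²` costs only a quadratic term of relative size
`n^(-2)`, absorbed by the margin `1 / 20` between `139 / 20` and `7`. -/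
theorem IsReduced.abs_freq_lt (hR : IsReduced n Ω u ω q γ)
    (hS : IsSpectrum n k1 k2 k31 k32 n1 n2 Ω u) (hB : SpecBounds n k1 k2 d K n1 n2 Ω u)
    (hn : (0 : ℝ) < n) (hf : 0 < f) (hk2 : 0 < k2) (hc2 : 0 < c2)
    (hc : 2 * √(2 * k2) * c2 * f = 7) (hL : 80 * c2 ^ 2 * f < (n : ℝ) ^ 2) {r : ℕ}
    (hW : ∀ a, 1 ≤ a → a ≤ r + 1 →
      |freqSq ω a| ≤ 139 / 20 / n * (weight (f * n) a / (f * n)))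
    (hO : ∀ a, 1 ≤ a → a ≤ r → |ω a| < c2 * weight (f * n) a / n ^ 2) :
    |ω (r + 1)| < c2 * weight (f * n) (r + 1) / n ^ 2 := by
  have hF : 0 < f * n := by positivity
  have hw := weight_pos hF (a := r + 1) (by omega)
  have h1 : √(2 * k2) < Ω 1 := by
    rw [Real.sqrt_lt' (hS.pos 1 (by
      have := hS.count
      simp only [mem_Icc]; omega))]
    exact (hS.optical 1 (by simp [hB.one_le])).1
  have hs : 0 < √(2 * k2) := by positivity
  have h2 : 2 * Ω 1 * ω (r + 1) = freqSq ω (r + 1) -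
      ∑ x ∈ (antidiagonal (r + 1)).filter (fun x => x.1 ≠ 0 ∧ x.2 ≠ 0), ω x.1 * ω x.2 := by
    rw [freqSq, sum_antidiagonal_eq_ends (by omega), hR.freq_zero]
    ring
  have h3 := sum_filter_mul_le (F := f * n) (V := c2 / n ^ 2) (M := c2 / n ^ 2) (m := r + 1)
    (x := fun a => |ω a|) (y := fun a => |ω a|) hF (by positivity) (by positivity)
    (fun a => abs_nonneg _) (fun a ha har => (hO a ha (by omega)).le.trans (le_of_eq (by ring)))
    (fun a ha har => (hO a ha (by omega)).le.trans (le_of_eq (by ring)))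
  have h4 : |∑ x ∈ (antidiagonal (r + 1)).filter (fun x => x.1 ≠ 0 ∧ x.2 ≠ 0), ω x.1 * ω x.2| ≤
      ∑ x ∈ (antidiagonal (r + 1)).filter (fun x => x.1 ≠ 0 ∧ x.2 ≠ 0), |ω x.1| * |ω x.2| := by
    refine (abs_sum_le_sum_abs _ _).trans (le_of_eq ?_)
    exact sum_congr rfl fun x _ => abs_mul _ _
  have h5 := hW (r + 1) (by omega) le_rfl
  have h6 : 2 * Ω 1 * |ω (r + 1)| ≤ 139 / 20 / n * (weight (f * n) (r + 1) / (f * n)) +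
      4 * (c2 / n ^ 2 * (c2 / n ^ 2)) * weight (f * n) (r + 1) := by
    have := congrArg abs h2
    rw [abs_mul, abs_of_pos (by linarith : 0 < 2 * Ω 1)] at this
    rw [this]
    exact (abs_sub _ _).trans (add_le_add h5 (h4.trans h3))
  have h7 : 4 * (c2 / n ^ 2 * (c2 / n ^ 2)) * weight (f * n) (r + 1) <
      1 / 20 / n * (weight (f * n) (r + 1) / (f * n)) := by
    have e1 : 4 * (c2 / n ^ 2 * (c2 / n ^ 2)) * weight (f * n) (r + 1) =
        (80 * c2 ^ 2 * f) * (weight (f * n) (r + 1) / (20 * f * n ^ 4)) := by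
      field_simp; ring
    have e2 : 1 / 20 / n * (weight (f * n) (r + 1) / (f * n)) =
        (n : ℝ) ^ 2 * (weight (f * n) (r + 1) / (20 * f * n ^ 4)) := by
      field_simp
    rw [e1, e2]
    exact mul_lt_mul_of_pos_right hL (by positivity)
  have h8 : 2 * √(2 * k2) * |ω (r + 1)| ≤ 2 * Ω 1 * |ω (r + 1)| := by gcongr
  have h9 : 2 * √(2 * k2) * (c2 * weight (f * n) (r + 1) / n ^ 2) =
      139 / 20 / n * (weight (f * n) (r + 1) / (f * n)) +
        1 / 20 / n * (weight (f * n) (r + 1) / (f * n)) := by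
    have : 2 * √(2 * k2) * (c2 * weight (f * n) (r + 1) / n ^ 2) =
        (2 * √(2 * k2) * c2 * f) * (weight (f * n) (r + 1) / (f * n ^ 2)) := by field_simp
    rw [this, hc]
    field_simp
    norm_num
  refine lt_of_mul_lt_mul_left (a := 2 * √(2 * k2)) ?_ (by positivity)
  linarith

/-- The nearly resonant family. Cauchy-Schwarz combines the `ℓ²` bound `16 / n` on the cubic term
with the bound `f n² / 350` on the inverse divisors. The result `16 / 350`, plus `7 / 2160` from the
frequency corrections, is less than `1 / 16`. -/
theorem IsReduced.sum_first_lt (hR : IsReduced n Ω u ω q γ)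
    (hS : IsSpectrum n k1 k2 k31 k32 n1 n2 Ω u) (hB : SpecBounds n k1 k2 d K n1 n2 Ω u)
    (hn : (0 : ℝ) < n) (hf : 0 < growth k1 k2) {r : ℕ}
    (hW : ∀ a, 1 ≤ a → a ≤ r + 1 →
      |freqSq ω a| ≤ 139 / 20 / n * (weight (growth k1 k2 * n) a / (growth k1 k2 * n)))
    (hO : ∀ a, 1 ≤ a → a ≤ r → ∑ j ∈ D1 n1, |γ a 1 j| < weight (growth k1 k2 * n) a / 16)
    (hN : ∑ j ∈ Icc 1 (2 * n), cubicCoef q (unitState (u j)) r 1 ^ 2 ≤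
      (16 / n * (weight (growth k1 k2 * n) (r + 1) / (growth k1 k2 * n))) ^ 2) :
    ∑ j ∈ D1 n1, |γ (r + 1) 1 j| < weight (growth k1 k2 * n) (r + 1) / 16 := by
  set F := growth k1 k2 * n with hFdef
  have hF : 0 < F := by positivity
  have hw := weight_pos hF (a := r + 1) (by omega)
  have hJ : ∀ j ∈ D1 n1, j ∈ Icc 1 (2 * n) := by
    have := hS.count
    intro j; simp only [D1, mem_Icc]; omega
  have hΔ : ∀ j ∈ D1 n1, 0 < Ω j ^ 2 - Ω 1 ^ 2 := fun j hj =>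
    lt_of_lt_of_le (by positivity) (hB.spacing j hj)
  have hΔ' : ∀ j ∈ D1 n1, 1 / (Ω j ^ 2 - Ω 1 ^ 2) ≤ F * n / 540 := by
    intro j hj
    have := hB.spacing j hj
    rw [div_le_iff₀ (hΔ j hj)]
    rw [div_le_iff₀ (by positivity)] at this
    rw [hFdef]
    linarith
  have h0 : ∀ j ∈ D1 n1, γ 0 1 j = 0 := by
    intro j hj
    rw [hR.zero j (hJ j hj) 1 le_rfl, if_neg]
    simp only [D1, mem_Icc] at hj
    omega
  set T : ℕ → ℝ := fun j => ∑ x ∈ (antidiagonal (r + 1)).filter (fun x => x.1 ≠ 0 ∧ x.2 ≠ 0),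
    |freqSq ω x.1| * |γ x.2 1 j|
  have hT0 : ∀ j, 0 ≤ T j := fun j => sum_nonneg fun _ _ => by positivity
  have h1 : ∀ j ∈ D1 n1, |γ (r + 1) 1 j| ≤
      |cubicCoef q (unitState (u j)) r 1| * (1 / (Ω j ^ 2 - Ω 1 ^ 2)) + F * n / 540 * T j := by
    intro j hj
    have e := congrArg abs (hR.mode_eq r (hJ j hj) le_rfl (h0 j hj))
    rw [abs_mul, Nat.cast_one, one_pow, one_mul, one_mul, abs_sub_comm, abs_of_pos (hΔ j hj)] at e
    have e2 : (Ω j ^ 2 - Ω 1 ^ 2) * |γ (r + 1) 1 j| ≤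
        |cubicCoef q (unitState (u j)) r 1| + T j := by
      rw [e]
      refine (abs_sub _ _).trans ?_
      rw [abs_neg]
      gcongr
      refine (abs_sum_le_sum_abs _ _).trans (le_of_eq ?_)
      exact sum_congr rfl fun x _ => abs_mul _ _
    have e3 := mul_le_mul_of_nonneg_right (hΔ' j hj) (hT0 j)
    calc |γ (r + 1) 1 j| = ((Ω j ^ 2 - Ω 1 ^ 2) * |γ (r + 1) 1 j|) * (1 / (Ω j ^ 2 - Ω 1 ^ 2)) := by
          have := (hΔ j hj).ne'
          field_simp
      _ ≤ (|cubicCoef q (unitState (u j)) r 1| + T j) * (1 / (Ω j ^ 2 - Ω 1 ^ 2)) := by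
          have := hΔ j hj
          gcongr
      _ ≤ _ := by linarith
  have h2 : ∑ j ∈ D1 n1, T j ≤ 4 * (7 / n / F * (1 / 16)) * weight F (r + 1) := by
    have h3 := sum_filter_mul_le (F := F) (V := 7 / n / F) (M := 1 / 16) (m := r + 1)
      (x := fun a => |freqSq ω a|) (y := fun b => ∑ j ∈ D1 n1, |γ b 1 j|) hF (by positivity)
      (by positivity) (fun a => sum_nonneg fun j _ => abs_nonneg _)
      (fun a ha har => (hW a ha (by omega)).trans (by
        have := weight_nonneg hF.le a
        calc 139 / 20 / n * (weight F a / F) = 139 / 20 * (weight F a / (n * F)) := by ring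
          _ ≤ 7 * (weight F a / (n * F)) := by gcongr; norm_num
          _ = 7 / n / F * weight F a := by ring))
      (fun a ha har => (hO a ha (by omega)).le.trans (le_of_eq (by ring)))
    refine le_trans (le_of_eq ?_) h3
    rw [sum_comm]
    exact sum_congr rfl fun x _ => by rw [mul_sum]
  have h4 : ∑ j ∈ D1 n1, |cubicCoef q (unitState (u j)) r 1| * (1 / (Ω j ^ 2 - Ω 1 ^ 2)) ≤
      16 / n * (weight F (r + 1) / F) * (F * n / 350) := by
    refine abs_le_of_sq_le_sq' ?_ (by positivity) |>.2
    rw [mul_pow]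
    refine (Finset.sum_mul_sq_le_sq_mul_sq _ _ _).trans ?_
    have e1 : ∑ j ∈ D1 n1, |cubicCoef q (unitState (u j)) r 1| ^ 2 ≤
        (16 / n * (weight F (r + 1) / F)) ^ 2 := by
      simp only [sq_abs]
      exact (sum_le_sum_of_subset_of_nonneg hJ fun _ _ _ => sq_nonneg _).trans hN
    have e2 : ∑ j ∈ D1 n1, (1 / (Ω j ^ 2 - Ω 1 ^ 2)) ^ 2 ≤ (F * n / 350) ^ 2 := by
      refine hB.spacing_sum.trans (le_of_eq ?_)
      rw [hFdef]; ring
    exact mul_le_mul e1 e2 (sum_nonneg fun _ _ => sq_nonneg _) (sq_nonneg _)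
  have h5 := sum_le_sum h1
  rw [sum_add_distrib, ← mul_sum] at h5
  have h6 := mul_le_mul_of_nonneg_left h2 (show 0 ≤ F * n / 540 by positivity)
  have e1 : F * n / 540 * (4 * (7 / n / F * (1 / 16)) * weight F (r + 1)) =
      7 / 2160 * weight F (r + 1) := by field_simp; ring
  have e2 : 16 / n * (weight F (r + 1) / F) * (F * n / 350) = 16 / 350 * weight F (r + 1) := by
    field_simp
  rw [e1] at h6
  rw [e2] at h4
  linarith

/-- Strong induction: the bounds below an order give a `HarmSeq`, hence all three cubic estimates,
hence the five bounds at that order. Apart from the first harmonic of the optical band, every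
divisor is at least `g k²`. -/
theorem orderBounds (hk1 : 0 < k1) (hk12 : k1 < k2) (hS : IsSpectrum n k1 k2 k31 k32 n1 n2 Ω u)
    (hB : SpecBounds n k1 k2 d K n1 n2 Ω u) (hR : IsReduced n Ω u ω q γ) (hc2 : 0 < c2)
    (hc : 2 * √(2 * k2) * c2 * growth k1 k2 = 7) (hK' : 0 < K') (hK : 0 < K) (hg : 0 < g)
    (hg1 : g ≤ 2 * (k2 - k1)) (hg2 : g ≤ d) (hg3 : g ≤ k2)
    (hL : IsLarge n (growth k1 k2) c2 K K' g) (p : ℕ) (hp : 1 ≤ p) :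
    OrderBounds n n1 n2 (growth k1 k2 * n) c2 K' ω γ p := by
  induction p using Nat.strong_induction_on with
  | _ p ih =>
  obtain ⟨r, rfl⟩ := Nat.exists_eq_add_of_le' hp
  have hcnt := hS.count
  have hf := growth_pos hk1 hk12
  have hk2 := hk1.trans hk12
  have hn : (0 : ℝ) < n := by exact_mod_cast show 0 < n by omega
  have hn1 : (1 : ℝ) ≤ n := by exact_mod_cast show 1 ≤ n by omega
  set F := growth k1 k2 * n with hFdef
  have hF : 0 < F := by positivity
  have hw := weight_pos hF (a := r + 1) (by omega)
  have hs : 0 < √(n : ℝ) := Real.sqrt_pos.mpr hn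
  have hs2 : √(n : ℝ) ^ 2 = n := Real.sq_sqrt hn.le
  have hO : ∀ a, 1 ≤ a → a ≤ r → OrderBounds n n1 n2 F c2 K' ω γ a := fun a ha har =>
    ih a (by omega) ha
  obtain ⟨S, X, hq⟩ := hB.exists_harmSeq hS hR hF hK' hL.modes hO
  have hW := fun a ha har => hR.abs_freqSq_le hS hB hq (a := a) ha har
  have hN : ∀ k, 1 ≤ k → ∑ j ∈ Icc 1 (2 * n), cubicCoef q (unitState (u j)) r k ^ 2 ≤
      (16 / n * (weight F (r + 1) / F)) ^ 2 := by
    intro k hk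
    apply hS.sum_sq_cubicCoef_le hR.cont
    intro h H hH hh
    have := hq.abs_cubicCoef_le_norm hH hh hk
    rwa [hs2] at this
  have hN1 : ∀ k, 1 ≤ k → ∀ J : Finset ℕ, (∀ j ∈ J, j ∈ Icc 1 (2 * n)) →
      ∑ j ∈ J, |cubicCoef q (unitState (u j)) r k| ≤ 32 / √n * (weight F (r + 1) / F) := by
    intro k hk J hJ
    refine (sum_le_sum_of_subset_of_nonneg hJ fun _ _ _ => abs_nonneg _).trans ?_
    refine abs_le_of_sq_le_sq' ?_ (by positivity) |>.2
    -- Passing from `ℓ²` to `ℓ¹` over the `2 n` modes costs `√(2 n)`; the result `O(n^(-1/2))`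
    -- becomes `O(n^(-3/2))` after division by `F`, better than the `1 / n` required.
    refine sq_sum_le_card_mul_sum_sq.trans ?_
    simp only [sq_abs, Nat.card_Icc, Nat.add_sub_cancel]
    refine (mul_le_mul_of_nonneg_left (hN k hk) (by positivity)).trans ?_
    rw [mul_pow, mul_pow, div_pow (16 : ℝ), div_pow (32 : ℝ), hs2, ← mul_assoc]
    apply mul_le_mul_of_nonneg_right _ (by positivity)
    push_cast
    rw [div_eq_mul_inv, div_eq_mul_inv]
    have : 2 * (n : ℝ) * (16 ^ 2 * ((n : ℝ) ^ 2)⁻¹) = 512 * (n : ℝ)⁻¹ := by field_simp; norm_num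
    rw [this]
    have : 0 < (n : ℝ)⁻¹ := by positivity
    linarith
  have hN3 : ∀ k, ∑ j ∈ D3 n n1 n2, |cubicCoef q (unitState (u j)) r k| ≤
      208 * K / (n * √n) * (weight F (r + 1) / F) := by
    intro k
    have e : ∀ j ∈ D3 n n1 n2, |cubicCoef q (unitState (u j)) r k| ≤
        104 * K / (n * √n) * (weight F (r + 1) / F) := by
      intro j hj
      have := hq.abs_cubicCoef_le_sum (hB.gap_sum j hj) k
      rwa [pow_succ, hs2] at this
    refine (sum_le_card_nsmul _ _ _ e).trans ?_
    rw [nsmul_eq_mul]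
    have hcard : ((D3 n n1 n2).card : ℝ) ≤ 2 := by exact_mod_cast card_le_two
    refine (mul_le_mul_of_nonneg_right hcard (by positivity)).trans (le_of_eq ?_)
    ring
  have m1 : ∀ j ∈ Icc 1 n1, j ∈ Icc 1 (2 * n) := by
    intro j; simp only [mem_Icc]; omega
  have m2 : ∀ j ∈ D2 n n2, j ∈ Icc 1 (2 * n) := by
    intro j; simp only [D2, mem_Icc]; omega
  have m3 : ∀ j ∈ D3 n n1 n2, j ∈ Icc 1 (2 * n) := by
    intro j; simp only [D3, mem_Icc, mem_insert, mem_singleton]; omega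
  have o1 := (hS.optical 1 (by simp [hB.one_le])).1
  have hhigh : ∀ k : ℕ, 2 ≤ k → ∀ j ∈ Icc 1 (2 * n),
      g * (k : ℝ) ^ 2 ≤ |(k : ℝ) ^ 2 * Ω 1 ^ 2 - Ω j ^ 2| := by
    intro k hk j hj
    refine le_trans ?_ (le_abs_self _)
    exact (mul_le_mul_of_nonneg_right hg3 (sq_nonneg _)).trans
      (hS.nonresonant hk1 hk12 hB.one_le hj hk)
  have hz : ∀ k : ℕ, 1 ≤ k → ∀ j ∈ Icc 1 (2 * n), (k ≠ 1 ∨ j ≠ 1) → γ 0 k j = 0 := by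
    intro k hk j hj h
    rw [hR.zero j hj k hk, if_neg (by tauto)]
  have hband : ∀ k : ℕ, 1 ≤ k → (32 / √n + 28 * (K' / n) / n) * (weight F (r + 1) / F) /
      (g * (k : ℝ) ^ 2) < K' * weight F (r + 1) / n / k ^ 2 := by
    intro k hk
    have hk0 : (0 : ℝ) < k := by exact_mod_cast hk
    have e1 : 28 * (K' / n) / n ≤ 28 * K' / n := by
      rw [← mul_div_assoc]
      exact div_le_self (by positivity) hn1
    have e2 : 32 / √n + 28 * (K' / n) / n < K' * growth k1 k2 * g := by linarith [hL.band]
    calc (32 / √n + 28 * (K' / n) / n) * (weight F (r + 1) / F) / (g * (k : ℝ) ^ 2)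
        < (K' * growth k1 k2 * g) * (weight F (r + 1) / F) / (g * (k : ℝ) ^ 2) := by gcongr
      _ = K' * weight F (r + 1) / n / k ^ 2 := by rw [hFdef]; field_simp
  have hgap : ∀ k : ℕ, 1 ≤ k → (208 * K / (n * √n) + 28 * (K' / (n ^ 2 * √n)) / n) *
      (weight F (r + 1) / F) / (g * (k : ℝ) ^ 2) <
      K' * weight F (r + 1) / (n ^ 2 * √n) / k ^ 2 := by
    intro k hk
    have hk0 : (0 : ℝ) < k := by exact_mod_cast hk
    have e1 : 28 * (K' / (n ^ 2 * √n)) / n ≤ 28 * K' / n / (n * √n) := by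
      rw [mul_div_assoc', div_div, div_div]
      apply div_le_div_of_nonneg_left (by positivity) (by positivity)
      have : (n : ℝ) * (n * √n) * 1 ≤ n * (n * √n) * n := by gcongr
      linarith
    have e2 : 208 * K / (n * √n) + 28 * (K' / (n ^ 2 * √n)) / n <
        K' * growth k1 k2 * g / (n * √n) := by
      have := div_lt_div_of_pos_right hL.gap (show 0 < n * √n by positivity)
      rw [add_div] at this
      linarith
    calc (208 * K / (n * √n) + 28 * (K' / (n ^ 2 * √n)) / n) *
          (weight F (r + 1) / F) / (g * (k : ℝ) ^ 2)
        < (K' * growth k1 k2 * g / (n * √n)) * (weight F (r + 1) / F) / (g * (k : ℝ) ^ 2) := by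
          gcongr
      _ = K' * weight F (r + 1) / (n ^ 2 * √n) / k ^ 2 := by rw [hFdef]; field_simp
  refine ⟨?_, ?_, ?_, ?_, ?_⟩
  · exact hR.abs_freq_lt hS hB hn hf hk2 hc2 hc hL.freq hW fun a ha har => (hO a ha har).freq
  · exact hR.sum_first_lt hS hB hn hf hW (fun a ha har => (hO a ha har).first) (hN 1 le_rfl)
  · intro k hk
    refine lt_of_le_of_lt (hR.sum_abs_le hF hn (M := K' / n) (by positivity) hW m1 (by omega)
      (fun j hj => hz k (by omega) j (m1 j hj) (Or.inl (by omega))) hg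
      (fun j hj => hhigh k hk j (m1 j hj))
      (fun b hb hbr => ((hO b hb hbr).optical k hk).le.trans (le_of_eq (by ring)))
      (hN1 k (by omega) _ m1)) (hband k (by omega))
  · intro k hk
    refine lt_of_le_of_lt (hR.sum_abs_le hF hn (M := K' / n) (by positivity) hW m2 hk
      (fun j hj => hz k hk j (m2 j hj) (Or.inr ?_)) hg (fun j hj => ?_)
      (fun b hb hbr => ((hO b hb hbr).acoustic k hk).le.trans (le_of_eq (by ring)))
      (hN1 k hk _ m2)) (hband k hk)
    · have := hB.one_le
      simp only [D2, mem_Icc] at hj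
      omega
    · rcases hk.eq_or_lt with rfl | hk'
      · refine le_trans ?_ (le_abs_self _)
        have := hS.acoustic j hj
        push_cast
        linarith
      · exact hhigh k hk' j (m2 j hj)
  · intro k hk
    refine lt_of_le_of_lt (hR.sum_abs_le hF hn (M := K' / (n ^ 2 * √n)) (by positivity) hW m3 hk
      (fun j hj => hz k hk j (m3 j hj) (Or.inr ?_)) hg (fun j hj => ?_)
      (fun b hb hbr => ((hO b hb hbr).gap k hk).le.trans (le_of_eq (by ring)))
      (hN3 k)) (hgap k hk)
    · have := hB.one_le
      simp only [D3, mem_insert, mem_singleton] at hj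
      omega
    · rcases hk.eq_or_lt with rfl | hk'
      · refine le_trans ?_ (le_abs_self _)
        have := hB.gap_spacing j hj
        push_cast
        linarith
      · exact hhigh k hk' j (m3 j hj)

end Induction
end DiatomicChain
end

/-! ### Cosine polynomials with odd frequencies. -/

noncomputable section
namespace DiatomicChain
open Finset MeasureTheory

/-- The cosine polynomials with odd frequencies. -/
def oddCos : Submodule ℝ (ℝ → ℝ) :=
  Submodule.span ℝ (Set.range fun (l : ℤ) (τ : ℝ) => Real.cos ((2 * l + 1) * τ))

theorem cos_mem_oddCos (l : ℤ) : (fun τ : ℝ => Real.cos ((2 * l + 1) * τ)) ∈ oddCos :=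
  Submodule.subset_span ⟨l, rfl⟩

theorem two_cos_mem_oddCos : (fun τ : ℝ => 2 * Real.cos τ) ∈ oddCos := by
  have := oddCos.smul_mem 2 (cos_mem_oddCos 0)
  convert this using 1
  ext τ
  simp

theorem sum_mem_oddCos {ι : Type*} (s : Finset ι) {f : ι → ℝ → ℝ} (hf : ∀ i ∈ s, f i ∈ oddCos) :
    (fun τ => ∑ i ∈ s, f i τ) ∈ oddCos := by
  have : (fun τ => ∑ i ∈ s, f i τ) = ∑ i ∈ s, f i := by ext τ; simp
  rw [this]
  exact oddCos.sum_mem hf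

theorem const_mul_mem_oddCos (x : ℝ) {f : ℝ → ℝ} (hf : f ∈ oddCos) :
    (fun τ => x * f τ) ∈ oddCos := oddCos.smul_mem x hf

/-- A product of three cosines is a mean of four cosines whose frequencies are signed sums of three
odd numbers, hence odd; in particular no constant term can appear. -/
theorem triple_mem_oddCos {f g h : ℝ → ℝ} (hf : f ∈ oddCos) (hg : g ∈ oddCos) (hh : h ∈ oddCos) :
    (fun τ => f τ * (g τ * h τ)) ∈ oddCos := by
  have h1 : f * (g * h) ∈ oddCos * (oddCos * oddCos) :=
    Submodule.mul_mem_mul hf (Submodule.mul_mem_mul hg hh)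
  have h2 : oddCos * (oddCos * oddCos) ≤ oddCos := by
    conv_lhs => unfold oddCos
    rw [Submodule.span_mul_span, Submodule.span_mul_span, Submodule.span_le]
    rintro _ ⟨_, ⟨a, rfl⟩, _, ⟨_, ⟨b, rfl⟩, _, ⟨c, rfl⟩, rfl⟩, rfl⟩
    have e : ((fun τ : ℝ => Real.cos ((2 * a + 1) * τ)) *
        ((fun τ : ℝ => Real.cos ((2 * b + 1) * τ)) * fun τ : ℝ => Real.cos ((2 * c + 1) * τ))) =
        fun τ : ℝ => 1 / 4 * (Real.cos ((2 * (a + b + c + 1 : ℤ) + 1) * τ) +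
          Real.cos ((2 * (a + b - c : ℤ) + 1) * τ) + Real.cos ((2 * (a - b + c : ℤ) + 1) * τ) +
          Real.cos ((2 * (a - b - c - 1 : ℤ) + 1) * τ)) := by
      ext τ
      simp only [Pi.mul_apply]
      set x := (2 * (a : ℝ) + 1) * τ with hx
      set y := (2 * (b : ℝ) + 1) * τ with hy
      set z := (2 * (c : ℝ) + 1) * τ with hz
      have e1 : (2 * ((a + b + c + 1 : ℤ) : ℝ) + 1) * τ = x + y + z := by
        push_cast; rw [hx, hy, hz]; ring
      have e2 : (2 * ((a + b - c : ℤ) : ℝ) + 1) * τ = x + y - z := by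
        push_cast; rw [hx, hy, hz]; ring
      have e3 : (2 * ((a - b + c : ℤ) : ℝ) + 1) * τ = x - y + z := by
        push_cast; rw [hx, hy, hz]; ring
      have e4 : (2 * ((a - b - c - 1 : ℤ) : ℝ) + 1) * τ = x - y - z := by
        push_cast; rw [hx, hy, hz]; ring
      rw [e1, e2, e3, e4, Real.cos_add (x + y), Real.cos_sub (x + y), Real.cos_add (x - y),
        Real.cos_sub (x - y), Real.cos_add x, Real.cos_sub x]
      ring
    simp only
    rw [e]
    apply const_mul_mem_oddCos
    exact oddCos.add_mem (oddCos.add_mem (oddCos.add_mem (cos_mem_oddCos _) (cos_mem_oddCos _))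
      (cos_mem_oddCos _)) (cos_mem_oddCos _)
  exact h2 h1

theorem contDiff_of_mem_oddCos {g : ℝ → ℝ} (hg : g ∈ oddCos) : ContDiff ℝ 2 g := by
  refine Submodule.span_induction (p := fun g _ => ContDiff ℝ 2 g) ?_ contDiff_const
    (fun x y _ _ hx hy => hx.add hy) (fun a x _ hx => contDiff_const.smul hx) hg
  rintro _ ⟨l, rfl⟩
  fun_prop

theorem iteratedDeriv_two_cos (x τ : ℝ) :
    iteratedDeriv 2 (fun τ => Real.cos (x * τ)) τ = -x ^ 2 * Real.cos (x * τ) := by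
  rw [congrFun (iteratedDeriv_comp_const_mul (n := 2) (f := Real.cos)
    (Real.contDiff_cos) x) τ]
  simp [iteratedDeriv_succ]

theorem iteratedDeriv_two_mem_oddCos {g : ℝ → ℝ} (hg : g ∈ oddCos) :
    iteratedDeriv 2 g ∈ oddCos := by
  refine Submodule.span_induction (p := fun g _ => iteratedDeriv 2 g ∈ oddCos) ?_ ?_ ?_ ?_ hg
  · rintro _ ⟨l, rfl⟩
    have : iteratedDeriv 2 (fun τ : ℝ => Real.cos ((2 * l + 1) * τ)) =
        fun τ => -(2 * (l : ℝ) + 1) ^ 2 * Real.cos ((2 * l + 1) * τ) :=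
      funext fun τ => iteratedDeriv_two_cos _ τ
    rw [this]
    exact const_mul_mem_oddCos _ (cos_mem_oddCos l)
  · have : iteratedDeriv 2 (0 : ℝ → ℝ) = 0 := funext fun x => iteratedDeriv_const_zero
    rw [this]
    exact oddCos.zero_mem
  · intro x y hx hy ix iy
    have : iteratedDeriv 2 (x + y) = iteratedDeriv 2 x + iteratedDeriv 2 y := funext fun τ =>
      iteratedDeriv_add (contDiff_of_mem_oddCos hx).contDiffAt
        (contDiff_of_mem_oddCos hy).contDiffAt
    rw [this]
    exact oddCos.add_mem ix iy
  · intro a x hx ix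
    have : iteratedDeriv 2 (a • x) = a • iteratedDeriv 2 x :=
      funext fun τ => iteratedDeriv_const_smul_field a x
    rw [this]
    exact oddCos.smul_mem a ix

theorem cosCoef_cos_odd (l : ℤ) {k : ℕ} (hk : 1 ≤ k) :
    cosCoef k (fun τ => Real.cos ((2 * l + 1) * τ)) =
      if (2 * l + 1).natAbs = k then 1 / 2 else 0 := by
  obtain ⟨M, hM⟩ : ∃ M, (2 * l + 1).natAbs = M + 1 := ⟨(2 * l + 1).natAbs - 1, by omega⟩
  have e : (fun τ : ℝ => Real.cos ((2 * l + 1) * τ)) =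
      fun τ => 1 / 2 * (2 * Real.cos (((M : ℝ) + 1) * τ)) := by
    ext τ
    have h1 : (2 * l + 1 : ℤ) = M + 1 ∨ (2 * l + 1 : ℤ) = -(M + 1) := by omega
    have h2 : Real.cos ((2 * (l : ℝ) + 1) * τ) = Real.cos (((M : ℝ) + 1) * τ) := by
      rcases h1 with h | h
      · have : 2 * (l : ℝ) + 1 = M + 1 := by exact_mod_cast h
        rw [this]
      · have : 2 * (l : ℝ) + 1 = -(M + 1) := by exact_mod_cast h
        rw [this, neg_mul, Real.cos_neg]
    rw [h2]; ring
  rw [e, cosCoef_const_mul, cosCoef_two_cos M hk, hM]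
  split_ifs <;> simp

theorem hasSum_of_mem_oddCos {g : ℝ → ℝ} (hg : g ∈ oddCos) (τ : ℝ) :
    HasSum (fun k : ℕ => cosCoef (k + 1) g * (2 * Real.cos (((k : ℝ) + 1) * τ))) (g τ) := by
  refine Submodule.span_induction (p := fun g _ => HasSum (fun k : ℕ => cosCoef (k + 1) g *
    (2 * Real.cos (((k : ℝ) + 1) * τ))) (g τ)) ?_ ?_ ?_ ?_ hg
  · rintro _ ⟨l, rfl⟩
    obtain ⟨M, hM⟩ : ∃ M, (2 * l + 1).natAbs = M + 1 := ⟨(2 * l + 1).natAbs - 1, by omega⟩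
    have h1 : (2 * l + 1 : ℤ) = M + 1 ∨ (2 * l + 1 : ℤ) = -(M + 1) := by omega
    have h2 : Real.cos ((2 * (l : ℝ) + 1) * τ) = Real.cos (((M : ℝ) + 1) * τ) := by
      rcases h1 with h | h
      · have : 2 * (l : ℝ) + 1 = M + 1 := by exact_mod_cast h
        rw [this]
      · have : 2 * (l : ℝ) + 1 = -(M + 1) := by exact_mod_cast h
        rw [this, neg_mul, Real.cos_neg]
    have h3 := hasSum_ite_eq M (Real.cos (((M : ℝ) + 1) * τ))
    simp only
    rw [h2]
    convert h3 using 2 with k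
    rw [cosCoef_cos_odd l (by omega), hM]
    by_cases h : k = M
    · subst h; simp
    · rw [if_neg (by omega), if_neg h, zero_mul]
  · simp [cosCoef]
  · intro x y hx hy ix iy
    have e : ∀ k : ℕ, cosCoef (k + 1) (x + y) = cosCoef (k + 1) x + cosCoef (k + 1) y := fun k =>
      cosCoef_add _ (contDiff_of_mem_oddCos hx).continuous (contDiff_of_mem_oddCos hy).continuous
    have h := ix.add iy
    simp only [← add_mul, ← e] at h
    exact h
  · intro a x hx ix
    have e : ∀ k : ℕ, cosCoef (k + 1) (a • x) = a * cosCoef (k + 1) x := fun k =>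
      cosCoef_const_mul _ _ _
    have h := ix.mul_left a
    simp only [← mul_assoc a, ← e] at h
    exact h

/-- Solvability of `a y'' + b y = g`, up to a multiple of the resonant term. -/
theorem exists_oscillator_solution {a b : ℝ} (hab : ∀ l : ℤ, (2 * l + 1) ^ 2 ≠ 1 →
    b ≠ (2 * (l : ℝ) + 1) ^ 2 * a) {g : ℝ → ℝ} (hg : g ∈ oddCos) :
    ∃ y ∈ oddCos, ∃ μ : ℝ, (b = a → cosCoef 1 y = 0) ∧ (b ≠ a → μ = 0) ∧
      ∀ τ, a * iteratedDeriv 2 y τ + b * y τ = g τ + μ * (2 * Real.cos τ) := by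
  refine Submodule.span_induction (p := fun g _ => ∃ y ∈ oddCos, ∃ μ : ℝ,
    (b = a → cosCoef 1 y = 0) ∧ (b ≠ a → μ = 0) ∧
      ∀ τ, a * iteratedDeriv 2 y τ + b * y τ = g τ + μ * (2 * Real.cos τ)) ?_ ?_ ?_ ?_ hg
  · rintro _ ⟨l, rfl⟩
    have hsol : b ≠ (2 * (l : ℝ) + 1) ^ 2 * a → ∀ τ, a * iteratedDeriv 2 (fun τ : ℝ =>
        (b - (2 * (l : ℝ) + 1) ^ 2 * a)⁻¹ * Real.cos ((2 * l + 1) * τ)) τ +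
        b * ((b - (2 * (l : ℝ) + 1) ^ 2 * a)⁻¹ * Real.cos ((2 * l + 1) * τ)) =
        Real.cos ((2 * l + 1) * τ) + 0 * (2 * Real.cos τ) := by
      intro h τ
      have h' := sub_ne_zero.mpr h
      rw [iteratedDeriv_const_mul_field, iteratedDeriv_two_cos]
      linear_combination Real.cos ((2 * (l : ℝ) + 1) * τ) * mul_inv_cancel₀ h'
    by_cases hl : (2 * l + 1) ^ 2 = 1
    · have hl' : (2 * (l : ℝ) + 1) ^ 2 = 1 := by exact_mod_cast hl
      by_cases hba : b = a
      · refine ⟨0, oddCos.zero_mem, -(1 / 2), fun _ => by simp [cosCoef],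
          fun h => absurd hba h, fun τ => ?_⟩
        have hc : Real.cos ((2 * (l : ℝ) + 1) * τ) = Real.cos τ := by
          rcases (sq_eq_sq_iff_eq_or_eq_neg.mp (hl'.trans (one_pow 2).symm)) with h | h
          · rw [h, one_mul]
          · rw [h, neg_one_mul, Real.cos_neg]
        have : iteratedDeriv 2 (0 : ℝ → ℝ) τ = 0 := iteratedDeriv_const_zero
        rw [this]
        simp only
        rw [hc]
        simp
      · refine ⟨_, const_mul_mem_oddCos _ (cos_mem_oddCos l), 0, fun h => absurd h hba,
          fun _ => rfl, hsol ?_⟩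
        rw [hl', one_mul]
        exact hba
    · refine ⟨_, const_mul_mem_oddCos _ (cos_mem_oddCos l), 0, fun _ => ?_, fun _ => rfl,
        hsol (hab l hl)⟩
      rw [cosCoef_const_mul, cosCoef_cos_odd l le_rfl, if_neg, mul_zero]
      intro h
      apply hl
      rw [← Int.natAbs_sq, h]
      norm_num
  · refine ⟨0, oddCos.zero_mem, 0, fun _ => by simp [cosCoef], fun _ => rfl, fun τ => ?_⟩
    have : iteratedDeriv 2 (0 : ℝ → ℝ) τ = 0 := iteratedDeriv_const_zero
    rw [this]
    simp
  · rintro x y - - ⟨y1, m1, μ1, p1, q1, e1⟩ ⟨y2, m2, μ2, p2, q2, e2⟩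
    refine ⟨y1 + y2, oddCos.add_mem m1 m2, μ1 + μ2, fun h => ?_, fun h => ?_, fun τ => ?_⟩
    · have := cosCoef_add 1 (contDiff_of_mem_oddCos m1).continuous
        (contDiff_of_mem_oddCos m2).continuous
      rw [p1 h, p2 h, add_zero] at this
      exact this
    · rw [q1 h, q2 h, add_zero]
    · rw [iteratedDeriv_add (contDiff_of_mem_oddCos m1).contDiffAt
        (contDiff_of_mem_oddCos m2).contDiffAt, Pi.add_apply, Pi.add_apply]
      linarith [e1 τ, e2 τ]
  · rintro r x - ⟨y1, m1, μ1, p1, q1, e1⟩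
    refine ⟨r • y1, oddCos.smul_mem r m1, r * μ1, fun h => ?_, fun h => ?_, fun τ => ?_⟩
    · have := cosCoef_const_mul 1 r y1
      rw [p1 h, mul_zero] at this
      exact this
    · rw [q1 h, mul_zero]
    · rw [iteratedDeriv_const_smul_field r y1]
      simp only [Pi.smul_apply, smul_eq_mul]
      linear_combination r * e1 τ

/-- Construction of a sequence by choosing its terms one after the other. -/
theorem exists_seq_of_step {α : Type*} [Inhabited α] {P : ℕ → (ℕ → α) → Prop}
    (hcongr : ∀ m s s', (∀ a ≤ m, s a = s' a) → P m s → P m s')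
    (hstep : ∀ m s, (∀ a < m, P a s) → ∃ x, P m (Function.update s m x)) :
    ∃ s, ∀ m, P m s := by
  choose! x hx using hstep
  let F : ℕ → ℕ → α := fun m => Nat.rec (fun _ => default)
    (fun m s => Function.update s m (x m s)) m
  have hF : ∀ m, F (m + 1) = Function.update (F m) m (x m (F m)) := fun m => rfl
  have hstab : ∀ a m, a < m → F m a = F (a + 1) a := by
    intro a m h
    induction m with
    | zero => omega
    | succ m ih =>
      rcases (Nat.lt_succ_iff_lt_or_eq.mp h) with h | rfl
      · rw [hF, Function.update_of_ne (by omega), ih h]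
      · rfl
  have hP : ∀ m, ∀ a < m, P a (F m) := by
    intro m
    induction m with
    | zero => intro a h; omega
    | succ m ih =>
      intro a h
      rcases (Nat.lt_succ_iff_lt_or_eq.mp h) with h | rfl
      · refine hcongr a _ _ (fun b hb => ?_) (ih a h)
        rw [hF, Function.update_of_ne (by omega)]
      · rw [hF]
        exact hx a _ ih
  refine ⟨fun a => F (a + 1) a, fun m => hcongr m _ _ (fun a ha => ?_) (hP (m + 1) m (by omega))⟩
  exact hstab a (m + 1) (by omega)

end DiatomicChain
end

/-! ### Construction of the expansion. -/

noncomputable section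
namespace DiatomicChain
open Finset MeasureTheory

section Existence
variable {n : ℕ} {k1 k2 k31 k32 : ℝ} {n1 n2 : ℕ} {Ω : ℕ → ℝ} {u : ℕ → Fin (2 * n) → ℝ}

/-- In the eigenbasis the equation decouples into oscillators, of which only the first mode
resonates, and only at the first harmonic. The parameter `μ` compensates that component of the
forcing. -/
theorem IsSpectrum.exists_mode_solution (hS : IsSpectrum n k1 k2 k31 k32 n1 n2 Ω u) (hk1 : 0 < k1)
    (hk12 : k1 < k2) (hn1 : 1 ≤ n1) {G : ℝ → Fin (2 * n) → ℝ}
    (hG : ∀ i, (fun τ => G τ i) ∈ oddCos) :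
    ∃ Y : ℝ → Fin (2 * n) → ℝ, (∀ i, (fun τ => Y τ i) ∈ oddCos) ∧
      cosCoef 1 (fun τ => ∑ i, unitState (u 1) i * Y τ i) = 0 ∧
      ∃ μ : ℝ, ∀ τ i, Ω 1 ^ 2 * iteratedDeriv 2 (fun s => Y s i) τ -
        ∑ p, chainMatrix n k1 k2 k31 k32 i p * Y τ p =
          G τ i + μ * (unitState (u 1) i * (2 * Real.cos τ)) := by
  have hcnt := hS.count
  have h1 : 1 ∈ Icc 1 (2 * n) := by simp only [mem_Icc]; omega
  have hk2 := hk1.trans hk12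
  have hex : ∀ j, ∃ y : ℝ → ℝ, ∃ μ : ℝ, j ∈ Icc 1 (2 * n) → y ∈ oddCos ∧
      (j = 1 → cosCoef 1 y = 0) ∧ (j ≠ 1 → μ = 0) ∧
      ∀ τ, Ω 1 ^ 2 * iteratedDeriv 2 y τ + Ω j ^ 2 * y τ =
        (∑ p, unitState (u j) p * G τ p) + μ * (2 * Real.cos τ) := by
    intro j
    by_cases hj : j ∈ Icc 1 (2 * n)
    · have hab : ∀ l : ℤ, (2 * l + 1) ^ 2 ≠ 1 → Ω j ^ 2 ≠ (2 * (l : ℝ) + 1) ^ 2 * Ω 1 ^ 2 := by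
        intro l hl h
        have hk : 2 ≤ (2 * l + 1).natAbs := by
          by_contra hlt
          have : (2 * l + 1).natAbs = 1 := by omega
          apply hl
          rw [← Int.natAbs_sq, this]
          norm_num
        have h3 := hS.nonresonant hk1 hk12 hn1 hj hk
        have h4 : (((2 * l + 1).natAbs : ℕ) : ℝ) ^ 2 = (2 * (l : ℝ) + 1) ^ 2 := by
          rw [Nat.cast_natAbs, Int.cast_abs, sq_abs]
          push_cast
          ring
        rw [h4, ← h, sub_self, ← h4] at h3
        have : (0 : ℝ) < ((2 * l + 1).natAbs : ℝ) ^ 2 := by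
          have : (0 : ℝ) < ((2 * l + 1).natAbs : ℝ) := by exact_mod_cast (by omega)
          positivity
        have := mul_pos hk2 this
        linarith
      obtain ⟨y, hy, μ, p1, p2, p3⟩ := exists_oscillator_solution hab
        (sum_mem_oddCos univ fun p _ => const_mul_mem_oddCos (unitState (u j) p) (hG p))
      refine ⟨y, μ, fun _ => ⟨hy, fun h => p1 (by rw [h]), fun h => p2 fun h' => h ?_, p3⟩⟩
      exact hS.sq_injOn hj h1 h'
    · exact ⟨0, 0, fun h => absurd h hj⟩
  choose y μ hy using hex
  have hcd : ∀ j ∈ Icc 1 (2 * n), ContDiff ℝ 2 (y j) := fun j hj =>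
    contDiff_of_mem_oddCos (hy j hj).1
  refine ⟨fun τ i => ∑ j ∈ Icc 1 (2 * n), y j τ * unitState (u j) i, fun i => ?_, ?_, μ 1,
    fun τ i => ?_⟩
  · apply sum_mem_oddCos (f := fun j τ => y j τ * unitState (u j) i)
    intro j hj
    simp only [mul_comm (y j _)]
    exact const_mul_mem_oddCos _ (hy j hj).1
  · simp only [hS.sum_unitState_mul_sum h1 (fun j => y j _)]
    exact (hy 1 h1).2.1 rfl
  · have e1 : iteratedDeriv 2 (fun s => ∑ j ∈ Icc 1 (2 * n), y j s * unitState (u j) i) τ =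
        ∑ j ∈ Icc 1 (2 * n), iteratedDeriv 2 (y j) τ * unitState (u j) i := by
      rw [iteratedDeriv_fun_sum fun j hj => ((hcd j hj).mul contDiff_const).contDiffAt]
      exact sum_congr rfl fun j _ => by rw [iteratedDeriv_mul_const_field]
    have e2 : ∑ p, chainMatrix n k1 k2 k31 k32 i p *
        ∑ j ∈ Icc 1 (2 * n), y j τ * unitState (u j) p =
        ∑ j ∈ Icc 1 (2 * n), -(Ω j ^ 2 * y j τ * unitState (u j) i) := by
      simp only [mul_sum]
      rw [sum_comm]
      refine sum_congr rfl fun j hj => ?_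
      have h := congrFun (hS.unitState_eigen hj) i
      simp only [Matrix.mulVec, dotProduct, Pi.smul_apply, smul_eq_mul] at h
      calc ∑ p, chainMatrix n k1 k2 k31 k32 i p * (y j τ * unitState (u j) p)
          = y j τ * ∑ p, chainMatrix n k1 k2 k31 k32 i p * unitState (u j) p := by
            rw [mul_sum]; exact sum_congr rfl fun p _ => by ring
        _ = _ := by rw [h]; ring
    rw [e1, e2, mul_sum, ← sum_sub_distrib]
    have e3 : ∀ j ∈ Icc 1 (2 * n), Ω 1 ^ 2 * (iteratedDeriv 2 (y j) τ * unitState (u j) i) -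
        -(Ω j ^ 2 * y j τ * unitState (u j) i) =
        (∑ p, unitState (u j) p * G τ p) * unitState (u j) i +
          if j = 1 then μ 1 * (unitState (u 1) i * (2 * Real.cos τ)) else 0 := by
      intro j hj
      have h := (hy j hj).2.2.2 τ
      split_ifs with hj1
      · subst hj1
        linear_combination unitState (u 1) i * h
      · rw [(hy j hj).2.2.1 hj1] at h
        linear_combination unitState (u j) i * h
    rw [sum_congr rfl e3, sum_add_distrib, ← hS.expand (G τ) i, sum_ite_eq' _ 1, if_pos h1]

/-- The equation of order `m + 1` of a formal expansion. -/
def OrderEq (n : ℕ) (k1 k2 k31 k32 : ℝ) (w : ℕ → ℝ) (Q : ℕ → ℝ → Fin (2 * n) → ℝ) (m : ℕ) :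
    Prop :=
  ∀ τ i, ∑ x ∈ antidiagonal m, (∑ y ∈ antidiagonal x.1, w y.1 * w y.2) *
      iteratedDeriv 2 (fun s => Q x.2 s i) τ =
    (∑ p, chainMatrix n k1 k2 k31 k32 i p * Q m τ p) +
      if 2 ≤ m then ∑ x ∈ antidiagonal (m - 2), ∑ y ∈ antidiagonal x.2,
        Q x.1 τ i * (Q y.1 τ i * Q y.2 τ i) else 0

theorem OrderEq.congr {w w' : ℕ → ℝ} {Q Q' : ℕ → ℝ → Fin (2 * n) → ℝ} {m : ℕ}
    (hw : ∀ a ≤ m, w a = w' a) (hQ : ∀ a ≤ m, Q a = Q' a)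
    (h : OrderEq n k1 k2 k31 k32 w Q m) : OrderEq n k1 k2 k31 k32 w' Q' m := by
  intro τ i
  have := h τ i
  rw [hQ m le_rfl] at this
  refine Eq.trans (sum_congr rfl fun x hx => ?_) (this.trans ?_)
  · rw [HasAntidiagonal.mem_antidiagonal] at hx
    rw [hQ x.2 (by omega)]
    congr 1
    refine sum_congr rfl fun y hy => ?_
    rw [HasAntidiagonal.mem_antidiagonal] at hy
    rw [hw y.1 (by omega), hw y.2 (by omega)]
  · congr 1
    refine if_ctx_congr Iff.rfl (fun h2 => sum_congr rfl fun x hx => sum_congr rfl fun y hy => ?_)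
      fun _ => rfl
    rw [HasAntidiagonal.mem_antidiagonal] at hx hy
    rw [hQ x.1 (by omega), hQ y.1 (by omega), hQ y.2 (by omega)]

/-- The conditions on the terms of order at most `m` of a normalized expansion. -/
structure IsPartial (n : ℕ) (k1 k2 k31 k32 : ℝ) (Ω : ℕ → ℝ) (u : ℕ → Fin (2 * n) → ℝ) (m : ℕ)
    (s : ℕ → ℝ × (ℝ → Fin (2 * n) → ℝ)) : Prop where
  mem : ∀ i, (fun τ => (s m).2 τ i) ∈ oddCos
  zero : m = 0 → s 0 = (Ω 1, fun τ i => unitState (u 1) i * (2 * Real.cos τ))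
  normalized : m ≠ 0 → cosCoef 1 (fun τ => ∑ i, unitState (u 1) i * (s m).2 τ i) = 0
  eq : OrderEq n k1 k2 k31 k32 (fun a => (s a).1) (fun a => (s a).2) m

theorem iteratedDeriv_const_mul_two_cos (x τ : ℝ) :
    iteratedDeriv 2 (fun s => x * (2 * Real.cos s)) τ = -(x * (2 * Real.cos τ)) := by
  have e : (fun s => x * (2 * Real.cos s)) = fun s => (x * 2) * Real.cos (1 * s) := by
    ext s; rw [one_mul]; ring
  rw [e, iteratedDeriv_const_mul_field, iteratedDeriv_two_cos]
  simp
  ring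

theorem IsSpectrum.isPartial_zero (hS : IsSpectrum n k1 k2 k31 k32 n1 n2 Ω u)
    (h1 : 1 ∈ Icc 1 (2 * n)) (s : ℕ → ℝ × (ℝ → Fin (2 * n) → ℝ))
    (hs : s 0 = (Ω 1, fun τ i => unitState (u 1) i * (2 * Real.cos τ))) :
    IsPartial n k1 k2 k31 k32 Ω u 0 s where
  mem i := by
    rw [hs]
    exact const_mul_mem_oddCos _ two_cos_mem_oddCos
  zero _ := hs
  normalized h := absurd rfl h
  eq := by
    intro τ i
    have h := congrFun (hS.unitState_eigen h1) i
    simp only [Matrix.mulVec, dotProduct, Pi.smul_apply, smul_eq_mul] at h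
    simp only [HasAntidiagonal.antidiagonal_zero, sum_singleton, hs,
      iteratedDeriv_const_mul_two_cos, ← mul_assoc (chainMatrix n k1 k2 k31 k32 i _)]
    rw [← sum_mul, h, if_neg (by omega)]
    ring

/-- The unknown frequency term enters the equation of order `m` only through a multiple of the first
mode times `2 cos τ`, which is precisely the freedom `μ` of the linear problem; it is therefore `μ /
(2 Ω 1)`. -/
theorem IsSpectrum.exists_partial_succ (hS : IsSpectrum n k1 k2 k31 k32 n1 n2 Ω u) (hk1 : 0 < k1)
    (hk12 : k1 < k2) (hn1 : 1 ≤ n1) {m : ℕ} (hm : m ≠ 0) (s : ℕ → ℝ × (ℝ → Fin (2 * n) → ℝ))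
    (hs : ∀ a < m, IsPartial n k1 k2 k31 k32 Ω u a s) :
    ∃ x, IsPartial n k1 k2 k31 k32 Ω u m (Function.update s m x) := by
  have hcnt := hS.count
  have h1 : 1 ∈ Icc 1 (2 * n) := by simp only [mem_Icc]; omega
  have hpos := hS.pos 1 h1
  have h0 := (hs 0 (by omega)).zero rfl
  set fl : Finset (ℕ × ℕ) := (antidiagonal m).filter fun x => x.1 ≠ 0 ∧ x.2 ≠ 0 with hfl
  have hflm : ∀ x ∈ fl, x.1 < m ∧ x.2 < m := by
    intro x hx
    rw [hfl, mem_filter, HasAntidiagonal.mem_antidiagonal] at hx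
    omega
  set I : ℝ := ∑ y ∈ fl, (s y.1).1 * (s y.2).1 with hI
  -- The forcing collects all terms of lower order, including the part `I` of the order-`m`
  -- coefficient of `ω²` that is already known.
  set G : ℝ → Fin (2 * n) → ℝ := fun τ i =>
    (if 2 ≤ m then ∑ x ∈ antidiagonal (m - 2), ∑ y ∈ antidiagonal x.2,
        (s x.1).2 τ i * ((s y.1).2 τ i * (s y.2).2 τ i) else 0) -
      (∑ x ∈ fl, (∑ y ∈ antidiagonal x.1, (s y.1).1 * (s y.2).1) *
        iteratedDeriv 2 (fun t => (s x.2).2 t i) τ) +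
      I * (unitState (u 1) i * (2 * Real.cos τ)) with hGdef
  have hG : ∀ i, (fun τ => G τ i) ∈ oddCos := by
    intro i
    refine oddCos.add_mem (oddCos.sub_mem ?_ ?_) ?_
    · split_ifs
      · refine sum_mem_oddCos _ fun x hx => sum_mem_oddCos _ fun y hy => ?_
        rw [HasAntidiagonal.mem_antidiagonal] at hx hy
        exact triple_mem_oddCos ((hs _ (by omega)).mem i) ((hs _ (by omega)).mem i)
          ((hs _ (by omega)).mem i)
      · exact oddCos.zero_mem
    · refine sum_mem_oddCos _ fun x hx => const_mul_mem_oddCos _ ?_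
      exact iteratedDeriv_two_mem_oddCos ((hs _ (hflm x hx).2).mem i)
    · exact const_mul_mem_oddCos _ (const_mul_mem_oddCos _ two_cos_mem_oddCos)
  obtain ⟨Y, hY, hY1, μ, hμ⟩ := hS.exists_mode_solution hk1 hk12 hn1 hG
  refine ⟨(μ / (2 * Ω 1), Y), ?_⟩
  set s' := Function.update s m (μ / (2 * Ω 1), Y) with hs'
  have hlt : ∀ a < m, s' a = s a := fun a ha => Function.update_of_ne (by omega) _ _
  have hsm : s' m = (μ / (2 * Ω 1), Y) := Function.update_self _ _ _
  refine ⟨?_, fun h => absurd h hm, fun _ => ?_, ?_⟩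
  · rw [hsm]; exact hY
  · rw [hsm]; exact hY1
  · intro τ i
    have hW : ∑ y ∈ antidiagonal m, (s' y.1).1 * (s' y.2).1 = μ + I := by
      rw [sum_antidiagonal_eq_ends hm, hlt 0 (by omega), h0, hsm]
      have : ∑ y ∈ fl, (s' y.1).1 * (s' y.2).1 = I := sum_congr rfl fun y hy => by
        rw [hlt _ (hflm y hy).1, hlt _ (hflm y hy).2]
      rw [this]
      field_simp
      ring
    have hfil : ∑ x ∈ fl, (∑ y ∈ antidiagonal x.1, (s' y.1).1 * (s' y.2).1) *
        iteratedDeriv 2 (fun t => (s' x.2).2 t i) τ =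
        ∑ x ∈ fl, (∑ y ∈ antidiagonal x.1, (s y.1).1 * (s y.2).1) *
          iteratedDeriv 2 (fun t => (s x.2).2 t i) τ := by
      refine sum_congr rfl fun x hx => ?_
      rw [hlt _ (hflm x hx).2]
      congr 1
      refine sum_congr rfl fun y hy => ?_
      rw [HasAntidiagonal.mem_antidiagonal] at hy
      have := (hflm x hx).1
      rw [hlt y.1 (by omega), hlt y.2 (by omega)]
    have hcub : (if 2 ≤ m then ∑ x ∈ antidiagonal (m - 2), ∑ y ∈ antidiagonal x.2,
        (s' x.1).2 τ i * ((s' y.1).2 τ i * (s' y.2).2 τ i) else 0) =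
        if 2 ≤ m then ∑ x ∈ antidiagonal (m - 2), ∑ y ∈ antidiagonal x.2,
          (s x.1).2 τ i * ((s y.1).2 τ i * (s y.2).2 τ i) else 0 := by
      split_ifs
      · refine sum_congr rfl fun x hx => sum_congr rfl fun y hy => ?_
        rw [HasAntidiagonal.mem_antidiagonal] at hx hy
        rw [hlt x.1 (by omega), hlt y.1 (by omega), hlt y.2 (by omega)]
      · rfl
    have h := hμ τ i
    simp only [hGdef] at h
    rw [hcub, sum_antidiagonal_eq_ends hm, ← hfl, hfil]
    simp only [HasAntidiagonal.antidiagonal_zero, sum_singleton]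
    rw [hW, hlt 0 (by omega), hsm, h0]
    simp only [iteratedDeriv_const_mul_two_cos]
    linear_combination h

theorem IsSpectrum.exists_isExpansion (hS : IsSpectrum n k1 k2 k31 k32 n1 n2 Ω u) (hk1 : 0 < k1)
    (hk12 : k1 < k2) (hn1 : 1 ≤ n1) :
    ∃ (w : ℕ → ℝ) (Q : ℕ → ℝ → Fin (2 * n) → ℝ) (c : ℕ → ℕ → ℕ → ℝ),
      IsExpansion n k1 k2 k31 k32 Ω u w Q c := by
  have hcnt := hS.count
  have h1 : 1 ∈ Icc 1 (2 * n) := by simp only [mem_Icc]; omega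
  obtain ⟨s, hs⟩ := exists_seq_of_step (P := IsPartial n k1 k2 k31 k32 Ω u)
    (fun m s s' h hp => by
      refine ⟨?_, fun hm => ?_, ?_, hp.eq.congr (fun a ha => by rw [h a ha])
        fun a ha => by rw [h a ha]⟩
      · rw [← h m le_rfl]; exact hp.mem
      · rw [← h 0 (by omega)]; exact hp.zero hm
      · rw [← h m le_rfl]; exact hp.normalized)
    (fun m s hp => by
      rcases eq_or_ne m 0 with rfl | hm
      · exact ⟨_, hS.isPartial_zero h1 _ (Function.update_self _ _ _)⟩
      · exact hS.exists_partial_succ hk1 hk12 hn1 hm s hp)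
  have h0 := (hs 0).zero rfl
  have hc : ∀ m i, Continuous fun τ => (s m).2 τ i := fun m i =>
    (contDiff_of_mem_oddCos ((hs m).mem i)).continuous
  refine ⟨fun m => (s m).1, fun m => (s m).2,
    fun m k j => cosCoef k fun τ => ∑ i, unitState (u j) i * (s m).2 τ i, ?_⟩
  refine ⟨fun m i => contDiff_of_mem_oddCos ((hs m).mem i), fun m τ i => ?_, ?_, ?_, ?_,
    fun m hm => (hs m).normalized (by omega), fun τ i => ?_⟩
  · have h := hasSum_of_mem_oddCos ((hs m).mem i) τ
    have e : ∀ k : ℕ, ∑ j ∈ Icc 1 (2 * n),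
        cosCoef (k + 1) (fun τ => ∑ i, unitState (u j) i * (s m).2 τ i) * unitState (u j) i *
          (2 * Real.cos (((k : ℝ) + 1) * τ)) =
        cosCoef (k + 1) (fun τ => (s m).2 τ i) * (2 * Real.cos (((k : ℝ) + 1) * τ)) := by
      intro k
      rw [← sum_mul, hS.expand (fun i => cosCoef (k + 1) (fun τ => (s m).2 τ i)) i]
      congr 1
      refine sum_congr rfl fun j _ => ?_
      rw [cosCoef_sum_mul _ _ _ fun i _ => hc m i]
    simp only [e]
    exact h
  · rw [h0]
  · intro τ i; rw [h0]
  · simp only [h0, ← mul_assoc (unitState (u 1) _), ← sum_mul]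
    rw [cosCoef_const_mul, hS.orthonormal h1 h1, if_pos rfl, one_mul]
    have := cosCoef_two_cos 0 (k := 1) le_rfl
    simp only [Nat.cast_zero, zero_add, one_mul, if_true] at this
    rw [cosCoef_const_mul] at this
    exact this
  · ext m
    -- Because `Q` starts at order one in `ε`, the coefficient of `ε^0` is trivial and that of `ε^(m
    -- + 1)` is the equation of order `m`.
    rcases m with _ | m
    · simp [mul_left_comm _ PowerSeries.X, mul_pow]
    · have h := (hs m).eq τ i
      rw [mul_left_comm, PowerSeries.coeff_succ_X_mul, PowerSeries.coeff_mul, map_add, map_sum]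
      simp only [mul_left_comm _ PowerSeries.X]
      simp only [PowerSeries.coeff_C_mul, PowerSeries.coeff_succ_X_mul, PowerSeries.coeff_mk,
        coeff_sq_mk]
      rw [h, mul_pow, PowerSeries.coeff_X_pow_mul', coeff_cube_mk]
      congr 1
      refine if_congr (by omega) ?_ rfl
      rw [show m + 1 - 3 = m - 2 by omega]

end Existence
end DiatomicChain
end

/-! ### Choice of constants and the conclusion. -/

noncomputable section
namespace DiatomicChain
open Finset

theorem rpow_five_halves (n : ℕ) : (n : ℝ) ^ (5 / 2 : ℝ) = (n : ℝ) ^ 2 * √n := by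
  rcases Nat.eq_zero_or_pos n with rfl | h
  · norm_num
  · have : (0 : ℝ) < n := by exact_mod_cast h
    rw [Real.sqrt_eq_rpow, ← Real.rpow_natCast, ← Real.rpow_add this]
    norm_num

theorem majorant_eq (k1 k2 C1 : ℝ) (n : ℕ) {m : ℕ} (hm : 1 ≤ m) :
    majorant k1 k2 C1 n m = C1 * weight (growth k1 k2 * n) m := by
  rw [majorant, weight_of_pos hm, mul_pow]
  ring

theorem exists_isLarge {f c2 K K' g : ℝ} (hK' : 0 < K') (hK : 0 < K)
    (h : K' * f * g = 208 * K + 2) : ∃ N : ℕ, 1 ≤ N ∧ ∀ n, N ≤ n → IsLarge n f c2 K K' g := by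
  obtain ⟨N, hN⟩ := exists_nat_gt (max (max (1200 * K') 1025) (80 * c2 ^ 2 * f))
  refine ⟨N + 1, by omega, fun n hn => ?_⟩
  have hn' : (N : ℝ) ≤ n := by exact_mod_cast (by omega : N ≤ n)
  have h1 : 1200 * K' < n :=
    (((le_max_left _ _).trans (le_max_left _ _)).trans_lt hN).trans_le hn'
  have h2 : 1025 < (n : ℝ) :=
    (((le_max_right _ _).trans (le_max_left _ _)).trans_lt hN).trans_le hn'
  have h3 : 80 * c2 ^ 2 * f < n := ((le_max_right _ _).trans_lt hN).trans_le hn'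
  have h4 : 28 * K' / n < 1 := by
    rw [div_lt_one (by linarith)]
    linarith
  have h5 : 32 / √(n : ℝ) < 1 := by
    have : 32 < √(n : ℝ) := by
      rw [Real.lt_sqrt (by norm_num)]
      linarith
    rw [div_lt_one (by linarith)]
    exact this
  refine ⟨h1.le, ?_, ?_, ?_⟩
  · nlinarith
  · rw [h]; linarith
  · rw [h]; linarith

end DiatomicChain
end

theorem mainTheorem2 (k1 k2 k31 k32 : ℝ) (hk1 : 0 < k1) (hk12 : k1 < k2)
    (hk31 : 0 < k31) (hk32 : 0 < k32) (hk31' : k31 ≠ 2 * k2) (hk32' : k32 ≠ 2 * k2) :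
    ∃ N : ℕ, ∀ C1 : ℝ, 0 < C1 → ∃ C2 C3 C4 δ : ℝ,
      0 < C2 ∧ 0 < C3 ∧ 0 < C4 ∧ 0 < δ ∧
      C1 * C3 = 1 / 16 ∧
      27 * k1 * k2 / (320 * Real.sqrt (2 * k2) * (k2 - k1)) + δ < C1 * C2 ∧
      C1 * C2 = 7 * k1 * k2 / (80 * Real.sqrt (2 * k2) * (k2 - k1)) ∧
      C1 * C2 < Real.pi ^ 2 * k1 * k2 / (64 * Real.sqrt (2 * k2) * (k2 - k1)) - δ ∧
      ∀ n : ℕ, N ≤ n → ∀ (n1 n2 : ℕ) (Ω : ℕ → ℝ) (u : ℕ → Fin (2 * n) → ℝ),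
        DiatomicChain.IsSpectrum n k1 k2 k31 k32 n1 n2 Ω u →
        (∃ (w : ℕ → ℝ) (Q : ℕ → ℝ → Fin (2 * n) → ℝ) (c : ℕ → ℕ → ℕ → ℝ),
          DiatomicChain.IsExpansion n k1 k2 k31 k32 Ω u w Q c) ∧
        ∀ (w : ℕ → ℝ) (Q : ℕ → ℝ → Fin (2 * n) → ℝ) (c : ℕ → ℕ → ℕ → ℝ),
          DiatomicChain.IsExpansion n k1 k2 k31 k32 Ω u w Q c →
          ∀ m : ℕ, 1 ≤ m →
            |w (2 * m)| < C2 * DiatomicChain.majorant k1 k2 C1 n m / (n : ℝ) ^ 2 ∧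
            ∑ j ∈ DiatomicChain.D1 n1, |c (2 * m) 1 j|
              < C3 * DiatomicChain.majorant k1 k2 C1 n m ∧
            ∑ j ∈ DiatomicChain.D2 n n2, |c (2 * m) 1 j|
              < C4 * DiatomicChain.majorant k1 k2 C1 n m / (n : ℝ) ∧
            ∑ j ∈ DiatomicChain.D3 n n1 n2, |c (2 * m) 1 j|
              < C4 * DiatomicChain.majorant k1 k2 C1 n m / (n : ℝ) ^ (5 / 2 : ℝ) ∧
            ∀ l : ℕ, 1 ≤ l →
              ∑ j ∈ Finset.Icc 1 n1, |c (2 * m) (2 * l + 1) j|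
                < C4 * DiatomicChain.majorant k1 k2 C1 n m
                    / ((n : ℝ) * (2 * (l : ℝ) + 1) ^ 2) ∧
              ∑ j ∈ DiatomicChain.D2 n n2, |c (2 * m) (2 * l + 1) j|
                < C4 * DiatomicChain.majorant k1 k2 C1 n m
                    / ((n : ℝ) * (2 * (l : ℝ) + 1) ^ 2) ∧
              ∑ j ∈ DiatomicChain.D3 n n1 n2, |c (2 * m) (2 * l + 1) j|
                < C4 * DiatomicChain.majorant k1 k2 C1 n m
                    / ((n : ℝ) ^ (5 / 2 : ℝ) * (2 * (l : ℝ) + 1) ^ 2) := by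
  obtain ⟨d, hd, K, hK, N0, hN0⟩ :=
    DiatomicChain.exists_specBounds hk1 hk12 hk31 hk32 hk31' hk32'
  have hk2 := hk1.trans hk12
  have hk := sub_pos.mpr hk12
  have hf := DiatomicChain.growth_pos hk1 hk12
  have hs : 0 < Real.sqrt (2 * k2) := by positivity
  set f := DiatomicChain.growth k1 k2 with hfdef
  set g := min (2 * (k2 - k1)) (min d k2) with hgdef
  have hg : 0 < g := lt_min (by linarith) (lt_min hd hk2)
  have hg1 : g ≤ 2 * (k2 - k1) := min_le_left _ _
  have hg2 : g ≤ d := (min_le_right _ _).trans (min_le_left _ _)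
  have hg3 : g ≤ k2 := (min_le_right _ _).trans (min_le_right _ _)
  set A := k1 * k2 / (Real.sqrt (2 * k2) * (k2 - k1)) with hA
  have hA0 : 0 < A := by positivity
  set c2 := 7 * k1 * k2 / (80 * Real.sqrt (2 * k2) * (k2 - k1)) with hc2def
  have hc2 : 0 < c2 := by positivity
  have hc2A : c2 = 7 / 80 * A := by
    rw [hc2def, hA]
    field_simp
  have hc : 2 * Real.sqrt (2 * k2) * c2 * f = 7 := by
    rw [hc2def, hfdef, DiatomicChain.growth]
    field_simp
    norm_num
  -- Then `K' f g` exceeds `208 K` by `2`; for large `n` the lower-order terms in `IsLarge.gap` and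
  -- `IsLarge.band` use at most that margin.
  set K' := (208 * K + 2) / (f * g) with hK'def
  have hK' : 0 < K' := by positivity
  have hK'e : K' * f * g = 208 * K + 2 := by
    rw [hK'def]
    field_simp
  obtain ⟨N1, hN1, hL⟩ := DiatomicChain.exists_isLarge (c2 := c2) hK' hK hK'e
  -- All bounds depend on `C1` only through its products with the other constants, so `N` can be
  -- chosen first. The value of `δ` works because `27 / 320`, `7 / 80` and `9 / 64 < π² / 64` are
  -- more than `1 / 1000` apart.
  refine ⟨max N0 N1, fun C1 hC1 => ⟨c2 / C1, 1 / 16 / C1, K' / C1, A / 1000, by positivity,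
    by positivity, by positivity, by positivity, by field_simp, ?_, by field_simp, ?_, ?_⟩⟩
  · have e : 27 * k1 * k2 / (320 * Real.sqrt (2 * k2) * (k2 - k1)) = 27 / 320 * A := by
      rw [hA]
      field_simp
    rw [e, mul_div_cancel₀ _ hC1.ne', hc2A]
    linarith
  · have e : Real.pi ^ 2 * k1 * k2 / (64 * Real.sqrt (2 * k2) * (k2 - k1)) =
        Real.pi ^ 2 / 64 * A := by
      rw [hA]
      field_simp
    have hpi : 9 < Real.pi ^ 2 := by nlinarith [Real.pi_gt_three]
    have := mul_lt_mul_of_pos_right hpi hA0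
    rw [e, mul_div_cancel₀ _ hC1.ne', hc2A]
    linarith
  · intro n hn n1 n2 Ω u hS
    have hB := hN0 n ((le_max_left _ _).trans hn) n1 n2 Ω u hS
    have hLn := hL n ((le_max_right _ _).trans hn)
    refine ⟨hS.exists_isExpansion hk1 hk12 hB.one_le, fun w Q c hE m hm => ?_⟩
    have hR := hE.isReduced hS hk1 hk12 hB.one_le
    have hO := DiatomicChain.orderBounds hk1 hk12 hS hB hR hc2 hc hK' hK hg hg1 hg2 hg3 hLn m hm
    rw [DiatomicChain.majorant_eq k1 k2 C1 n hm, DiatomicChain.rpow_five_halves]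
    have e : ∀ x y : ℝ, x / C1 * (C1 * y) = x * y := by
      intro x y
      field_simp
    simp only [e]
    refine ⟨hO.freq, ?_, ?_, ?_, fun l hl => ?_⟩
    · have := hO.first
      linarith
    · simpa using hO.acoustic 1 le_rfl
    · simpa using hO.gap 1 le_rfl
    · have h1 := hO.optical (2 * l + 1) (by omega)
      have h2 := hO.acoustic (2 * l + 1) (by omega)
      have h3 := hO.gap (2 * l + 1) (by omega)
      push_cast at h1 h2 h3
      rw [div_div] at h1 h2 h3
      exact ⟨h1, h2, h3⟩
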